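/- **Setting.** Let $n\ge 2$ be fixed. Let $\mathcal V$ be a hereditarily Lindelöf topological space (e.g. a separable metric space) with a σ-algebra containing the open sets, $\mathcal X$ a countable discrete set, and $k:\mathcal X\times\mathcal V\times\mathcal V\to[0,1]$ measurable with $\sum_{x}k(x,v_1,v_2)=1$ for all $v_1,v_2$. *Round-robin graph.* Let $N>4n$ be even. Place the nodes $1,\dots,N$ at places $1,\dots,N$, node $i$ at place $i$. A round-robin move leaves the node at place $1$ fixed and moves the node at place $2$ to place $3$, the node at an odd place $3\le p<N-1$ to $p+2$, the node at place $N-1$ to $N$, and the node at an even place $p>2$ to $p-2$. At each time $t=1,\dots,n$ (with $t-1$ moves made before time $t$) the nodes standing at places $2a-1$ and $2a$, $1\le a\le N/2$, are paired. The edge set $E^{n,N}$ is the set of all pairs so obtained, each written $(i,j)$ with $i<j$. *Layers.* Let $d$ be the graph distance and $\mathrm{om}(n,N)+1=\max_i d(1,i)$. Let $V^{n,N}_q$ be the family of the weights $V_i$ with $d(1,i)=q$, and $X_q^{n,N}$ the family of the $X_{i,j}$, $(i,j)\in E^{n,N}$, with endpoints either at distances $q$ and $q+1$ from $1$, or both at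 distance $q+1$. *Model.* For a probability measure $\pi$ on $\mathcal V$, $\mathbb P^{n,N}_\pi$ is the joint law of $(X^{n,N},V)$ with $X^{n,N}=(X_{i,j})_{(i,j)\in E^{n,N}}$, $V=(V_1,\dots,V_N)$, given by $$\mathbb P^{n,N}_\pi(X^{n,N}=x,\,V\in A)=\int_A\prod_{(i,j)\in E^{n,N}}k(x_{i,j},v_i,v_j)\,\pi^{\otimes N}(dv).$$ Write $\mathbb P^{n,N}_\pi(x)=\mathbb P^{n,N}_\pi(X^{n,N}=x)$, and $\mathbb P^{n,N}_\pi(X_q\mid X_{q+1:\mathrm{om}(n,N)-1})$ for the elementary conditional probability, evaluated at the observations, of the layer $X_q$ given the layers $X_{q+1},\dots,X_{\mathrm{om}(n,N)-1}$. *Assumption H1* for a set $\Pi$ of probability measures on $\mathcal V$ and a probability measure $\pi_\star$: there is $\varepsilon>0$ such that $k(x,v_1,v_2)\ge\varepsilon$ for all $x\in\mathcal X$, all $\pi\in\Pi\cup\{\pi_\star\}$ and all $v_1,v_2\in\mathrm{supp}(\pi)$. *Stationary extension.* List the weights of a node layer by increasing label and the observations of an edge layer in the lexicographic order of $(i,j)$.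 A stationary extension of the model with law $\pi_\star$ consists of random elements $(X^{n,N},V^{n,N})$ with law $\mathbb P^{n,N}_{\pi_\star}$, for all even $N>4n$, and a stationary process $(\mathbf X^n_z,\mathbf V^n_z)_{z\in\mathbb Z}$ with values in $\mathcal X^{n(n-1)}\times\mathcal V^{2(n-1)}$, all on one probability space, such that for all these $N$ and all $2\le q\le \mathrm{om}(n,N)-2$, almost surely $\mathbf X^n_q=X^{n,N}_q$ and $\mathbf V^n_q=V^{n,N}_q$. Let $(\vartheta x)_z=x_{z+1}$ be the shift on $(\mathcal X^{n(n-1)})^{\mathbb Z}$. **Theorem.** There are functions $\ell^n_\pi:(\mathcal X^{n(n-1)})^{\mathbb Z}\to\mathbb R$, indexed by the probability measures $\pi$ on $\mathcal V$ and depending only on $n$, $k$ and $\pi$, such that for all $\Pi$ and $\pi_\star$ satisfying H1: 1. a stationary extension of the model with law $\pi_\star$ exists, and $\ell^n_\pi$ is measurable for every $\pi\in\Pi$; 2. for every stationary extension and every $q\ge2$, almost surely, as $N\to\infty$ along the even integers, $$\sup_{\pi\in\Pi}\Bigl|\log\mathbb P^{n,N}_\pi\bigl(X^{n,N}_q\mid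 X^{n,N}_{q+1:\mathrm{om}(n,N)-1}\bigr)-\ell^n_\pi(\vartheta^q\mathbf X^n)\Bigr|\longrightarrow0;$$ 3. for every stationary extension and every $\pi\in\Pi$, $\ell^n_\pi(\mathbf X^n)$ is integrable and, almost surely and in $L^1$, as $N\to\infty$ along the even integers, $$\frac1{\mathrm{om}(n,N)}\log\mathbb P^{n,N}_\pi(X^{n,N})\longrightarrow \mathsf L^n_{\pi_\star}(\pi)=\mathbb E_{\pi_\star}\bigl[\ell^n_\pi(\mathbf X^n)\bigr].$$ -/

import Mathlib

open MeasureTheory ProbabilityTheory Filter Topology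
open scoped ENNReal

universe u v w

noncomputable section

namespace RoundRobin

/-! ## The round-robin graph on the nodes `1, …, N` (`N` even) -/

/-- One round-robin move: the place taken by whoever stands at place `p`. Place `1` is fixed,
`2` moves to `3`, an odd place `p < N - 1` moves to `p + 2`, `N - 1` moves to `N`, and an even
place `p > 2` moves to `p - 2`. -/
def move (N p : ℕ) : ℕ :=
  if p = 1 then 1
  else if p = 2 then 3
  else if Odd p then (if p + 1 < N then p + 2 else N)
  else p - 2

/-- The round-robin graph: at time `t + 1` the node `i` stands at place `(move N)^[t] i`, and the
nodes that stand at places `2a - 1` and `2a` are paired; the graph collects all the pairs of the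
times `1, …, n`. Natural numbers outside `{1, …, N}` are isolated and never used. -/
def graph (n N : ℕ) : SimpleGraph ℕ where
  Adj i j := i ≠ j ∧ (1 ≤ i ∧ i ≤ N) ∧ (1 ≤ j ∧ j ≤ N) ∧
    ∃ t < n, ((move N)^[t] i + 1) / 2 = ((move N)^[t] j + 1) / 2
  symm := ⟨fun _ _ ⟨h, hi, hj, t, ht, e⟩ => ⟨h.symm, hj, hi, t, ht, e.symm⟩⟩
  loopless := ⟨fun _ h => h.1 rfl⟩

/-- The nodes `1, …, N`. -/
abbrev Node (N : ℕ) : Type := {i : ℕ // i ∈ Finset.Icc 1 N}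

/-- The edges `{i, j}` of the round-robin graph, written as pairs `(i, j)` with `i < j` and
ordered lexicographically. -/
abbrev Edge (n N : ℕ) : Type :=
  {e : Node N ×ₗ Node N // (ofLex e).1 < (ofLex e).2 ∧
    (graph n N).Adj ((ofLex e).1 : ℕ) ((ofLex e).2 : ℕ)}

/-- The smaller endpoint of an edge. -/
def Edge.fst {n N : ℕ} (e : Edge n N) : Node N := (ofLex e.1).1

/-- The larger endpoint of an edge. -/
def Edge.snd {n N : ℕ} (e : Edge n N) : Node N := (ofLex e.1).2

instance (N : ℕ) : Finite (Node N ×ₗ Node N) :=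
  inferInstanceAs (Finite (Node N × Node N))

instance (n N : ℕ) : Fintype (Edge n N) := Fintype.ofFinite _

/-- The graph distance between the node `1` and the node `i`. -/
def depth (n : ℕ) {N : ℕ} (i : Node N) : ℕ := (graph n N).dist 1 i

/-- `orderMax n N + 1` is the maximal distance to the node `1`. -/
def orderMax (n N : ℕ) : ℕ := (Finset.univ.sup fun i : Node N => depth n i) - 1

/-- The `q`-th layer of nodes: those at distance `q` from the node `1`. -/
def nodeLayer (n N q : ℕ) : Finset (Node N) := Finset.univ.filter fun i => depth n i = q

/-- The `q`-th layer of edges: those between the node layers `q` and `q + 1`, and those inside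
the node layer `q + 1`. -/
def edgeLayer (n N q : ℕ) : Finset (Edge n N) :=
  Finset.univ.filter fun e =>
    (depth n e.fst = q ∧ depth n e.snd = q + 1) ∨
    (depth n e.fst = q + 1 ∧ depth n e.snd = q) ∨
    (depth n e.fst = q + 1 ∧ depth n e.snd = q + 1)

/-- The union of the edge layers `q, q + 1, …, r`. -/
def edgeLayers (n N q r : ℕ) : Finset (Edge n N) :=
  (Finset.Icc q r).biUnion fun p => edgeLayer n N p

/-! ## The random graph model and its likelihoods -/

section Model

variable {𝒱 : Type u} {𝒳 : Type v} [MeasurableSpace 𝒱] [MeasurableSpace 𝒳]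

/-- The joint law of the observations and the latent weights when the latter are i.i.d. with law
`π`: the measure `(x, A) ↦ ∫_A ∏_{(i,j)} k(x_{ij}, v_i, v_j) π^{⊗ N}(dv)`. -/
def jointLaw (k : 𝒳 → 𝒱 → 𝒱 → ℝ) (n N : ℕ) (π : Measure 𝒱) :
    Measure ((Edge n N → 𝒳) × (Node N → 𝒱)) :=
  (Measure.count.prod (Measure.pi fun _ : Node N => π)).withDensity fun p =>
    ∏ e : Edge n N, ENNReal.ofReal (k (p.1 e) (p.2 e.fst) (p.2 e.snd))

/-- The law of the observations. -/
def obsLaw (k : 𝒳 → 𝒱 → 𝒱 → ℝ) (n N : ℕ) (π : Measure 𝒱) : Measure (Edge n N → 𝒳) :=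
  (jointLaw k n N π).map Prod.fst

/-- The log-likelihood `log P_π(X = x)`. -/
def logLik (k : 𝒳 → 𝒱 → 𝒱 → ℝ) (n N : ℕ) (π : Measure 𝒱) (x : Edge n N → 𝒳) : ℝ :=
  Real.log ((obsLaw k n N π).real {x})

/-- The conditional log-likelihood `log P_π(X_q = x_q | X_p = x_p, q < p ≤ orderMax - 1)` of the
`q`-th edge layer given the following ones, up to `orderMax n N - 1`. -/
def condLogLik (k : 𝒳 → 𝒱 → 𝒱 → ℝ) (n N : ℕ) (π : Measure 𝒱) (q : ℕ) (x : Edge n N → 𝒳) : ℝ :=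
  Real.log ((obsLaw k n N π)[|{y | ∀ e ∈ edgeLayers n N (q + 1) (orderMax n N - 1), y e = x e}].real
    {y | ∀ e ∈ edgeLayer n N q, y e = x e})

/-- The mixing assumption over a set `P` of laws: there is `ε > 0` with `k(x, v₁, v₂) ≥ ε` for all
`x`, all `π ∈ P` and all `v₁, v₂` in the support of `π`. -/
def Mixing [TopologicalSpace 𝒱] (k : 𝒳 → 𝒱 → 𝒱 → ℝ) (P : Set (ProbabilityMeasure 𝒱)) : Prop :=
  ∃ ε : ℝ, 0 < ε ∧ ∀ x : 𝒳, ∀ π ∈ P,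
    ∀ v₁ ∈ (π : Measure 𝒱).support, ∀ v₂ ∈ (π : Measure 𝒱).support, ε ≤ k x v₁ v₂

/-- On one probability space: for all even `N > 4n`, latent weights and observations with the law
`P_{π⋆}` of the model on the round-robin graph, and a process `(Xinf, Vinf)` indexed by `ℤ`,
stationary, that extends the chain of the bulk layers `(X_q, V_q)`, `2 ≤ q ≤ orderMax n N - 2`.
The layers are read as vectors by listing the nodes in increasing order and the edges in
lexicographic order. (Stationarity and the extension property determine the law of the process, and
with it its transition kernel.) -/
structure StationaryExtension {Ω : Type w} [MeasurableSpace Ω] (μ : Measure Ω)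
    (k : 𝒳 → 𝒱 → 𝒱 → ℝ) (n : ℕ) (πstar : Measure 𝒱) where
  /-- the latent weights `V_1, …, V_N` -/
  V (N : ℕ) : Ω → Node N → 𝒱
  /-- the observations `X^{n,N}` -/
  X (N : ℕ) : Ω → Edge n N → 𝒳
  measurable_V (N : ℕ) : Measurable (V N)
  measurable_X (N : ℕ) : Measurable (X N)
  law_eq (N : ℕ) : Even N → 4 * n < N →
    μ.map (fun ω => (X N ω, V N ω)) = jointLaw k n N πstar
  /-- the latent part of the stationary extension -/
  Vinf : Ω → ℤ → Fin (2 * (n - 1)) → 𝒱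
  /-- the observed part of the stationary extension -/
  Xinf : Ω → ℤ → Fin (n * (n - 1)) → 𝒳
  measurable_Vinf : Measurable Vinf
  measurable_Xinf : Measurable Xinf
  stationary : μ.map (fun ω (z : ℤ) => (Xinf ω (z + 1), Vinf ω (z + 1))) =
    μ.map (fun ω (z : ℤ) => (Xinf ω z, Vinf ω z))
  extends_V (N q : ℕ) : Even N → 4 * n < N → 2 ≤ q → q + 2 ≤ orderMax n N →
    ∀ᵐ ω ∂μ, List.ofFn (Vinf ω q) = ((nodeLayer n N q).sort).map (V N ω)
  extends_X (N q : ℕ) : Even N → 4 * n < N → 2 ≤ q → q + 2 ≤ orderMax n N →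
    ∀ᵐ ω ∂μ, List.ofFn (Xinf ω q) = ((edgeLayer n N q).sort).map (X N ω)

end Model

/-- The shift operator `(ϑ x)_z = x_{z+1}`. -/
def shift {S : Type*} (x : ℤ → S) : ℤ → S := fun z => x (z + 1)

/-- `N → ∞` along the even integers. -/
def evenAtTop : Filter ℕ := atTop ⊓ 𝓟 {N | Even N}

end RoundRobin

end

/-! Geometry. All nodes except `1` travel along a cycle of length `N - 1`. In the coordinate
`cyclePos`, two of them meet after `t` moves exactly when their initial coordinates add up to `-2t`
modulo `N - 1`. So the neighbours of the point `c` are its reflections `-c - 2t`, `t < n`, and the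
balls around the node `1` are arcs that grow by `n - 1` at both ends (`inBall_add_iff`). Until the
arc closes up, consecutive layers are translates of each other by `2(n - 1)` labels (`layer_add`,
`exists_node_enum`, `exists_edge_enum`). The observations of the edge layer `z` involve only the
weights of the node layers `z` and `z + 1`. The bulk is therefore a piece of a translation invariant
model on `ℤ`, the same for all `N`.

Forgetting. A likelihood is the integral of a product of layer weights with values in `[δ, 1]`,
where `δ = ε ^ (n(n-1))`. Splitting the constant `δ` off one weight makes past and future
independent on that part, as in Doeblin's minorization. The influence of a far tail on the increment
of the log-likelihood thus contracts by `1 - δ` per layer (`WeightChain.exists_ratio_bounds`,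
`WeightChain.abs_log_sub_le`). The bound depends neither on the observations nor on the tail, and on
`π` only through `ε`. Hence the increments converge to a limit `ell`, and the conditional
log-likelihoods of the finite graphs are uniformly close to it.

Law of large numbers. By the chain rule and a geometric sum of errors, the log-likelihood is a
Birkhoff sum of `ell` up to a constant (`exists_abs_logLik_sub_sum_le`); only boundedly many edges
lie outside the bulk. Now `ell` is uniformly close to functions of finitely many layers, and blocks
of layers with one layer left out between them are independent. So the strong law for pairwise
independent variables, applied along residue classes, takes the place of an ergodic theorem.
Boundedness gives the convergence in `L¹`.

The lower bound on `k` holds only on supports, which carry all the mass; `trunc` makes it global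
without changing any likelihood. It also forces `𝒳` to be finite. Stationary extensions exist
because all the graphs can be read off one array of i.i.d. weights on `ℤ` and independent uniform
variables on `ℤ × ℤ`. -/

section Forgetting

/-! ### Exponential forgetting for products of weights bounded from below. -/

variable {Ω : Type*} [mΩ : MeasurableSpace Ω] {μ : Measure Ω}

/-- Functions measurable for independent σ-algebras are uncorrelated. -/
theorem integral_mul_of_indep {m₁ m₂ : MeasurableSpace Ω} (h₁ : m₁ ≤ mΩ) (h₂ : m₂ ≤ mΩ)
    (hI : Indep m₁ m₂ μ) {f g : Ω → ℝ} (hf : Measurable[m₁] f) (hg : Measurable[m₂] g) :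
    ∫ ω, f ω * g ω ∂μ = (∫ ω, f ω ∂μ) * ∫ ω, g ω ∂μ := by
  have hfg : IndepFun f g μ :=
    indep_of_indep_of_le_left (indep_of_indep_of_le_right hI hg.comap_le) hf.comap_le
  exact hfg.integral_fun_mul_eq_mul_integral (hf.mono h₁ le_rfl).aestronglyMeasurable
    (hg.mono h₂ le_rfl).aestronglyMeasurable

/-- A chain of nonnegative weights, the `j`-th of which is a function of the past up to `j + 1` and
of the future from `j`. -/
structure WeightChain (μ : Measure Ω) (past fut : ℕ → MeasurableSpace Ω) (δ : ℝ)
    (w : ℕ → Ω → ℝ) : Prop where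
  past_le (j : ℕ) : past j ≤ mΩ
  fut_le (j : ℕ) : fut j ≤ mΩ
  past_mono : Monotone past
  fut_anti : Antitone fut
  indep (j : ℕ) : Indep (past j) (fut (j + 1)) μ
  meas_past (j : ℕ) : Measurable[past (j + 1)] (w j)
  meas_fut (j : ℕ) : Measurable[fut j] (w j)
  pos : 0 < δ
  lower (j : ℕ) (ω : Ω) : δ ≤ w j ω
  upper (j : ℕ) (ω : Ω) : w j ω ≤ 1

namespace WeightChain

variable {past fut : ℕ → MeasurableSpace Ω} {δ : ℝ} {w : ℕ → Ω → ℝ}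

theorem measurable (C : WeightChain μ past fut δ w) (j : ℕ) : Measurable (w j) :=
  (C.meas_past j).mono (C.past_le _) le_rfl

theorem le_one [IsProbabilityMeasure μ] (C : WeightChain μ past fut δ w) : δ ≤ 1 := by
  obtain ⟨ω⟩ := nonempty_of_isProbabilityMeasure μ
  exact (C.lower 0 ω).trans (C.upper 0 ω)

theorem nonneg (C : WeightChain μ past fut δ w) (j : ℕ) (ω : Ω) : 0 ≤ w j ω :=
  C.pos.le.trans (C.lower j ω)

theorem prod_mem (C : WeightChain μ past fut δ w) (s : Finset ℕ) (ω : Ω) :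
    0 ≤ ∏ j ∈ s, w j ω ∧ ∏ j ∈ s, w j ω ≤ 1 :=
  ⟨Finset.prod_nonneg fun j _ => C.nonneg j ω,
    Finset.prod_le_one (fun j _ => C.nonneg j ω) fun j _ => C.upper j ω⟩

theorem measurable_prod_fut (C : WeightChain μ past fut δ w) (p r : ℕ) :
    Measurable[fut p] fun ω => ∏ j ∈ Finset.Icc p r, w j ω := by
  refine Finset.measurable_fun_prod _ fun j hj => ?_
  exact (C.meas_fut j).mono (C.fut_anti (Finset.mem_Icc.1 hj).1) le_rfl

/-- Two-sided comparison of the tilted expectations of all functions of the past, with constants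
whose gap contracts by `1 - δ` at each step. -/
theorem exists_ratio_bounds [IsProbabilityMeasure μ] (C : WeightChain μ past fut δ w) {r : ℕ} {H : Ω → ℝ}
    (hH : Measurable[fut (r + 1)] H) (H0 : ∀ ω, 0 ≤ H ω) (H1 : ∀ ω, H ω ≤ 1) (d : ℕ) :
    ∀ p, p + d = r → ∃ a b : ℝ, δ * (∫ ω, H ω ∂μ) ≤ a ∧ a ≤ b ∧
      b - a ≤ (1 - δ) ^ d * ((∫ ω, H ω ∂μ) / δ) ∧
      ∀ φ : Ω → ℝ, Measurable[past p] φ → (∀ ω, 0 ≤ φ ω) → (∀ ω, φ ω ≤ 1) →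
        a * (∫ ω, φ ω * ∏ j ∈ Finset.Icc p r, w j ω ∂μ) ≤
            ∫ ω, φ ω * ((∏ j ∈ Finset.Icc p r, w j ω) * H ω) ∂μ ∧
          ∫ ω, φ ω * ((∏ j ∈ Finset.Icc p r, w j ω) * H ω) ∂μ ≤
            b * ∫ ω, φ ω * ∏ j ∈ Finset.Icc p r, w j ω ∂μ := by
  have hδ1 := C.le_one
  have hδ := C.pos
  have Hm : Measurable H := hH.mono (C.fut_le _) le_rfl
  have hint : ∀ f : Ω → ℝ, Measurable f → (∀ ω, 0 ≤ f ω) → (∀ ω, f ω ≤ 1) → Integrable f μ := by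
    intro f hf h0 h1
    refine Integrable.of_bound hf.aestronglyMeasurable 1 (ae_of_all _ fun ω => ?_)
    rw [Real.norm_eq_abs, abs_of_nonneg (h0 ω)]; exact h1 ω
  have hIH0 : 0 ≤ ∫ ω, H ω ∂μ := integral_nonneg H0
  induction d with
  | zero =>
    rintro p rfl
    -- With one weight left, `φ` and `H` are independent, and replacing `w p` by `1` costs at most a
    -- factor `δ` either way.
    refine ⟨δ * ∫ ω, H ω ∂μ, (∫ ω, H ω ∂μ) / δ, le_rfl, ?_, ?_, ?_⟩
    · rw [le_div_iff₀ hδ]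
      have : δ * δ ≤ 1 := by nlinarith
      nlinarith
    · have : 0 ≤ δ * ∫ ω, H ω ∂μ := by positivity
      simp only [pow_zero, one_mul]; linarith
    · intro φ hφ φ0 φ1
      have φm : Measurable φ := hφ.mono (C.past_le _) le_rfl
      simp only [add_zero, Finset.Icc_self, Finset.prod_singleton]
      have hφH : ∫ ω, φ ω * H ω ∂μ = (∫ ω, φ ω ∂μ) * ∫ ω, H ω ∂μ :=
        integral_mul_of_indep (C.past_le p) (C.fut_le _) (C.indep p) hφ hH
      have iφ := hint φ φm φ0 φ1
      have iφw : Integrable (fun ω => φ ω * w p ω) μ := hint _ (φm.mul (C.measurable p))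
        (fun ω => mul_nonneg (φ0 ω) (C.nonneg p ω))
        fun ω => mul_le_one₀ (φ1 ω) (C.nonneg p ω) (C.upper p ω)
      have iφH : Integrable (fun ω => φ ω * H ω) μ := hint _ (φm.mul Hm)
        (fun ω => mul_nonneg (φ0 ω) (H0 ω)) fun ω => mul_le_one₀ (φ1 ω) (H0 ω) (H1 ω)
      have iφwH : Integrable (fun ω => φ ω * (w p ω * H ω)) μ :=
        hint _ (φm.mul ((C.measurable p).mul Hm))
        (fun ω => mul_nonneg (φ0 ω) (mul_nonneg (C.nonneg p ω) (H0 ω)))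
        fun ω => mul_le_one₀ (φ1 ω) (mul_nonneg (C.nonneg p ω) (H0 ω))
          (mul_le_one₀ (C.upper p ω) (H0 ω) (H1 ω))
      have e1 : ∫ ω, φ ω * w p ω ∂μ ≤ ∫ ω, φ ω ∂μ := integral_mono iφw iφ fun ω =>
        mul_le_of_le_one_right (φ0 ω) (C.upper p ω)
      have e2 : δ * ∫ ω, φ ω ∂μ ≤ ∫ ω, φ ω * w p ω ∂μ := by
        rw [← integral_const_mul]
        refine integral_mono (iφ.const_mul δ) iφw fun ω => ?_
        have := mul_le_mul_of_nonneg_left (C.lower p ω) (φ0 ω)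
        simp only; linarith
      have e3 : ∫ ω, φ ω * (w p ω * H ω) ∂μ ≤ ∫ ω, φ ω * H ω ∂μ := integral_mono iφwH iφH fun ω =>
        mul_le_mul_of_nonneg_left (mul_le_of_le_one_left (H0 ω) (C.upper p ω)) (φ0 ω)
      have e4 : δ * ∫ ω, φ ω * H ω ∂μ ≤ ∫ ω, φ ω * (w p ω * H ω) ∂μ := by
        rw [← integral_const_mul]
        refine integral_mono (iφH.const_mul δ) iφwH fun ω => ?_
        have := mul_le_mul_of_nonneg_left
          (mul_le_mul_of_nonneg_right (C.lower p ω) (H0 ω)) (φ0 ω)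
        simp only; linarith
      rw [hφH] at e3 e4
      constructor
      · refine le_trans ?_ e4
        have := mul_le_mul_of_nonneg_left e1 (mul_nonneg hδ.le hIH0)
        linarith
      · refine e3.trans ?_
        rw [div_mul_eq_mul_div, le_div_iff₀ hδ]
        have := mul_le_mul_of_nonneg_left e2 hIH0
        linarith
  | succ d ih =>
    intro p hp
    obtain ⟨a, b, ha, hab, hgap, hφ'⟩ := ih (p + 1) (by omega)
    have hsplit : ∀ ω, ∏ j ∈ Finset.Icc p r, w j ω =
        w p ω * ∏ j ∈ Finset.Icc (p + 1) r, w j ω := fun ω => by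
      rw [← Finset.insert_Icc_add_one_left_eq_Icc (by omega : p ≤ r), Finset.prod_insert (by simp)]
    set W : Ω → ℝ := fun ω => ∏ j ∈ Finset.Icc (p + 1) r, w j ω with hW
    have Wf : Measurable[fut (p + 1)] W := C.measurable_prod_fut (p + 1) r
    have Wm : Measurable W := Wf.mono (C.fut_le _) le_rfl
    have HfW : Measurable[fut (p + 1)] fun ω => W ω * H ω :=
      Wf.mul (hH.mono (C.fut_anti (by omega)) le_rfl)
    have W0 : ∀ ω, 0 ≤ W ω := fun ω => (C.prod_mem _ ω).1
    have W1 : ∀ ω, W ω ≤ 1 := fun ω => (C.prod_mem _ ω).2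
    have WH0 : ∀ ω, 0 ≤ W ω * H ω := fun ω => mul_nonneg (W0 ω) (H0 ω)
    have WH1 : ∀ ω, W ω * H ω ≤ 1 := fun ω => mul_le_one₀ (W1 ω) (H0 ω) (H1 ω)
    set B := ∫ ω, W ω ∂μ with hB
    set A := ∫ ω, W ω * H ω ∂μ with hA
    have hB0 : 0 < B := by
      have hle : δ ^ (Finset.Icc (p + 1) r).card ≤ B := by
        have : ∫ _ : Ω, δ ^ (Finset.Icc (p + 1) r).card ∂μ ≤ B := by
          refine integral_mono (integrable_const _) (hint W Wm W0 W1) fun ω => ?_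
          simp only [hW]
          rw [← Finset.prod_const]
          exact Finset.prod_le_prod (fun _ _ => hδ.le) fun j _ => C.lower j ω
        simpa using this
      exact lt_of_lt_of_le (pow_pos hδ _) hle
    have hAB : a * B ≤ A ∧ A ≤ b * B := by
      have := hφ' (fun _ => 1) measurable_const (fun _ => zero_le_one) fun _ => le_rfl
      simpa only [one_mul] using this
    -- `s` is the exact ratio on the part `δ` split off from `w p`, because there `φ` is independent
    -- of the future.
    set s := A / B with hs
    have hAs : A = s * B := by rw [hs]; field_simp
    have has : a ≤ s := by rw [hs, le_div_iff₀ hB0]; exact hAB.1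
    have hsb : s ≤ b := by rw [hs, div_le_iff₀ hB0]; exact hAB.2
    -- Both ends move towards `s ∈ [a, b]` by the fraction `δ` of their distance to it, which
    -- multiplies the gap by `1 - δ`.
    refine ⟨a + δ * (s - a), b - δ * (b - s), ?_, ?_, ?_, ?_⟩
    · nlinarith
    · nlinarith
    · have : (1 - δ) * (b - a) ≤ (1 - δ) * ((1 - δ) ^ d * ((∫ ω, H ω ∂μ) / δ)) :=
        mul_le_mul_of_nonneg_left hgap (by linarith)
      rw [pow_succ]; linarith
    · intro φ hφ φ0 φ1
      have φm : Measurable φ := hφ.mono (C.past_le _) le_rfl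
      have hφs : Measurable[past (p + 1)] φ := hφ.mono (C.past_mono (by omega)) le_rfl
      simp only [hsplit]
      -- The remainder `φ * (w p - δ)` is again a `[0, 1]`-valued function of the past, one step
      -- later; this is why the bounds are claimed for all `φ`.
      have key := hφ' (fun ω => φ ω * (w p ω - δ))
        (hφs.mul ((C.meas_past p).sub measurable_const))
        (fun ω => mul_nonneg (φ0 ω) (by linarith [C.lower p ω]))
        (fun ω => mul_le_one₀ (φ1 ω) (by linarith [C.lower p ω]) (by linarith [C.upper p ω]))
      have indW : ∫ ω, φ ω * W ω ∂μ = (∫ ω, φ ω ∂μ) * B :=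
        integral_mul_of_indep (C.past_le p) (C.fut_le _) (C.indep p) hφ Wf
      have indWH : ∫ ω, φ ω * (W ω * H ω) ∂μ = (∫ ω, φ ω ∂μ) * A :=
        integral_mul_of_indep (C.past_le p) (C.fut_le _) (C.indep p) hφ HfW
      have iφW : Integrable (fun ω => φ ω * W ω) μ := hint _ (φm.mul Wm)
        (fun ω => mul_nonneg (φ0 ω) (W0 ω)) fun ω => mul_le_one₀ (φ1 ω) (W0 ω) (W1 ω)
      have iφWH : Integrable (fun ω => φ ω * (W ω * H ω)) μ := hint _ (φm.mul (Wm.mul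
        Hm)) (fun ω => mul_nonneg (φ0 ω) (WH0 ω)) fun ω => mul_le_one₀ (φ1 ω) (WH0 ω) (WH1 ω)
      have φw0 : ∀ ω, 0 ≤ φ ω * w p ω := fun ω => mul_nonneg (φ0 ω) (C.nonneg p ω)
      have φw1 : ∀ ω, φ ω * w p ω ≤ 1 := fun ω => mul_le_one₀ (φ1 ω) (C.nonneg p ω) (C.upper p ω)
      have iφwW : Integrable (fun ω => φ ω * (w p ω * W ω)) μ := by
        simp_rw [← mul_assoc]
        exact hint _ ((φm.mul (C.measurable p)).mul Wm) (fun ω => mul_nonneg (φw0 ω) (W0 ω))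
          fun ω => mul_le_one₀ (φw1 ω) (W0 ω) (W1 ω)
      have iφwWH : Integrable (fun ω => φ ω * (w p ω * W ω * H ω)) μ := by
        simp_rw [mul_assoc, ← mul_assoc (φ _) (w p _)]
        exact hint _ ((φm.mul (C.measurable p)).mul (Wm.mul Hm))
          (fun ω => mul_nonneg (φw0 ω) (WH0 ω))
          fun ω => mul_le_one₀ (φw1 ω) (WH0 ω) (WH1 ω)
      have eW : ∫ ω, φ ω * (w p ω - δ) * W ω ∂μ =
          (∫ ω, φ ω * (w p ω * W ω) ∂μ) - δ * ((∫ ω, φ ω ∂μ) * B) := by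
        rw [← indW, ← integral_const_mul, ← integral_sub iφwW (iφW.const_mul δ)]
        exact integral_congr_ae (ae_of_all _ fun ω => by simp only; ring)
      have eWH : ∫ ω, φ ω * (w p ω - δ) * (W ω * H ω) ∂μ =
          (∫ ω, φ ω * (w p ω * W ω * H ω) ∂μ) - δ * ((∫ ω, φ ω ∂μ) * A) := by
        rw [← indWH, ← integral_const_mul, ← integral_sub iφwWH (iφWH.const_mul δ)]
        exact integral_congr_ae (ae_of_all _ fun ω => by simp only; ring)
      rw [eW, eWH] at key
      -- The gain on the split-off part is `δ * (s - a)` times the right-hand side, and it is wanted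
      -- as a multiple of the left-hand side.
      have hle : ∫ ω, φ ω * (w p ω * W ω) ∂μ ≤ (∫ ω, φ ω ∂μ) * B := by
        rw [← indW]
        exact integral_mono iφwW iφW fun ω => mul_le_mul_of_nonneg_left
          (mul_le_of_le_one_left (W0 ω) (C.upper p ω)) (φ0 ω)
      obtain ⟨k1, k2⟩ := key
      rw [hAs] at k1 k2
      set I := ∫ ω, φ ω ∂μ
      set β := ∫ ω, φ ω * (w p ω * W ω) ∂μ
      have l1 := mul_le_mul_of_nonneg_left hle (mul_nonneg hδ.le (sub_nonneg.2 has))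
      have l2 := mul_le_mul_of_nonneg_left hle (mul_nonneg hδ.le (sub_nonneg.2 hsb))
      constructor
      · nlinarith
      · nlinarith

/-- Exponential forgetting: the increment of the log-likelihood barely depends on a far tail. -/
theorem abs_log_sub_le [IsProbabilityMeasure μ] (C : WeightChain μ past fut δ w) {r : ℕ} (hr : 1 ≤ r) {H : Ω → ℝ}
    (hH : Measurable[fut (r + 1)] H) {η : ℝ} (hη : 0 < η) (H0 : ∀ ω, η ≤ H ω)
    (H1 : ∀ ω, H ω ≤ 1) :
    |(Real.log (∫ ω, (∏ j ∈ Finset.Icc 0 r, w j ω) * H ω ∂μ) -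
        Real.log (∫ ω, (∏ j ∈ Finset.Icc 1 r, w j ω) * H ω ∂μ)) -
      (Real.log (∫ ω, ∏ j ∈ Finset.Icc 0 r, w j ω ∂μ) -
        Real.log (∫ ω, ∏ j ∈ Finset.Icc 1 r, w j ω ∂μ))| ≤ (1 - δ) ^ (r - 1) / δ ^ 2 := by
  have hδ := C.pos
  have hδ1 := C.le_one
  have Hm : Measurable H := hH.mono (C.fut_le _) le_rfl
  -- Both `1` and `w 0` are functions of `past 1`, so the effect of `H` on the two likelihoods lies
  -- in the same interval `[a, b]`.
  obtain ⟨a, b, ha, hab, hgap, hφ⟩ := C.exists_ratio_bounds hH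
    (fun ω => hη.le.trans (H0 ω)) H1 (r - 1) 1 (by omega)
  have h1 := hφ (fun _ => 1) measurable_const (fun _ => zero_le_one) fun _ => le_rfl
  have h0 := hφ (w 0) (C.meas_past 0) (C.nonneg 0) (C.upper 0)
  have hsplit : ∀ ω, ∏ j ∈ Finset.Icc 0 r, w j ω =
      w 0 ω * ∏ j ∈ Finset.Icc 1 r, w j ω := fun ω => by
    rw [← Finset.insert_Icc_add_one_left_eq_Icc (by omega : 0 ≤ r), Finset.prod_insert (by simp),
      zero_add]
  simp only [one_mul] at h1
  simp only [← mul_assoc, ← hsplit] at h0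
  have hHpos : 0 < ∫ ω, H ω ∂μ := by
    have : ∫ _ : Ω, η ∂μ ≤ ∫ ω, H ω ∂μ := integral_mono (integrable_const _)
      (Integrable.of_bound Hm.aestronglyMeasurable 1 (ae_of_all _ fun ω => by
        rw [Real.norm_eq_abs, abs_of_nonneg (hη.le.trans (H0 ω))]; exact H1 ω)) H0
    simp at this; linarith
  have hpos : ∀ p, 0 < ∫ ω, ∏ j ∈ Finset.Icc p r, w j ω ∂μ := fun p => by
    have hle : ∫ _ : Ω, δ ^ (Finset.Icc p r).card ∂μ ≤ ∫ ω, ∏ j ∈ Finset.Icc p r, w j ω ∂μ := by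
      refine integral_mono (integrable_const _) ?_ fun ω => ?_
      · refine Integrable.of_bound (Measurable.aestronglyMeasurable ?_) 1 (ae_of_all _ fun ω => ?_)
        · exact (C.measurable_prod_fut p r).mono (C.fut_le _) le_rfl
        · rw [Real.norm_eq_abs, abs_of_nonneg (C.prod_mem _ ω).1]; exact (C.prod_mem _ ω).2
      · simp only
        rw [← Finset.prod_const]
        exact Finset.prod_le_prod (fun _ _ => hδ.le) fun j _ => C.lower j ω
    simp only [integral_const, probReal_univ, smul_eq_mul, one_mul] at hle
    exact lt_of_lt_of_le (pow_pos hδ _) hle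
  have ha0 : 0 < a := lt_of_lt_of_le (mul_pos hδ hHpos) ha
  have hb0 : 0 < b := ha0.trans_le hab
  have p1 := hpos 1
  have p0 := hpos 0
  have q1 := lt_of_lt_of_le (mul_pos ha0 p1) h1.1
  have q0 := lt_of_lt_of_le (mul_pos ha0 p0) h0.1
  have logb : ∀ {x y : ℝ}, 0 < x → 0 < y → a * x ≤ y → y ≤ b * x →
      Real.log a ≤ Real.log y - Real.log x ∧ Real.log y - Real.log x ≤ Real.log b := by
    intro x y hx hy h1 h2
    rw [← Real.log_div hy.ne' hx.ne']
    exact ⟨Real.log_le_log ha0 (by rwa [le_div_iff₀ hx]),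
      Real.log_le_log (by positivity) (by rwa [div_le_iff₀ hx])⟩
  have L1 := logb p1 q1 h1.1 h1.2
  have L0 := logb p0 q0 h0.1 h0.2
  -- `log (b / a) ≤ (b - a) / a`. One factor `1 / δ` comes from the gap, the other from `a ≥ δ * ∫
  -- H`; the integral of `H` cancels.
  have hlog : Real.log b - Real.log a ≤ (1 - δ) ^ (r - 1) / δ ^ 2 := by
    rw [← Real.log_div hb0.ne' ha0.ne']
    refine (Real.log_le_sub_one_of_pos (by positivity)).trans ?_
    rw [div_sub_one ha0.ne', div_le_iff₀ ha0]
    refine hgap.trans ?_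
    have hq : 0 ≤ (1 - δ) ^ (r - 1) := pow_nonneg (by linarith) _
    have : (1 - δ) ^ (r - 1) / δ ^ 2 * (δ * ∫ ω, H ω ∂μ) =
        (1 - δ) ^ (r - 1) * ((∫ ω, H ω ∂μ) / δ) := by field_simp
    rw [← this]
    exact mul_le_mul_of_nonneg_left ha (by positivity)
  rw [abs_le]
  constructor <;> linarith [L0.1, L0.2, L1.1, L1.2]

end WeightChain

end Forgetting

namespace RoundRobin

/-! ### Distances in the round-robin graph -/

/-- The position of the place `p ≥ 2` on the cycle along which the nodes move, place `2` being at
the origin. -/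
def cyclePos (p : ℕ) : ℤ := if p % 2 = 1 then ((p : ℤ) - 1) / 2 else (2 - (p : ℤ)) / 2

theorem move_one (N : ℕ) : move N 1 = 1 := by simp [move]

theorem iterate_move_one (N t : ℕ) : (move N)^[t] 1 = 1 :=
  Function.iterate_fixed (move_one N) t

/-- A move is the rotation by one step. The second alternative is the jump from place `N - 1` to
place `N`, where the coordinate wraps around. -/
theorem move_spec {N h p : ℕ} (hN : N = 2 * h) (h2 : 2 ≤ h) (hp : 2 ≤ p) (hpN : p ≤ N) :
    2 ≤ move N p ∧ move N p ≤ N ∧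
      (cyclePos p < h - 1 ∧ cyclePos (move N p) = cyclePos p + 1 ∨
        cyclePos p = h - 1 ∧ cyclePos (move N p) = 1 - h) := by
  unfold move
  simp only [Nat.odd_iff]
  split_ifs <;> simp only [cyclePos] <;> (refine ⟨by omega, by omega, ?_⟩) <;> split_ifs <;> omega

theorem cyclePos_mem {N h p : ℕ} (hN : N = 2 * h) (hp : 2 ≤ p) (hpN : p ≤ N) :
    1 - (h : ℤ) ≤ cyclePos p ∧ cyclePos p ≤ h - 1 := by
  unfold cyclePos; split_ifs <;> omega

theorem cyclePos_inj {p p' : ℕ} (hp : 2 ≤ p) (hp' : 2 ≤ p') (h : cyclePos p = cyclePos p') :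
    p = p' := by
  unfold cyclePos at h; split_ifs at h <;> omega

theorem exists_cyclePos {N h : ℕ} {c : ℤ} (hN : N = 2 * h) (hc : 1 - (h : ℤ) ≤ c)
    (hc' : c ≤ h - 1) : ∃ p, 2 ≤ p ∧ p ≤ N ∧ cyclePos p = c := by
  by_cases h0 : 1 ≤ c
  · refine ⟨(2 * c + 1).toNat, by omega, by omega, ?_⟩
    unfold cyclePos; split_ifs <;> omega
  · refine ⟨(2 - 2 * c).toNat, by omega, by omega, ?_⟩
    unfold cyclePos; split_ifs <;> omega

theorem iterate_move_spec {N h p : ℕ} (hN : N = 2 * h) (h2 : 2 ≤ h) (hp : 2 ≤ p) (hpN : p ≤ N)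
    (t : ℕ) (ht : t + 2 ≤ N) :
    2 ≤ (move N)^[t] p ∧ (move N)^[t] p ≤ N ∧
      (cyclePos ((move N)^[t] p) = cyclePos p + t ∨
        cyclePos ((move N)^[t] p) = cyclePos p + t - (N - 1)) := by
  have hm := cyclePos_mem hN hp hpN
  induction t with
  | zero => simp [hp, hpN]
  | succ t ih =>
    obtain ⟨a, b, c⟩ := ih (by omega)
    obtain ⟨a', b', c'⟩ := move_spec hN h2 a b
    have := cyclePos_mem hN a b
    rw [Function.iterate_succ_apply']
    refine ⟨a', b', ?_⟩
    push_cast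
    omega

/-- The places `2a - 1` and `2a` have the opposite coordinates `a - 1` and `1 - a`. -/
theorem paired_iff {p p' : ℕ} (hp : 2 ≤ p) (hp' : 2 ≤ p') (hne : p ≠ p') :
    (p + 1) / 2 = (p' + 1) / 2 ↔ cyclePos p + cyclePos p' = 0 := by
  unfold cyclePos; split_ifs <;> omega

/-- After `t` moves both coordinates have grown by `t` modulo `N - 1`, so meeting is a congruence;
the sizes of the coordinates leave only the multiples `0` and `N - 1`. -/
theorem adj_iff {n N h i j : ℕ} (hN : N = 2 * h) (hn : 4 * n < N)
    (hi : 2 ≤ i) (hiN : i ≤ N) (hj : 2 ≤ j) (hjN : j ≤ N) :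
    (graph n N).Adj i j ↔ i ≠ j ∧ ∃ t < n, cyclePos i + cyclePos j + 2 * t = 0 ∨
      cyclePos i + cyclePos j + 2 * t = N - 1 := by
  simp only [graph]
  constructor
  · rintro ⟨hne, -, -, t, ht, e⟩
    refine ⟨hne, t, ht, ?_⟩
    obtain ⟨a, b, c⟩ := iterate_move_spec hN (by omega) hi hiN t (by omega)
    obtain ⟨a', b', c'⟩ := iterate_move_spec hN (by omega) hj hjN t (by omega)
    have m1 := cyclePos_mem hN hi hiN
    have m2 := cyclePos_mem hN hj hjN
    have m3 := cyclePos_mem hN a b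
    have m4 := cyclePos_mem hN a' b'
    have hne' : (move N)^[t] i ≠ (move N)^[t] j := fun h => hne (cyclePos_inj hi hj (by
      rw [h] at c; omega))
    rw [paired_iff a a' hne'] at e
    omega
  · rintro ⟨hne, t, ht, e⟩
    refine ⟨hne, by omega, by omega, t, ht, ?_⟩
    obtain ⟨a, b, c⟩ := iterate_move_spec hN (by omega) hi hiN t (by omega)
    obtain ⟨a', b', c'⟩ := iterate_move_spec hN (by omega) hj hjN t (by omega)
    have m1 := cyclePos_mem hN hi hiN
    have m2 := cyclePos_mem hN hj hjN
    have m3 := cyclePos_mem hN a b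
    have m4 := cyclePos_mem hN a' b'
    have hne' : (move N)^[t] i ≠ (move N)^[t] j := fun h => hne (cyclePos_inj hi hj (by
      rw [h] at c; omega))
    rw [paired_iff a a' hne']
    omega

/-- The node `1` never moves, and its partner is whoever has reached the origin, place `2`. -/
theorem adj_one_iff {n N h j : ℕ} (hN : N = 2 * h) (hn : 4 * n < N) (hn1 : 1 ≤ n)
    (hj : 2 ≤ j) (hjN : j ≤ N) :
    (graph n N).Adj 1 j ↔ 1 - (n : ℤ) ≤ cyclePos j ∧ cyclePos j ≤ 0 := by
  simp only [graph, iterate_move_one]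
  constructor
  · rintro ⟨-, -, -, t, ht, e⟩
    obtain ⟨a, b, c⟩ := iterate_move_spec hN (by omega) hj hjN t (by omega)
    have hm := cyclePos_mem hN hj hjN
    have : (move N)^[t] j = 2 := by omega
    rw [this] at c
    simp [cyclePos] at c hm ⊢
    omega
  · rintro ⟨h1, h2⟩
    obtain ⟨t, ht⟩ : ∃ t : ℕ, cyclePos j + t = 0 := ⟨(-cyclePos j).toNat, by omega⟩
    refine ⟨by omega, by omega, by omega, t, by omega, ?_⟩
    obtain ⟨a, b, c⟩ := iterate_move_spec hN (by omega) hj hjN t (by omega)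
    have m3 := cyclePos_mem hN a b
    have : (move N)^[t] j = 2 := cyclePos_inj a le_rfl (by simp [cyclePos] at *; omega)
    rw [this]

/-- The ball around the node `1` whose radius is `A / (n - 1)`. -/
def InBall (n N : ℕ) (A : ℤ) (i : ℕ) : Prop :=
  i = 1 ∨ (2 ≤ i ∧ i ≤ N ∧
    (-A ≤ cyclePos i ∧ cyclePos i ≤ A - (n - 1) ∨ N - 1 - A ≤ cyclePos i))

/-- The reflections `c ↦ -c - 2t`, `t < n`, send the arc `[-A, A - (n - 1)]` into `[-A - (n - 1),
A]`. For `A = 0` the arc is empty and the ball is the node `1` alone. -/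
theorem inBall_add_iff {n N h i : ℕ} {A : ℤ} (hN : N = 2 * h) (hn : 4 * n < N) (hn1 : 2 ≤ n)
    (hA : A = 0 ∨ (n : ℤ) - 1 ≤ A) :
    InBall n N (A + (n - 1)) i ↔
      InBall n N A i ∨ ∃ j, InBall n N A j ∧ (graph n N).Adj j i := by
  constructor
  · rintro (rfl | ⟨hi, hiN, hb⟩)
    · exact Or.inl (Or.inl rfl)
    · by_cases hin : InBall n N A i
      · exact Or.inl hin
      right
      have hm := cyclePos_mem hN hi hiN
      rcases hA with rfl | hA
      · refine ⟨1, Or.inl rfl, (adj_one_iff hN hn (by omega) hi hiN).2 ?_⟩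
        omega
      · have hnin : ¬ (-A ≤ cyclePos i ∧ cyclePos i ≤ A - (n - 1)) ∧ ¬ (N - 1 - A ≤ cyclePos i) := by
          constructor <;> intro hc <;> exact hin (Or.inr ⟨hi, hiN, by tauto⟩)
        -- New points within `[-A, A]` are reached by the reflection with `t = 0`, the others by the
        -- one with `t = n - 1`, shifted by `N - 1` at the upper end.
        by_cases h1 : -A ≤ cyclePos i ∧ cyclePos i ≤ A
        · obtain ⟨j, hj, hjN, hc⟩ := exists_cyclePos (c := - cyclePos i) hN
            (by omega) (by omega)
          refine ⟨j, Or.inr ⟨hj, hjN, by omega⟩, ?_⟩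
          refine (adj_iff hN hn hj hjN hi hiN).2 ⟨?_, 0, by omega, by omega⟩
          rintro rfl; omega
        · by_cases h2 : cyclePos i < -A
          · obtain ⟨j, hj, hjN, hc⟩ := exists_cyclePos (c := - cyclePos i - 2 * (n - 1)) hN
              (by omega) (by omega)
            refine ⟨j, Or.inr ⟨hj, hjN, by omega⟩, ?_⟩
            refine (adj_iff hN hn hj hjN hi hiN).2 ⟨?_, n - 1, by omega, by omega⟩
            rintro rfl; omega
          · obtain ⟨j, hj, hjN, hc⟩ := exists_cyclePos (c := N - 1 - cyclePos i - 2 * (n - 1)) hN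
              (by omega) (by omega)
            refine ⟨j, Or.inr ⟨hj, hjN, by omega⟩, ?_⟩
            refine (adj_iff hN hn hj hjN hi hiN).2 ⟨?_, n - 1, by omega, by omega⟩
            rintro rfl; omega
  · rintro (hb | ⟨j, hj, hadj⟩)
    · rcases hb with rfl | ⟨hi, hiN, hb⟩
      · exact Or.inl rfl
      · exact Or.inr ⟨hi, hiN, by omega⟩
    · by_cases hi1 : i = 1
      · exact Or.inl hi1
      have hi := hadj.2.2.1
      have hi2 : 2 ≤ i := by omega
      refine Or.inr ⟨hi2, hi.2, ?_⟩
      have m1 := cyclePos_mem hN hi2 hi.2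
      rcases hj with rfl | ⟨hj, hjN, hb⟩
      · have := (adj_one_iff hN hn (by omega) hi2 hi.2).1 hadj
        omega
      · obtain ⟨hne, t, ht, e⟩ := (adj_iff hN hn hj hjN hi2 hi.2).1 hadj
        have m2 := cyclePos_mem hN hj hjN
        omega

/-- A family of sets built up by adding neighbours consists of balls. -/
theorem _root_.SimpleGraph.exists_walk_length_le_iff {V : Type*} {G : SimpleGraph V} {a : V}
    {B : ℕ → V → Prop} (h0 : ∀ i, B 0 i ↔ i = a)
    (hs : ∀ q i, B (q + 1) i ↔ B q i ∨ ∃ j, B q j ∧ G.Adj j i) (q : ℕ) (i : V) :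
    B q i ↔ ∃ p : G.Walk a i, p.length ≤ q := by
  induction q generalizing i with
  | zero =>
    rw [h0]
    constructor
    · rintro rfl; exact ⟨.nil, le_rfl⟩
    · rintro ⟨p, hp⟩; exact (p.eq_of_length_eq_zero (by omega)).symm
  | succ q ih =>
    rw [hs, ih]
    constructor
    · rintro (⟨p, hp⟩ | ⟨j, hj, hadj⟩)
      · exact ⟨p, by omega⟩
      · obtain ⟨p, hp⟩ := (ih j).1 hj
        exact ⟨p.concat hadj, by simpa using hp⟩
    · rintro ⟨p, hp⟩
      by_cases hq : p.length ≤ q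
      · exact Or.inl ⟨p, hq⟩
      · right
        cases hr : p.reverse with
        | nil =>
          have := congrArg SimpleGraph.Walk.length hr
          rw [SimpleGraph.Walk.length_reverse, SimpleGraph.Walk.length_nil] at this
          omega
        | cons hadj p' =>
          refine ⟨_, (ih _).2 ⟨p'.reverse, ?_⟩, hadj.symm⟩
          have := congrArg SimpleGraph.Walk.length hr
          rw [SimpleGraph.Walk.length_reverse, SimpleGraph.Walk.length_cons] at this
          rw [SimpleGraph.Walk.length_reverse]; omega

theorem inBall_iff_walk {n N h : ℕ} (hN : N = 2 * h) (hn : 4 * n < N) (hn1 : 2 ≤ n) (q i : ℕ) :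
    InBall n N (q * (n - 1)) i ↔ ∃ p : (graph n N).Walk 1 i, p.length ≤ q := by
  refine SimpleGraph.exists_walk_length_le_iff (B := fun q i => InBall n N (q * (n - 1)) i)
    (fun i => ?_) (fun q i => ?_) q i
  · constructor
    · rintro (rfl | ⟨h1, h2, h3⟩)
      · rfl
      · have := cyclePos_mem hN h1 h2
        simp at h3; omega
    · exact Or.inl
  · have hq : (q : ℤ) = 0 ∨ 1 ≤ (q : ℤ) := by omega
    have : ((q : ℤ) * (n - 1)) = 0 ∨ (n : ℤ) - 1 ≤ q * (n - 1) := by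
      rcases hq with hq | hq
      · left; simp [hq]
      · right; nlinarith
    rw [← inBall_add_iff hN hn hn1 this]
    push_cast
    ring_nf

theorem dist_le_iff {n N h : ℕ} (hN : N = 2 * h) (hn : 4 * n < N) (hn1 : 2 ≤ n) {i : ℕ}
    (hi : 1 ≤ i) (hiN : i ≤ N) (q : ℕ) :
    (graph n N).dist 1 i ≤ q ↔ InBall n N (q * (n - 1)) i := by
  rw [inBall_iff_walk hN hn hn1]
  constructor
  · intro hd
    -- `dist` is `0` between unreachable nodes, so connectedness must be checked; the ball of radius
    -- `N` already contains every node.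
    have hr : (graph n N).Reachable 1 i := by
      have : InBall n N ((N : ℕ) * (n - 1)) i := by
        by_cases h1 : i = 1
        · exact Or.inl h1
        · have hm := cyclePos_mem hN (by omega : 2 ≤ i) hiN
          have : (N : ℤ) * 1 ≤ N * (n - 1) := by
            apply mul_le_mul_of_nonneg_left <;> omega
          have h3 : ((N : ℤ) - 1) * 1 ≤ (N - 1) * (n - 1) := by
            apply mul_le_mul_of_nonneg_left <;> omega
          have : (N : ℤ) * (n - 1) = (N - 1) * (n - 1) + (n - 1) := by ring
          exact Or.inr ⟨by omega, hiN, by omega⟩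
      obtain ⟨p, -⟩ := (inBall_iff_walk hN hn hn1 N i).1 this
      exact ⟨p⟩
    obtain ⟨p, hp⟩ := hr.exists_walk_length_eq_dist
    exact ⟨p, by omega⟩
  · rintro ⟨p, hp⟩
    exact (SimpleGraph.dist_le p).trans hp

/-! ### The bulk layers -/

theorem depth_le_iff {n N h : ℕ} (hN : N = 2 * h) (hn : 4 * n < N) (hn1 : 2 ≤ n) (i : Node N)
    (q : ℕ) : depth n i ≤ q ↔ InBall n N (q * (n - 1)) i :=
  dist_le_iff hN hn hn1 (Finset.mem_Icc.1 i.2).1 (Finset.mem_Icc.1 i.2).2 q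

theorem depth_le_orderMax (n : ℕ) {N : ℕ} (i : Node N) : depth n i ≤ orderMax n N + 1 := by
  have := Finset.le_sup (f := fun i : Node N => depth n i) (Finset.mem_univ i)
  simp only [orderMax]
  omega

/-- `hq` guarantees that the subtraction in `orderMax` is not truncated. -/
theorem exists_depth_gt {n N q : ℕ} (hq : 1 ≤ orderMax n N) (h : q ≤ orderMax n N) :
    ∃ i : Node N, q < depth n i := by
  by_contra! hc
  have : (Finset.univ.sup fun i : Node N => depth n i) ≤ q := Finset.sup_le fun i _ => hc i
  simp only [orderMax] at h hq
  omega

theorem le_two_mul_orderMax {n N h : ℕ} (hN : N = 2 * h) (hn : 4 * n < N) (hn1 : 2 ≤ n) :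
    (N : ℤ) - 2 ≤ 2 * ((orderMax n N + 1) * (n - 1)) := by
  -- The node `N` sits at the extreme coordinate `1 - h`, so a ball containing it has a large
  -- radius.
  have hmem : N ∈ Finset.Icc 1 N := by simp; omega
  have hb := (depth_le_iff hN hn hn1 ⟨N, hmem⟩ _).1 (depth_le_orderMax n _)
  push_cast at hb
  generalize ((orderMax n N : ℤ) + 1) * (n - 1) = A at hb ⊢
  rcases hb with hb | ⟨-, -, hb⟩
  · omega
  · simp only [cyclePos] at hb
    split_ifs at hb <;> omega

theorem two_le_orderMax {n N h : ℕ} (hN : N = 2 * h) (hn : 4 * n < N) (hn1 : 2 ≤ n) :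
    2 ≤ orderMax n N := by
  by_contra! hc
  have h1 := le_two_mul_orderMax hN hn hn1
  have h2 : ((orderMax n N : ℤ) + 1) * (n - 1) ≤ 2 * (n - 1) := by
    apply mul_le_mul_of_nonneg_right <;> omega
  omega

/-- An arc with at least `N - 1` points would cover the cycle, whereas some node lies outside the
ball of radius `orderMax n N`. -/
theorem two_mul_orderMax_lt {n N h : ℕ} (hN : N = 2 * h) (hn : 4 * n < N) (hn1 : 2 ≤ n) :
    2 * (orderMax n N * ((n : ℤ) - 1)) < N - 2 + (n - 1) := by
  obtain ⟨i, hi⟩ := exists_depth_gt (n := n) (N := N) (by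
    have := two_le_orderMax hN hn hn1; omega) le_rfl
  rw [← not_le, depth_le_iff hN hn hn1] at hi
  have hiN := Finset.mem_Icc.1 i.2
  generalize (orderMax n N : ℤ) * (n - 1) = A at hi ⊢
  have hi2 : 2 ≤ (i : ℕ) := by
    by_contra! hc
    exact hi (Or.inl (by omega))
  have hm := cyclePos_mem hN hi2 hiN.2
  by_contra! hc
  refine hi (Or.inr ⟨hi2, hiN.2, ?_⟩)
  omega

/-! ### The translation invariant layer structure on `ℤ`. -/

/-- The layer of the node `i` in the bulk of the graph, extended to a function on `ℤ` that commutes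
with the translations by `2 (n - 1)`. -/
def layer (n : ℕ) (i : ℤ) : ℤ :=
  if i % 2 = 1 then (i - 3) / (2 * (n - 1)) + 2 else (i - 4) / (2 * (n - 1)) + 1

theorem le_layer_iff {n : ℕ} (hn1 : 2 ≤ n) (i q : ℤ) : q ≤ layer n i ↔
    (i % 2 = 1 ∧ (q * (n - 1) - 2 * (n - 1)) * 2 ≤ i - 3) ∨
      (i % 2 = 0 ∧ (q * (n - 1) - (n - 1)) * 2 ≤ i - 4) := by
  have hm : (0 : ℤ) < 2 * (n - 1) := by omega
  unfold layer
  split_ifs with h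
  · rw [← sub_le_iff_le_add, Int.le_ediv_iff_mul_le hm]
    have : (q - 2) * (2 * ((n : ℤ) - 1)) = (q * (n - 1) - 2 * (n - 1)) * 2 := by ring
    rw [this]; omega
  · rw [← sub_le_iff_le_add, Int.le_ediv_iff_mul_le hm]
    have : (q - 1) * (2 * ((n : ℤ) - 1)) = (q * (n - 1) - (n - 1)) * 2 := by ring
    rw [this]; omega

theorem layer_eq_iff {n : ℕ} (hn1 : 2 ≤ n) (i q : ℤ) : layer n i = q ↔
    (i % 2 = 1 ∧ (q * (n - 1) - 2 * (n - 1)) * 2 ≤ i - 3 ∧ i - 3 < (q * (n - 1) - (n - 1)) * 2) ∨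
      (i % 2 = 0 ∧ (q * (n - 1) - (n - 1)) * 2 ≤ i - 4 ∧ i - 4 < (q * (n - 1)) * 2) := by
  have h1 := le_layer_iff hn1 i q
  have h2 := le_layer_iff hn1 i (q + 1)
  have h3 : layer n i = q ↔ q ≤ layer n i ∧ ¬ (q + 1 ≤ layer n i) := by omega
  have : (q + 1) * ((n : ℤ) - 1) = q * (n - 1) + (n - 1) := by ring
  rw [h3, h1, h2, this]
  generalize q * ((n : ℤ) - 1) = A
  omega

theorem layer_add {n : ℕ} (hn1 : 2 ≤ n) (i z : ℤ) :
    layer n (i + 2 * (n - 1) * z) = layer n i + z := by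
  rw [layer_eq_iff hn1]
  have h := (layer_eq_iff hn1 i (layer n i)).1 rfl
  have e : (layer n i + z) * ((n : ℤ) - 1) = layer n i * (n - 1) + (n - 1) * z := by ring
  rw [e, mul_assoc]
  generalize layer n i * ((n : ℤ) - 1) = A at h ⊢
  generalize ((n : ℤ) - 1) * z = B at h ⊢
  omega

/-- Valid up to the far end of the graph, where `layer` and `depth` may differ. This one-sided bound
suffices to make the tail of the likelihood a function of the future. -/
theorem le_layer_of_le_depth {n N h : ℕ} (hN : N = 2 * h) (hn : 4 * n < N) (hn1 : 2 ≤ n)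
    (i : Node N) {r : ℕ} (hr : 1 ≤ r) (hi : r < depth n i) : (r : ℤ) < layer n (i : ℕ) := by
  rw [← not_le, depth_le_iff hN hn hn1] at hi
  rw [← Int.add_one_le_iff, le_layer_iff hn1]
  have : ((r : ℤ) + 1) * ((n : ℤ) - 1) = r * (n - 1) + (n - 1) := by ring
  have hA : 1 * ((n : ℤ) - 1) ≤ r * ((n : ℤ) - 1) := by
    apply mul_le_mul_of_nonneg_right <;> omega
  rw [this]
  generalize (r : ℤ) * ((n : ℤ) - 1) = A at hi hA ⊢
  have hiN := Finset.mem_Icc.1 i.2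
  have hi2 : 2 ≤ (i : ℕ) := by
    by_contra! hc
    exact hi (Or.inl (by omega))
  have hc : ¬ (-A ≤ cyclePos i ∧ cyclePos i ≤ A - (n - 1)) := fun hc =>
    hi (Or.inr ⟨hi2, hiN.2, Or.inl hc⟩)
  have hm := cyclePos_mem hN hi2 hiN.2
  unfold cyclePos at hc
  split_ifs at hc <;> omega

/-- Leaves enough free space on the cycle that the ball of radius `q` does not meet its wrapped
copy. -/
theorem bulk_bound {n N h q : ℕ} (hN : N = 2 * h) (hn : 4 * n < N) (hn1 : 2 ≤ n)
    (hq : q + 1 ≤ orderMax n N) : 2 * (q * ((n : ℤ) - 1)) + (n - 1) < N - 2 := by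
  have h1 := two_mul_orderMax_lt hN hn hn1
  have h2 : ((q : ℤ) + 1) * (n - 1) ≤ orderMax n N * (n - 1) := by
    apply mul_le_mul_of_nonneg_right <;> omega
  have : ((q : ℤ) + 1) * ((n : ℤ) - 1) = q * (n - 1) + (n - 1) := by ring
  omega

theorem depth_eq_iff {n N h q : ℕ} (hN : N = 2 * h) (hn : 4 * n < N) (hn1 : 2 ≤ n)
    (hq : 2 ≤ q) (hq' : q + 1 ≤ orderMax n N) (i : Node N) :
    depth n i = q ↔ layer n (i : ℕ) = q := by
  have hb := bulk_bound hN hn hn1 hq'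
  have h1 := depth_le_iff hN hn hn1 i q
  have h2 := depth_le_iff hN hn hn1 i (q - 1)
  have h3 : depth n i = q ↔ depth n i ≤ q ∧ ¬ (depth n i ≤ q - 1) := by omega
  have hc : ((q - 1 : ℕ) : ℤ) * ((n : ℤ) - 1) = q * (n - 1) - (n - 1) := by
    rw [Nat.cast_sub (by omega)]; push_cast; ring
  have hq2 : (n : ℤ) - 1 ≤ ((q - 1 : ℕ) : ℤ) * ((n : ℤ) - 1) := by
    have h' : (1 : ℤ) ≤ ((q - 1 : ℕ) : ℤ) := by omega
    nlinarith
  rw [h3, h1, h2, layer_eq_iff hn1, hc]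
  rw [hc] at hq2
  have hiN := Finset.mem_Icc.1 i.2
  generalize (q : ℤ) * ((n : ℤ) - 1) = A at *
  unfold InBall cyclePos
  split_ifs <;> omega

theorem mem_Icc_of_layer {n N h q : ℕ} (hN : N = 2 * h) (hn : 4 * n < N) (hn1 : 2 ≤ n)
    (hq : 2 ≤ q) (hq' : q + 1 ≤ orderMax n N) {i : ℤ} (hi : layer n i = q) :
    3 ≤ i ∧ i ≤ N := by
  have hb := bulk_bound hN hn hn1 hq'
  rw [layer_eq_iff hn1] at hi
  have hq2 : 2 * ((n : ℤ) - 1) ≤ q * ((n : ℤ) - 1) := by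
    apply mul_le_mul_of_nonneg_right <;> omega
  generalize (q : ℤ) * ((n : ℤ) - 1) = A at *
  omega

/-- The edges of the bulk, the odd endpoint being the smaller one. -/
def IsEdge (n : ℕ) (i j : ℤ) : Prop := i % 2 = 1 ∧ ∃ t : ℕ, t < n ∧ j = i + 1 + 4 * t

/-- The alternative with sum `N - 1` is out of reach in the bulk, so an edge joins an odd label to
an even one and the meeting time fixes their difference. -/
theorem adj_iff_isEdge {n N h q : ℕ} (hN : N = 2 * h) (hn : 4 * n < N) (hn1 : 2 ≤ n)
    (hq : 2 ≤ q) (hq' : q + 2 ≤ orderMax n N) {i j : ℕ} (hij : i < j)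
    (hi : layer n i = q ∨ layer n i = (q + 1 : ℕ)) (hj : layer n j = q ∨ layer n j = (q + 1 : ℕ)) :
    (graph n N).Adj i j ↔ IsEdge n i j := by
  have hiN : 3 ≤ (i : ℤ) ∧ (i : ℤ) ≤ N := by
    rcases hi with hi | hi
    · exact mem_Icc_of_layer hN hn hn1 hq (by omega) hi
    · exact mem_Icc_of_layer hN hn hn1 (by omega) (by omega) hi
  have hjN : 3 ≤ (j : ℤ) ∧ (j : ℤ) ≤ N := by
    rcases hj with hj | hj
    · exact mem_Icc_of_layer hN hn hn1 hq (by omega) hj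
    · exact mem_Icc_of_layer hN hn hn1 (by omega) (by omega) hj
  rw [adj_iff hN hn (by omega) (by omega) (by omega) (by omega)]
  have hb := bulk_bound (q := q + 1) hN hn hn1 (by omega)
  have hc : ((q + 1 : ℕ) : ℤ) * ((n : ℤ) - 1) = q * (n - 1) + (n - 1) := by push_cast; ring
  have hq2 : 2 * ((n : ℤ) - 1) ≤ q * ((n : ℤ) - 1) := by
    apply mul_le_mul_of_nonneg_right <;> omega
  rw [layer_eq_iff hn1, layer_eq_iff hn1, hc] at hi hj
  rw [hc] at hb
  unfold IsEdge
  generalize (q : ℤ) * ((n : ℤ) - 1) = A at *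
  constructor
  · rintro ⟨-, t, ht, e⟩
    unfold cyclePos at e
    have hodd : (i : ℤ) % 2 = 1 := by split_ifs at e <;> omega
    refine ⟨hodd, t, ht, ?_⟩
    split_ifs at e <;> omega
  · rintro ⟨hodd, t, ht, e⟩
    refine ⟨by omega, t, ht, Or.inl ?_⟩
    unfold cyclePos
    split_ifs <;> omega

/-! ### Enumeration of the bulk layers -/

/-- The edge `(i, j)` of the bulk belongs to the layer `z`. -/
def InEdgeLayer (n : ℕ) (z i j : ℤ) : Prop :=
  IsEdge n i j ∧ ((layer n i = z ∧ layer n j = z + 1) ∨ (layer n i = z + 1 ∧ layer n j = z) ∨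
    (layer n i = z + 1 ∧ layer n j = z + 1))

theorem inEdgeLayer_add {n : ℕ} (hn1 : 2 ≤ n) (z i j y : ℤ) :
    InEdgeLayer n (z + y) (i + 2 * (n - 1) * y) (j + 2 * (n - 1) * y) ↔ InEdgeLayer n z i j := by
  have h1 : IsEdge n (i + 2 * (n - 1) * y) (j + 2 * (n - 1) * y) ↔ IsEdge n i j := by
    unfold IsEdge
    rw [mul_assoc]
    generalize ((n : ℤ) - 1) * y = B
    refine and_congr (by omega) (exists_congr fun t => and_congr_right fun _ => by omega)
  rw [InEdgeLayer, InEdgeLayer, h1, layer_add hn1, layer_add hn1]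
  refine and_congr_right fun _ => ?_
  omega

theorem _root_.Finset.sort_eq_ofFn {α : Type*} [LinearOrder α] {s : Finset α} {k : ℕ}
    {f : Fin k → α} (hf : StrictMono f) (hs : ∀ a, a ∈ s ↔ ∃ i, f i = a) :
    s.sort = List.ofFn f := by
  have hcard : s.card = k := by
    have : s = Finset.univ.image f := by ext a; simp [hs]
    rw [this, Finset.card_image_of_injective _ hf.injective, Finset.card_univ, Fintype.card_fin]
  rw [← Finset.listMap_orderEmbOfFin_finRange s hcard,
    ← Finset.orderEmbOfFin_unique hcard (fun i => (hs _).2 ⟨i, rfl⟩) hf, List.ofFn_eq_map]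

/-- The node layer `0` on `ℤ`. -/
def baseNodes (n : ℕ) : Finset ℤ :=
  (Finset.range (n - 1) ×ˢ Finset.range 2).image fun p =>
    -- The odd labels come from the positive half of the cycle and the even ones from the other
    -- half, `n - 1` of each.
    if p.2 = 0 then 3 - 4 * ((n : ℤ) - 1) + 2 * p.1 else 4 - 2 * ((n : ℤ) - 1) + 2 * p.1

/-- The edge layer `0` on `ℤ`. -/
def baseEdges (n : ℕ) : Finset (ℤ ×ₗ ℤ) :=
  (Finset.range n ×ˢ Finset.range (n - 1)).image fun p =>
    -- Each time `t = p.1` and each class `p.2` of odd labels modulo `2(n - 1)` give exactly one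
    -- edge: its odd endpoint is in node layer `1` in the first case and in node layer `0` in the
    -- second.
    if p.2 + 2 * p.1 < 2 * (n - 1) then
      toLex (3 - 2 * ((n : ℤ) - 1) + 2 * p.2, 3 - 2 * ((n : ℤ) - 1) + 2 * p.2 + 1 + 4 * p.1)
    else toLex (3 - 4 * ((n : ℤ) - 1) + 2 * p.2, 3 - 4 * ((n : ℤ) - 1) + 2 * p.2 + 1 + 4 * p.1)

theorem card_baseNodes (n : ℕ) : (baseNodes n).card = 2 * (n - 1) := by
  rw [baseNodes, Finset.card_image_of_injOn, Finset.card_product, Finset.card_range,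
    Finset.card_range, mul_comm]
  rintro ⟨a, s⟩ hp ⟨b, t⟩ hq h
  simp only [Finset.coe_product, Set.mem_prod, Finset.mem_coe, Finset.mem_range] at hp hq h
  ext
  · split_ifs at h <;> simp only <;> omega
  · split_ifs at h <;> simp only <;> omega

theorem card_baseEdges (n : ℕ) : (baseEdges n).card = n * (n - 1) := by
  rw [baseEdges, Finset.card_image_of_injOn, Finset.card_product, Finset.card_range,
    Finset.card_range]
  rintro ⟨a, s⟩ hp ⟨b, t⟩ hq h
  simp only [Finset.coe_product, Set.mem_prod, Finset.mem_coe, Finset.mem_range] at hp hq h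
  split_ifs at h <;> simp only [EmbeddingLike.apply_eq_iff_eq, Prod.mk.injEq] at h ⊢ <;> omega

theorem mem_baseNodes {n : ℕ} (hn1 : 2 ≤ n) (i : ℤ) : i ∈ baseNodes n ↔ layer n i = 0 := by
  rw [layer_eq_iff hn1]
  simp only [baseNodes, Finset.mem_image, Finset.mem_product, Finset.mem_range, Prod.exists]
  constructor
  · rintro ⟨a, s, ⟨ha, hs⟩, rfl⟩
    split_ifs <;> omega
  · rintro (h | h)
    · exact ⟨((i - (3 - 4 * ((n : ℤ) - 1))) / 2).toNat, 0, by omega, by rw [if_pos rfl]; omega⟩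
    · exact ⟨((i - (4 - 2 * ((n : ℤ) - 1))) / 2).toNat, 1, by omega,
        by rw [if_neg one_ne_zero]; omega⟩

theorem mem_baseEdges {n : ℕ} (hn1 : 2 ≤ n) (e : ℤ ×ₗ ℤ) :
    e ∈ baseEdges n ↔ InEdgeLayer n 0 (ofLex e).1 (ofLex e).2 := by
  unfold InEdgeLayer IsEdge
  simp only [layer_eq_iff hn1]
  simp only [baseEdges, Finset.mem_image, Finset.mem_product, Finset.mem_range, Prod.exists]
  constructor
  · rintro ⟨t, a, ⟨ht, ha⟩, rfl⟩
    split_ifs with h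
    · simp only [ofLex_toLex]
      exact ⟨⟨by omega, t, ht, rfl⟩, by omega⟩
    · simp only [ofLex_toLex]
      exact ⟨⟨by omega, t, ht, rfl⟩, by omega⟩
  · rintro ⟨⟨hodd, t, ht, hj⟩, h⟩
    by_cases h1 : 3 - 2 * ((n : ℤ) - 1) ≤ (ofLex e).1
    · refine ⟨t, (((ofLex e).1 - (3 - 2 * ((n : ℤ) - 1))) / 2).toNat, by omega, ?_⟩
      rw [if_pos (by omega)]
      apply ofLex.injective
      simp only [ofLex_toLex]
      ext <;> simp only <;> omega
    · refine ⟨t, (((ofLex e).1 - (3 - 4 * ((n : ℤ) - 1))) / 2).toNat, by omega, ?_⟩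
      rw [if_neg (by omega)]
      apply ofLex.injective
      simp only [ofLex_toLex]
      ext <;> simp only <;> omega

/-- The nodes of the layer `0` on `ℤ`, in increasing order. -/
def basePos (n : ℕ) : Fin (2 * (n - 1)) ↪o ℤ :=
  (baseNodes n).orderEmbOfFin (card_baseNodes n)

/-- The edges of the layer `0` on `ℤ`, in lexicographic order. -/
def baseEdge (n : ℕ) : Fin (n * (n - 1)) ↪o ℤ ×ₗ ℤ :=
  (baseEdges n).orderEmbOfFin (card_baseEdges n)

/-- The `a`-th node of the layer `z` on `ℤ`. -/
def nodeAt (n : ℕ) (z : ℤ) (a : Fin (2 * (n - 1))) : ℤ := basePos n a + 2 * (n - 1) * z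

/-- The smaller endpoint of the `f`-th edge of the layer `z` on `ℤ`. -/
def fstAt (n : ℕ) (z : ℤ) (f : Fin (n * (n - 1))) : ℤ :=
  (ofLex (baseEdge n f)).1 + 2 * (n - 1) * z

/-- The larger endpoint of the `f`-th edge of the layer `z` on `ℤ`. -/
def sndAt (n : ℕ) (z : ℤ) (f : Fin (n * (n - 1))) : ℤ :=
  (ofLex (baseEdge n f)).2 + 2 * (n - 1) * z

theorem layer_nodeAt {n : ℕ} (hn1 : 2 ≤ n) (z : ℤ) (a) : layer n (nodeAt n z a) = z := by
  have : basePos n a ∈ baseNodes n := Finset.orderEmbOfFin_mem _ _ _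
  rw [nodeAt, layer_add hn1, (mem_baseNodes hn1 _).1 this, zero_add]

theorem inEdgeLayer_at {n : ℕ} (hn1 : 2 ≤ n) (z : ℤ) (f) :
    InEdgeLayer n z (fstAt n z f) (sndAt n z f) := by
  have : baseEdge n f ∈ baseEdges n := Finset.orderEmbOfFin_mem _ _ _
  have h := (inEdgeLayer_add hn1 0 _ _ z).2 ((mem_baseEdges hn1 _).1 this)
  rwa [zero_add] at h

theorem layer_fstAt {n : ℕ} (hn1 : 2 ≤ n) (z : ℤ) (f) :
    z ≤ layer n (fstAt n z f) ∧ layer n (fstAt n z f) ≤ z + 1 := by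
  have := (inEdgeLayer_at hn1 z f).2; omega

theorem layer_sndAt {n : ℕ} (hn1 : 2 ≤ n) (z : ℤ) (f) :
    z ≤ layer n (sndAt n z f) ∧ layer n (sndAt n z f) ≤ z + 1 := by
  have := (inEdgeLayer_at hn1 z f).2; omega

theorem fstAt_lt_sndAt {n : ℕ} (hn1 : 2 ≤ n) (z : ℤ) (f) : fstAt n z f < sndAt n z f := by
  obtain ⟨⟨-, t, -, h⟩, -⟩ := inEdgeLayer_at hn1 z f
  omega

theorem exists_nodeAt {n : ℕ} (hn1 : 2 ≤ n) {z i : ℤ} (h : layer n i = z) :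
    ∃ a, nodeAt n z a = i := by
  have h0 : layer n (i + 2 * (n - 1) * (-z)) = 0 := by rw [layer_add hn1, h, add_neg_cancel]
  have hm : i + 2 * (n - 1) * (-z) ∈ (↑(baseNodes n) : Set ℤ) := (mem_baseNodes hn1 _).2 h0
  rw [← Finset.range_orderEmbOfFin _ (card_baseNodes n)] at hm
  obtain ⟨a, ha⟩ := hm
  exact ⟨a, by rw [nodeAt, basePos, ha]; ring⟩

theorem exists_edgeAt {n : ℕ} (hn1 : 2 ≤ n) {z i j : ℤ} (h : InEdgeLayer n z i j) :
    ∃ f, fstAt n z f = i ∧ sndAt n z f = j := by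
  have h0 : InEdgeLayer n 0 (i + 2 * (n - 1) * (-z)) (j + 2 * (n - 1) * (-z)) := by
    rw [← inEdgeLayer_add hn1 _ _ _ z]; convert h using 1 <;> ring
  have hm : toLex (i + 2 * ((n : ℤ) - 1) * (-z), j + 2 * ((n : ℤ) - 1) * (-z)) ∈
      (↑(baseEdges n) : Set (ℤ ×ₗ ℤ)) := (mem_baseEdges hn1 _).2 h0
  rw [← Finset.range_orderEmbOfFin _ (card_baseEdges n)] at hm
  obtain ⟨f, hf⟩ := hm
  exact ⟨f, by rw [fstAt, baseEdge, hf, ofLex_toLex]; ring,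
    by rw [sndAt, baseEdge, hf, ofLex_toLex]; ring⟩

theorem edgeAt_strictMono (n : ℕ) (z : ℤ) {f g : Fin (n * (n - 1))} (h : f < g) :
    fstAt n z f < fstAt n z g ∨ fstAt n z f = fstAt n z g ∧ sndAt n z f < sndAt n z g := by
  have := (baseEdge n).strictMono h
  rw [Prod.Lex.lt_iff] at this
  unfold fstAt sndAt
  omega

theorem exists_node_enum {n N h q : ℕ} (hN : N = 2 * h) (hn : 4 * n < N) (hn1 : 2 ≤ n)
    (hq : 2 ≤ q) (hq' : q + 2 ≤ orderMax n N) :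
    ∃ ν : Fin (2 * (n - 1)) → Node N, (nodeLayer n N q).sort = List.ofFn ν ∧
      ∀ a, ((ν a : ℕ) : ℤ) = nodeAt n q a := by
  have hmem : ∀ a, ∃ i : Node N, ((i : ℕ) : ℤ) = nodeAt n q a := fun a => by
    have := mem_Icc_of_layer hN hn hn1 hq (by omega) (layer_nodeAt hn1 q a)
    exact ⟨⟨(nodeAt n q a).toNat, Finset.mem_Icc.2 (by omega)⟩, by simp only; omega⟩
  choose ν hν using hmem
  refine ⟨ν, Finset.sort_eq_ofFn (fun a b hab => ?_) fun i => ?_, hν⟩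
  · have h1 : basePos n a < basePos n b := (basePos n).strictMono hab
    have ha := hν a
    have hb := hν b
    unfold nodeAt at ha hb
    rw [← Subtype.coe_lt_coe]
    omega
  · simp only [nodeLayer, Finset.mem_filter, Finset.mem_univ, true_and]
    rw [depth_eq_iff hN hn hn1 hq (by omega)]
    constructor
    · intro hl
      obtain ⟨a, ha⟩ := exists_nodeAt hn1 hl
      exact ⟨a, Subtype.ext (by have := hν a; omega)⟩
    · rintro ⟨a, rfl⟩
      rw [hν, layer_nodeAt hn1]

/-- Ties the sorted lists in `StationaryExtension` to positions on `ℤ` that do not depend on `N`: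
translations preserve the lexicographic order. -/
theorem exists_edge_enum {n N h q : ℕ} (hN : N = 2 * h) (hn : 4 * n < N) (hn1 : 2 ≤ n)
    (hq : 2 ≤ q) (hq' : q + 2 ≤ orderMax n N) :
    ∃ e : Fin (n * (n - 1)) → Edge n N, (edgeLayer n N q).sort = List.ofFn e ∧
      ∀ f, (((e f).fst : ℕ) : ℤ) = fstAt n q f ∧ (((e f).snd : ℕ) : ℤ) = sndAt n q f := by
  have hlay : ∀ {i : ℤ}, (q : ℤ) ≤ layer n i ∧ layer n i ≤ q + 1 →
      layer n i = q ∨ layer n i = (q + 1 : ℕ) := by intro i h; omega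
  have hIcc : ∀ {i : ℤ}, (q : ℤ) ≤ layer n i ∧ layer n i ≤ q + 1 → 3 ≤ i ∧ i ≤ N := by
    intro i h
    rcases hlay h with h | h
    · exact mem_Icc_of_layer hN hn hn1 hq (by omega) h
    · exact mem_Icc_of_layer hN hn hn1 (by omega) (by omega) h
  have hmem : ∀ f, ∃ e : Edge n N,
      ((e.fst : ℕ) : ℤ) = fstAt n q f ∧ ((e.snd : ℕ) : ℤ) = sndAt n q f := fun f => by
    have h1 := hIcc (layer_fstAt hn1 q f)
    have h2 := hIcc (layer_sndAt hn1 q f)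
    have h3 := fstAt_lt_sndAt hn1 q f
    obtain ⟨i, hi⟩ : ∃ i : ℕ, (i : ℤ) = fstAt n q f := ⟨(fstAt n q f).toNat, by omega⟩
    obtain ⟨j, hj⟩ : ∃ j : ℕ, (j : ℤ) = sndAt n q f := ⟨(sndAt n q f).toNat, by omega⟩
    have hij : i < j := by omega
    refine ⟨⟨toLex (⟨i, Finset.mem_Icc.2 (by omega)⟩, ⟨j, Finset.mem_Icc.2 (by omega)⟩), hij, ?_⟩,
      hi, hj⟩
    change (graph n N).Adj i j
    rw [adj_iff_isEdge hN hn hn1 hq hq' hij (by rw [hi]; exact hlay (layer_fstAt hn1 q f))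
      (by rw [hj]; exact hlay (layer_sndAt hn1 q f)), hi, hj]
    exact (inEdgeLayer_at hn1 q f).1
  choose e he using hmem
  refine ⟨e, Finset.sort_eq_ofFn (fun f g hfg => ?_) fun d => ?_, he⟩
  · have h1 := edgeAt_strictMono n q hfg
    rw [← (he f).1, ← (he f).2, ← (he g).1, ← (he g).2] at h1
    rw [← Subtype.coe_lt_coe, Prod.Lex.lt_iff]
    change (e f).fst < (e g).fst ∨ (e f).fst = (e g).fst ∧ (e f).snd < (e g).snd
    rw [← Subtype.coe_lt_coe, ← Subtype.coe_lt_coe, Subtype.ext_iff]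
    omega
  · have hadj : (graph n N).Adj (d.fst : ℕ) (d.snd : ℕ) := d.2.2
    have hlt : (d.fst : ℕ) < (d.snd : ℕ) := d.2.1
    simp only [edgeLayer, Finset.mem_filter, Finset.mem_univ, true_and]
    simp only [depth_eq_iff hN hn hn1 hq (by omega),
      depth_eq_iff hN hn hn1 (show 2 ≤ q + 1 by omega) (by omega)]
    constructor
    · intro hl
      have hE : InEdgeLayer n q (d.fst : ℕ) (d.snd : ℕ) := by
        refine ⟨(adj_iff_isEdge hN hn hn1 hq hq' hlt (by omega) (by omega)).1 hadj, ?_⟩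
        push_cast at hl
        exact hl
      obtain ⟨f, h1, h2⟩ := exists_edgeAt hn1 hE
      refine ⟨f, ?_⟩
      have h3 := he f
      apply Subtype.ext
      apply ofLex.injective
      exact Prod.ext (Subtype.ext (by change ((e f).fst : ℕ) = (d.fst : ℕ); omega))
        (Subtype.ext (by change ((e f).snd : ℕ) = (d.snd : ℕ); omega))
    · rintro ⟨f, rfl⟩
      have := (inEdgeLayer_at hn1 q f).2
      rw [← (he f).1, ← (he f).2] at this
      push_cast
      exact this

theorem depth_le_add_one {n N h : ℕ} (hN : N = 2 * h) (hn : 4 * n < N) (hn1 : 2 ≤ n)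
    {i j : Node N} (hadj : (graph n N).Adj (i : ℕ) (j : ℕ)) : depth n j ≤ depth n i + 1 := by
  obtain ⟨p, hp⟩ := (inBall_iff_walk hN hn hn1 _ _).1 ((depth_le_iff hN hn hn1 i _).1 le_rfl)
  refine (SimpleGraph.dist_le (p.concat hadj)).trans ?_
  rw [SimpleGraph.Walk.length_concat]
  omega

/-- All but a bounded number of edges lie in the bulk. -/
theorem card_compl_bulk_le {n N h : ℕ} (hN : N = 2 * h) (hn : 4 * n < N) (hn1 : 2 ≤ n) :
    (Finset.univ \ edgeLayers n N 2 (orderMax n N - 2)).card ≤ (20 * n) * (20 * n) := by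
  -- These labels include all nodes at distance at most `2` from node `1` and all those at distance
  -- greater than `orderMax n N - 2`.
  set T : Finset ℕ := Finset.range (5 * n) ∪ Finset.Icc (N - 14 * n) N with hT
  have hTc : T.card ≤ 20 * n := by
    refine (Finset.card_union_le _ _).trans ?_
    rw [Finset.card_range, Nat.card_Icc]
    omega
  have hom := two_le_orderMax hN hn hn1
  have hlow : ∀ i : Node N, depth n i ≤ 2 → (i : ℕ) ∈ T := by
    intro i hi
    rw [depth_le_iff hN hn hn1] at hi
    simp only [hT, Finset.mem_union, Finset.mem_range, Finset.mem_Icc]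
    unfold InBall cyclePos at hi
    split_ifs at hi <;> omega
  have hhigh : ∀ i : Node N, orderMax n N - 2 < depth n i → (i : ℕ) ∈ T := by
    intro i hi
    rw [← not_le, depth_le_iff hN hn hn1] at hi
    have h1 := le_two_mul_orderMax hN hn hn1
    have h2 : ((orderMax n N - 2 : ℕ) : ℤ) * ((n : ℤ) - 1) =
        (orderMax n N + 1) * ((n : ℤ) - 1) - 3 * (n - 1) := by
      rw [Nat.cast_sub hom]; push_cast; ring
    rw [h2] at hi
    have hiN := Finset.mem_Icc.1 i.2
    simp only [hT, Finset.mem_union, Finset.mem_range, Finset.mem_Icc]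
    generalize ((orderMax n N : ℤ) + 1) * ((n : ℤ) - 1) = A at *
    unfold InBall cyclePos at hi
    split_ifs at hi <;> omega
  refine (Finset.card_le_card_of_injOn (fun e : Edge n N => ((e.fst : ℕ), (e.snd : ℕ)))
    (t := T ×ˢ T) (fun e he => ?_) fun e _ e' _ hee => ?_).trans ?_
  · have hadj : (graph n N).Adj (e.fst : ℕ) (e.snd : ℕ) := e.2.2
    have hlt : (e.fst : ℕ) < (e.snd : ℕ) := e.2.1
    have d1 := depth_le_add_one hN hn hn1 hadj
    have d2 := depth_le_add_one hN hn hn1 hadj.symm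
    simp only [Finset.coe_sdiff, Finset.coe_univ, Set.mem_sdiff, Set.mem_univ, true_and,
      Finset.mem_coe, edgeLayers, Finset.mem_biUnion, Finset.mem_Icc, not_exists, not_and] at he
    have he' := fun q hq => he q hq
    simp only [edgeLayer, Finset.mem_filter, Finset.mem_univ, true_and] at he'
    rw [Finset.mem_coe, Finset.mem_product]
    by_cases hc : depth n e.fst ≤ 2 ∧ depth n e.snd ≤ 2
    · exact ⟨hlow _ hc.1, hlow _ hc.2⟩
    · by_cases hc' : orderMax n N - 2 < depth n e.fst ∧ orderMax n N - 2 < depth n e.snd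
      · exact ⟨hhigh _ hc'.1, hhigh _ hc'.2⟩
      · exfalso
        -- Depths of adjacent nodes differ by at most one, so the larger depth minus one is the
        -- index of the edge layer.
        refine he' (max (depth n e.fst) (depth n e.snd) - 1) (by omega) (by omega)
  · simp only [Prod.mk.injEq] at hee
    apply Subtype.ext
    apply ofLex.injective
    exact Prod.ext (Subtype.ext hee.1) (Subtype.ext hee.2)
  · rw [Finset.card_product]
    exact Nat.mul_le_mul hTc hTc

theorem tendsto_orderMax {n : ℕ} (hn1 : 2 ≤ n) : Tendsto (orderMax n) evenAtTop atTop := by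
  rw [tendsto_atTop]
  intro b
  rw [evenAtTop, eventually_inf_principal]
  filter_upwards [eventually_gt_atTop (4 * n + 2 * (b * n) + 2)] with N hN hev
  obtain ⟨h, hh⟩ := hev
  have h1 := le_two_mul_orderMax (n := n) (by omega : N = 2 * h) (by omega) hn1
  by_contra! hc
  have h2 : ((orderMax n N : ℤ) + 1) * (n - 1) ≤ b * n := by
    apply mul_le_mul <;> omega
  have : ((b * n : ℕ) : ℤ) = b * n := by push_cast; ring
  omega

/-! ### Likelihoods as integrals over the weights -/

section Likelihood

variable {𝒱 : Type u} {𝒳 : Type v} [MeasurableSpace 𝒱]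

/-- `k` is a measurable family of probability mass functions. -/
structure IsObsKernel (k : 𝒳 → 𝒱 → 𝒱 → ℝ) : Prop where
  meas (x : 𝒳) : Measurable (Function.uncurry (k x))
  nonneg (x : 𝒳) (v₁ v₂ : 𝒱) : 0 ≤ k x v₁ v₂
  sum (v₁ v₂ : 𝒱) : HasSum (fun x => k x v₁ v₂) 1

namespace IsObsKernel

variable {k : 𝒳 → 𝒱 → 𝒱 → ℝ}

theorem le_one (hk : IsObsKernel k) (x : 𝒳) (v₁ v₂ : 𝒱) : k x v₁ v₂ ≤ 1 :=
  le_hasSum (hk.sum v₁ v₂) x fun y _ => hk.nonneg y v₁ v₂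

/-- A positive constant is summable only over a finite type. -/
theorem finite (hk : IsObsKernel k) {ε : ℝ} (hε : 0 < ε) {v₁ v₂ : 𝒱} (h : ∀ x, ε ≤ k x v₁ v₂) :
    Finite 𝒳 := by
  have hs : Summable fun _ : 𝒳 => ε :=
    (hk.sum v₁ v₂).summable.of_nonneg_of_le (fun _ => hε.le) h
  by_contra hfin
  rw [not_finite_iff_infinite] at hfin
  exact hε.ne' ((summable_const_iff _).1 hs)

theorem sum_ofReal [Fintype 𝒳] (hk : IsObsKernel k) (v₁ v₂ : 𝒱) :
    ∑ x, ENNReal.ofReal (k x v₁ v₂) = 1 := by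
  rw [← ENNReal.ofReal_sum_of_nonneg fun x _ => hk.nonneg x v₁ v₂,
    (hasSum_fintype _).unique (hk.sum v₁ v₂), ENNReal.ofReal_one]

end IsObsKernel

/-- The product of the kernels over a set of edges, as a function of the weights. -/
def edgeWeight (k : 𝒳 → 𝒱 → 𝒱 → ℝ) {n N : ℕ} (S : Finset (Edge n N)) (x : Edge n N → 𝒳)
    (v : ℤ → 𝒱) : ℝ := ∏ e ∈ S, k (x e) (v (e.fst : ℕ)) (v (e.snd : ℕ))

/-- The likelihood of the observations on a set of edges. -/
noncomputable def cylLik (k : 𝒳 → 𝒱 → 𝒱 → ℝ) {n N : ℕ} (π : Measure 𝒱) (S : Finset (Edge n N))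
    (x : Edge n N → 𝒳) : ℝ := ∫ v, edgeWeight k S x v ∂(Measure.infinitePi fun _ : ℤ => π)

theorem measurePreserving_precomp {α ι : Type*} (π : Measure 𝒱) [IsProbabilityMeasure π]
    {g : α → ι} (hg : Function.Injective g) :
    MeasurePreserving (fun (v : ι → 𝒱) a => v (g a)) (Measure.infinitePi fun _ => π)
      (Measure.infinitePi fun _ => π) :=
  ⟨by fun_prop, Measure.map_infinitePi_infinitePi_of_inj hg⟩

theorem node_cast_injective (N : ℕ) : Function.Injective fun i : Node N => ((i : ℕ) : ℤ) :=
  fun i j h => Subtype.ext (by simpa using h)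

theorem measurable_kernel_comp {k : 𝒳 → 𝒱 → 𝒱 → ℝ} (hk : ∀ x, Measurable (Function.uncurry (k x)))
    {Ω : Type*} [MeasurableSpace Ω] (x : 𝒳) {f g : Ω → 𝒱} (hf : Measurable f) (hg : Measurable g) :
    Measurable fun ω => k x (f ω) (g ω) := (hk x).comp (hf.prodMk hg)

theorem cylLik_nonneg {k : 𝒳 → 𝒱 → 𝒱 → ℝ} (hk : IsObsKernel k) {n N : ℕ} (π : Measure 𝒱)
    (S : Finset (Edge n N)) (x : Edge n N → 𝒳) : 0 ≤ cylLik k π S x :=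
  integral_nonneg fun _ => Finset.prod_nonneg fun _ _ => hk.nonneg _ _ _

theorem measurable_edgeWeight {k : 𝒳 → 𝒱 → 𝒱 → ℝ} (hk : ∀ x, Measurable (Function.uncurry (k x)))
    {n N : ℕ} (S : Finset (Edge n N)) (x : Edge n N → 𝒳) : Measurable (edgeWeight k S x) :=
  Finset.measurable_fun_prod _ fun _ _ =>
    measurable_kernel_comp hk _ (measurable_pi_apply _) (measurable_pi_apply _)

/-- The factors of the unconstrained edges sum to one after exchanging sum and product. -/
theorem sum_indicator_cylinder [Fintype 𝒳] [DecidableEq 𝒳] {k : 𝒳 → 𝒱 → 𝒱 → ℝ}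
    (hk : IsObsKernel k) {n N : ℕ} (S : Finset (Edge n N)) (x : Edge n N → 𝒳) (v : Node N → 𝒱) :
    ∑ y, {y : Edge n N → 𝒳 | ∀ e ∈ S, y e = x e}.indicator (fun y =>
      ∏ e : Edge n N, ENNReal.ofReal (k (y e) (v e.fst) (v e.snd))) y =
      ∏ e ∈ S, ENNReal.ofReal (k (x e) (v e.fst) (v e.snd)) := by
  classical
  set t : Edge n N → Finset 𝒳 := fun e => if e ∈ S then {x e} else Finset.univ with ht
  have h1 : ∀ y : Edge n N → 𝒳, y ∈ {y : Edge n N → 𝒳 | ∀ e ∈ S, y e = x e} ↔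
      y ∈ Fintype.piFinset t := by
    intro y
    rw [Fintype.mem_piFinset]
    refine forall_congr' fun e => ?_
    by_cases he : e ∈ S <;> simp [ht, he]
  have h2 : ∑ y, {y : Edge n N → 𝒳 | ∀ e ∈ S, y e = x e}.indicator (fun y =>
      ∏ e : Edge n N, ENNReal.ofReal (k (y e) (v e.fst) (v e.snd))) y =
      ∑ y ∈ Fintype.piFinset t, ∏ e : Edge n N, ENNReal.ofReal (k (y e) (v e.fst) (v e.snd)) := by
    rw [← Finset.sum_subset (Finset.subset_univ (Fintype.piFinset t))]
    · exact Finset.sum_congr rfl fun y hy => Set.indicator_of_mem ((h1 y).2 hy) _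
    · exact fun y _ hy => Set.indicator_of_notMem (fun h => hy ((h1 y).1 h)) _
  rw [h2, ← Finset.prod_univ_sum t fun e a => ENNReal.ofReal (k a (v e.fst) (v e.snd)),
    ← Finset.prod_subset (Finset.subset_univ S)]
  · exact Finset.prod_congr rfl fun e he => by simp [ht, he]
  · intro e _ he
    simp only [ht, he, if_false]
    exact hk.sum_ofReal _ _

variable [MeasurableSpace 𝒳]

theorem jointLaw_apply [Fintype 𝒳] [DiscreteMeasurableSpace 𝒳] {k : 𝒳 → 𝒱 → 𝒱 → ℝ}
    (hk : ∀ x, Measurable (Function.uncurry (k x))) (n N : ℕ) (π : Measure 𝒱)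
    [IsProbabilityMeasure π] (S : Set (Edge n N → 𝒳)) {A : Set (Node N → 𝒱)}
    (hA : MeasurableSet A) :
    jointLaw k n N π (S ×ˢ A) = ∫⁻ v in A, ∑ y, S.indicator (fun y =>
      ∏ e : Edge n N, ENNReal.ofReal (k (y e) (v e.fst) (v e.snd))) y
      ∂(Measure.pi fun _ : Node N => π) := by
  classical
  have hS : MeasurableSet S := S.toFinite.measurableSet
  have hm : Measurable fun p : (Edge n N → 𝒳) × (Node N → 𝒱) =>
      ∏ e : Edge n N, ENNReal.ofReal (k (p.1 e) (p.2 e.fst) (p.2 e.snd)) := by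
    refine measurable_from_prod_countable_right fun y => ?_
    refine Finset.measurable_fun_prod _ fun e _ => ENNReal.measurable_ofReal.comp ?_
    exact measurable_kernel_comp hk _ (measurable_pi_apply _) (measurable_pi_apply _)
  rw [jointLaw, withDensity_apply _ (hS.prod hA), ← Measure.prod_restrict,
    lintegral_prod_symm _ hm.aemeasurable]
  refine lintegral_congr fun v => ?_
  rw [← lintegral_indicator hS, lintegral_count, tsum_fintype]

variable [DiscreteMeasurableSpace 𝒳] [Finite 𝒳]

/-- The probability of a cylinder. -/
theorem obsLaw_cylinder {k : 𝒳 → 𝒱 → 𝒱 → ℝ} (hk : IsObsKernel k) {n N : ℕ} (π : Measure 𝒱)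
    [IsProbabilityMeasure π] (S : Finset (Edge n N)) (x : Edge n N → 𝒳) :
    obsLaw k n N π {y | ∀ e ∈ S, y e = x e} = ENNReal.ofReal (cylLik k π S x) := by
  classical
  have := Fintype.ofFinite 𝒳
  have hpre : (Prod.fst ⁻¹' {y : Edge n N → 𝒳 | ∀ e ∈ S, y e = x e} :
      Set ((Edge n N → 𝒳) × (Node N → 𝒱))) = {y | ∀ e ∈ S, y e = x e} ×ˢ Set.univ := by
    ext; simp
  rw [obsLaw, Measure.map_apply measurable_fst (Set.toFinite _).measurableSet, hpre,
    jointLaw_apply hk.meas _ _ _ _ MeasurableSet.univ, Measure.restrict_univ]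
  simp_rw [sum_indicator_cylinder hk]
  rw [← Measure.infinitePi_eq_pi,
    ← (measurePreserving_precomp π (node_cast_injective N)).lintegral_comp, cylLik,
    ofReal_integral_eq_lintegral_ofReal]
  · refine lintegral_congr fun v => ?_
    rw [edgeWeight, ENNReal.ofReal_prod_of_nonneg fun e _ => hk.nonneg _ _ _]
  · refine Integrable.of_bound (measurable_edgeWeight hk.meas S x).aestronglyMeasurable 1
      (ae_of_all _ fun v => ?_)
    rw [edgeWeight, Real.norm_eq_abs, abs_of_nonneg (Finset.prod_nonneg fun e _ => hk.nonneg _ _ _)]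
    exact Finset.prod_le_one (fun e _ => hk.nonneg _ _ _) fun e _ => hk.le_one _ _ _
  · exact ae_of_all _ fun v => Finset.prod_nonneg fun e _ => hk.nonneg _ _ _
  · refine Finset.measurable_fun_prod _ fun e _ => ENNReal.measurable_ofReal.comp ?_
    exact measurable_kernel_comp hk.meas _ (measurable_pi_apply _) (measurable_pi_apply _)

theorem obsLaw_real_cylinder {k : 𝒳 → 𝒱 → 𝒱 → ℝ} (hk : IsObsKernel k) {n N : ℕ} (π : Measure 𝒱)
    [IsProbabilityMeasure π] (S : Finset (Edge n N)) (x : Edge n N → 𝒳) :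
    (obsLaw k n N π).real {y | ∀ e ∈ S, y e = x e} = cylLik k π S x := by
  rw [measureReal_def, obsLaw_cylinder hk, ENNReal.toReal_ofReal (cylLik_nonneg hk _ _ _)]

theorem logLik_eq {k : 𝒳 → 𝒱 → 𝒱 → ℝ} (hk : IsObsKernel k) (n N : ℕ) (π : Measure 𝒱)
    [IsProbabilityMeasure π] (x : Edge n N → 𝒳) :
    logLik k n N π x = Real.log (cylLik k π Finset.univ x) := by
  rw [logLik, ← obsLaw_real_cylinder hk]
  congr 2
  ext y
  simp [funext_iff]

theorem condLogLik_eq {k : 𝒳 → 𝒱 → 𝒱 → ℝ} (hk : IsObsKernel k) (n N : ℕ) (π : Measure 𝒱)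
    [IsProbabilityMeasure π] (x : Edge n N → 𝒳) {q : ℕ} (hq : q ≤ orderMax n N - 1) :
    condLogLik k n N π q x = Real.log (cylLik k π (edgeLayers n N q (orderMax n N - 1)) x /
      cylLik k π (edgeLayers n N (q + 1) (orderMax n N - 1)) x) := by
  have : IsFiniteMeasure (obsLaw k n N π) := ⟨by
    have := obsLaw_cylinder hk (n := n) (N := N) π ∅
    by_cases hne : Nonempty (Edge n N → 𝒳)
    · obtain ⟨y⟩ := hne
      have h := this y
      simp only [Finset.notMem_empty, false_implies, implies_true, Set.ofPred_true] at h
      rw [h]; exact ENNReal.ofReal_lt_top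
    · rw [not_nonempty_iff] at hne
      rw [Set.univ_eq_empty_iff.2 hne]; simp⟩
  rw [condLogLik, measureReal_def, cond_apply (Set.toFinite _).measurableSet, ENNReal.toReal_mul,
    ENNReal.toReal_inv, ← measureReal_def, ← measureReal_def, obsLaw_real_cylinder hk,
    mul_comm, ← div_eq_mul_inv]
  congr 2
  rw [← obsLaw_real_cylinder hk]
  congr 1
  have he : edgeLayers n N q (orderMax n N - 1) =
      edgeLayer n N q ∪ edgeLayers n N (q + 1) (orderMax n N - 1) := by
    rw [edgeLayers, edgeLayers, ← Finset.insert_Icc_add_one_left_eq_Icc hq, Finset.biUnion_insert]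
  ext y
  simp only [he, Set.mem_inter_iff, Set.mem_ofPred_eq, Finset.mem_union, or_imp, forall_and]
  tauto

end Likelihood

/-! ### Likelihoods of the bulk layers and their increments -/

section Bulk

variable {𝒱 : Type u} {𝒳 : Type v} [MeasurableSpace 𝒱]

/-- The product of the kernels over the edges of the layer `z`, which carry the observations
`y`. -/
def layerWeight (k : 𝒳 → 𝒱 → 𝒱 → ℝ) (n : ℕ) (z : ℤ) (y : Fin (n * (n - 1)) → 𝒳) (v : ℤ → 𝒱) : ℝ :=
  ∏ f, k (y f) (v (fstAt n z f)) (v (sndAt n z f))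

/-- The product of the kernels over the layers `q + j`, `j ∈ I`. -/
def bulkWeight (k : 𝒳 → 𝒱 → 𝒱 → ℝ) (n : ℕ) (q : ℤ) (I : Finset ℕ)
    (x : ℤ → Fin (n * (n - 1)) → 𝒳) (v : ℤ → 𝒱) : ℝ :=
  ∏ j ∈ I, layerWeight k n (q + j) (x (q + j)) v

/-- The likelihood of the layers `q + j`, `j ∈ I`. -/
noncomputable def bulkLik (k : 𝒳 → 𝒱 → 𝒱 → ℝ) (n : ℕ) (π : Measure 𝒱) (q : ℤ) (I : Finset ℕ)
    (x : ℤ → Fin (n * (n - 1)) → 𝒳) : ℝ :=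
  ∫ v, bulkWeight k n q I x v ∂(Measure.infinitePi fun _ : ℤ => π)

/-- The conditional log-likelihood of the layer `q` given the `r` following ones. -/
noncomputable def bulkIncr (k : 𝒳 → 𝒱 → 𝒱 → ℝ) (n : ℕ) (π : Measure 𝒱) (q : ℤ) (r : ℕ)
    (x : ℤ → Fin (n * (n - 1)) → 𝒳) : ℝ :=
  Real.log (bulkLik k n π q (Finset.Icc 0 r) x) - Real.log (bulkLik k n π q (Finset.Icc 1 r) x)

/-- The conditional log-likelihood of the layer `0` given all the following ones. -/
noncomputable def ell (k : 𝒳 → 𝒱 → 𝒱 → ℝ) (n : ℕ) (π : Measure 𝒱)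
    (x : ℤ → Fin (n * (n - 1)) → 𝒳) : ℝ :=
  limUnder atTop fun r => bulkIncr k n π 0 r x

theorem shift_iterate_apply {S : Type*} (q : ℕ) (x : ℤ → S) (z : ℤ) :
    shift^[q] x z = x (q + z) := by
  induction q generalizing z with
  | zero => simp
  | succ q ih =>
    rw [Function.iterate_succ_apply']
    change shift^[q] x (z + 1) = _
    rw [ih]
    congr 1
    push_cast; ring

theorem measurable_layerWeight {k : 𝒳 → 𝒱 → 𝒱 → ℝ} (hk : ∀ x, Measurable (Function.uncurry (k x)))
    (n : ℕ) (z : ℤ) (y : Fin (n * (n - 1)) → 𝒳) : Measurable (layerWeight k n z y) :=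
  Finset.measurable_fun_prod _ fun _ _ =>
    measurable_kernel_comp hk _ (measurable_pi_apply _) (measurable_pi_apply _)

theorem measurable_bulkWeight {k : 𝒳 → 𝒱 → 𝒱 → ℝ} (hk : ∀ x, Measurable (Function.uncurry (k x)))
    (n : ℕ) (q : ℤ) (I : Finset ℕ) (x : ℤ → Fin (n * (n - 1)) → 𝒳) :
    Measurable (bulkWeight k n q I x) :=
  Finset.measurable_fun_prod _ fun _ _ => measurable_layerWeight hk _ _ _

/-- Translating the labels by `2 (n - 1) q` moves the layers by `q` and preserves the i.i.d. law of
the weights. -/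
theorem bulkLik_shift {k : 𝒳 → 𝒱 → 𝒱 → ℝ} (hk : ∀ x, Measurable (Function.uncurry (k x)))
    (n : ℕ) (π : Measure 𝒱) [IsProbabilityMeasure π] (q : ℕ) (z : ℤ) (I : Finset ℕ)
    (x : ℤ → Fin (n * (n - 1)) → 𝒳) :
    bulkLik k n π (q + z) I x = bulkLik k n π z I (shift^[q] x) := by
  have hinj : Function.Injective fun i : ℤ => i + 2 * ((n : ℤ) - 1) * q := add_left_injective _
  have hmp := measurePreserving_precomp π hinj
  rw [bulkLik, bulkLik]
  conv_rhs => rw [← hmp.map_eq, integral_map hmp.measurable.aemeasurable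
    (measurable_bulkWeight hk _ _ _ _).aestronglyMeasurable]
  refine integral_congr_ae (ae_of_all _ fun v => Finset.prod_congr rfl fun j _ =>
    Finset.prod_congr rfl fun f _ => ?_)
  rw [shift_iterate_apply, ← add_assoc]
  congr 2
  · simp only [fstAt]; ring
  · simp only [sndAt]; ring

theorem bulkIncr_shift {k : 𝒳 → 𝒱 → 𝒱 → ℝ} (hk : ∀ x, Measurable (Function.uncurry (k x)))
    (n : ℕ) (π : Measure 𝒱) [IsProbabilityMeasure π] (q : ℕ) (r : ℕ)
    (x : ℤ → Fin (n * (n - 1)) → 𝒳) :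
    bulkIncr k n π q r x = bulkIncr k n π 0 r (shift^[q] x) := by
  rw [bulkIncr, bulkIncr, ← bulkLik_shift hk, ← bulkLik_shift hk, add_zero]

theorem prod_Icc_add {M : Type*} [CommMonoid M] (F : ℕ → M) (q a b : ℕ) :
    ∏ p ∈ Finset.Icc (q + a) (q + b), F p = ∏ j ∈ Finset.Icc a b, F (q + j) := by
  rw [← Finset.image_add_left_Icc, Finset.prod_image (by simp)]

theorem prod_Icc_mul_prod_Icc {M : Type*} [CommMonoid M] (F : ℕ → M) {a b c : ℕ} (hab : a ≤ b + 1)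
    (hbc : b ≤ c) :
    (∏ p ∈ Finset.Icc a b, F p) * ∏ p ∈ Finset.Icc (b + 1) c, F p = ∏ p ∈ Finset.Icc a c, F p := by
  rw [← Finset.prod_union]
  · congr 1
    ext p
    simp only [Finset.mem_union, Finset.mem_Icc]
    omega
  · rw [Finset.disjoint_left]
    intro p
    simp only [Finset.mem_Icc]
    omega

omit [MeasurableSpace 𝒱] in
theorem bulkWeight_Icc_succ (k : 𝒳 → 𝒱 → 𝒱 → ℝ) (n : ℕ) (q : ℤ) (a r : ℕ)
    (x : ℤ → Fin (n * (n - 1)) → 𝒳) (v : ℤ → 𝒱) :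
    bulkWeight k n q (Finset.Icc (1 + a) (1 + r)) x v =
      bulkWeight k n (q + 1) (Finset.Icc a r) x v := by
  rw [bulkWeight, prod_Icc_add, bulkWeight]
  refine Finset.prod_congr rfl fun j _ => ?_
  push_cast
  rw [add_assoc]

/-! ### Kernels bounded from below -/

/-- The σ-algebra of the coordinates in `S`. -/
@[reducible] def coordSigma (𝒱 : Type u) [MeasurableSpace 𝒱] (S : Set ℤ) : MeasurableSpace (ℤ → 𝒱) :=
  ⨆ i ∈ S, MeasurableSpace.comap (fun v => v i) inferInstance

theorem measurable_coordSigma {S : Set ℤ} {i : ℤ} (hi : i ∈ S) :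
    Measurable[coordSigma 𝒱 S] fun v : ℤ → 𝒱 => v i :=
  Measurable.mono (comap_measurable _)
    (le_iSup₂ (f := fun (i : ℤ) (_ : i ∈ S) =>
      MeasurableSpace.comap (fun v : ℤ → 𝒱 => v i) inferInstance) i hi) le_rfl

theorem coordSigma_le (S : Set ℤ) : coordSigma 𝒱 S ≤ MeasurableSpace.pi :=
  iSup₂_le fun i _ => (measurable_pi_apply i).comap_le

theorem coordSigma_mono {S T : Set ℤ} (h : S ⊆ T) : coordSigma 𝒱 S ≤ coordSigma 𝒱 T :=
  iSup₂_le fun i hi => le_iSup₂ (f := fun (i : ℤ) (_ : i ∈ T) =>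
      MeasurableSpace.comap (fun v : ℤ → 𝒱 => v i) inferInstance) i (h hi)

theorem indep_coordSigma (π : Measure 𝒱) [IsProbabilityMeasure π] {S T : Set ℤ}
    (h : Disjoint S T) :
    Indep (coordSigma 𝒱 S) (coordSigma 𝒱 T) (Measure.infinitePi fun _ : ℤ => π) :=
  indep_iSup_of_disjoint (fun i => (measurable_pi_apply i).comap_le)
    (iIndepFun_infinitePi (P := fun _ : ℤ => π) (X := fun _ v => v) fun _ => measurable_id) h

theorem measurable_layerWeight_coordSigma {k : 𝒳 → 𝒱 → 𝒱 → ℝ}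
    (hk : ∀ x, Measurable (Function.uncurry (k x))) {n : ℕ} (z : ℤ)
    (y : Fin (n * (n - 1)) → 𝒳) {S : Set ℤ} (hS : ∀ f, fstAt n z f ∈ S ∧ sndAt n z f ∈ S) :
    Measurable[coordSigma 𝒱 S] (layerWeight k n z y) :=
  @Finset.measurable_fun_prod _ _ _ _ _ _ (coordSigma 𝒱 S) _ _ fun f _ =>
    @measurable_kernel_comp _ _ _ _ hk _ (coordSigma 𝒱 S) _ _ _
      (measurable_coordSigma (hS f).1) (measurable_coordSigma (hS f).2)

theorem prod_mem_Icc {ι : Type*} (s : Finset ι) {F : ι → ℝ} {ε : ℝ} (hε : 0 ≤ ε)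
    (h : ∀ i ∈ s, ε ≤ F i ∧ F i ≤ 1) : ε ^ s.card ≤ ∏ i ∈ s, F i ∧ ∏ i ∈ s, F i ≤ 1 := by
  refine ⟨?_, Finset.prod_le_one (fun i hi => hε.trans (h i hi).1) fun i hi => (h i hi).2⟩
  rw [← Finset.prod_const]
  exact Finset.prod_le_prod (fun _ _ => hε) fun i hi => (h i hi).1

omit [MeasurableSpace 𝒱] in
theorem layerWeight_mem {k : 𝒳 → 𝒱 → 𝒱 → ℝ} {ε : ℝ} (hε : 0 ≤ ε)
    (h : ∀ x v₁ v₂, ε ≤ k x v₁ v₂ ∧ k x v₁ v₂ ≤ 1) (n : ℕ) (z : ℤ)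
    (y : Fin (n * (n - 1)) → 𝒳) (v : ℤ → 𝒱) :
    ε ^ (n * (n - 1)) ≤ layerWeight k n z y v ∧ layerWeight k n z y v ≤ 1 := by
  have := prod_mem_Icc Finset.univ (F := fun f => k (y f) (v (fstAt n z f)) (v (sndAt n z f))) hε
    fun f _ => h _ _ _
  rwa [Finset.card_univ, Fintype.card_fin] at this

/-- An edge of the layer `z` has its endpoints in the node layers `z` and `z + 1`, and disjoint sets
of coordinates are independent. -/
theorem weightChain {k : 𝒳 → 𝒱 → 𝒱 → ℝ} (hk : ∀ x, Measurable (Function.uncurry (k x)))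
    {ε : ℝ} (hε : 0 < ε) (h : ∀ x v₁ v₂, ε ≤ k x v₁ v₂ ∧ k x v₁ v₂ ≤ 1) {n : ℕ} (hn1 : 2 ≤ n)
    (π : Measure 𝒱) [IsProbabilityMeasure π] (q : ℤ) (x : ℤ → Fin (n * (n - 1)) → 𝒳) :
    WeightChain (Measure.infinitePi fun _ : ℤ => π)
      (fun j => coordSigma 𝒱 {i | layer n i ≤ q + j})
      (fun j => coordSigma 𝒱 {i | q + j ≤ layer n i}) (ε ^ (n * (n - 1)))
      (fun j => layerWeight k n (q + j) (x (q + j))) where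
  past_le j := coordSigma_le _
  fut_le j := coordSigma_le _
  past_mono i j hij := coordSigma_mono fun a ha => by
    rw [Set.mem_ofPred_eq] at ha ⊢; omega
  fut_anti i j hij := coordSigma_mono fun a ha => by
    rw [Set.mem_ofPred_eq] at ha ⊢; omega
  indep j := indep_coordSigma π (Set.disjoint_left.2 fun a ha hb => by
    rw [Set.mem_ofPred_eq] at ha hb; omega)
  meas_past j := measurable_layerWeight_coordSigma hk _ _ fun f => by
    have h1 := layer_fstAt hn1 (q + j) f
    have h2 := layer_sndAt hn1 (q + j) f
    constructor <;> (rw [Set.mem_ofPred_eq]; omega)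
  meas_fut j := measurable_layerWeight_coordSigma hk _ _ fun f => by
    have h1 := layer_fstAt hn1 (q + j) f
    have h2 := layer_sndAt hn1 (q + j) f
    constructor <;> (rw [Set.mem_ofPred_eq]; omega)
  pos := pow_pos hε _
  lower j v := (layerWeight_mem hε.le h n _ _ v).1
  upper j v := (layerWeight_mem hε.le h n _ _ v).2

omit [MeasurableSpace 𝒱] in
theorem bulkWeight_mem {k : 𝒳 → 𝒱 → 𝒱 → ℝ} {ε : ℝ} (hε : 0 ≤ ε)
    (h : ∀ x v₁ v₂, ε ≤ k x v₁ v₂ ∧ k x v₁ v₂ ≤ 1) (n : ℕ) (q : ℤ) (I : Finset ℕ)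
    (x : ℤ → Fin (n * (n - 1)) → 𝒳) (v : ℤ → 𝒱) :
    (ε ^ (n * (n - 1))) ^ I.card ≤ bulkWeight k n q I x v ∧ bulkWeight k n q I x v ≤ 1 :=
  prod_mem_Icc I (pow_nonneg hε _) fun _ _ => layerWeight_mem hε h n _ _ v

theorem integrable_of_mem {Ω : Type*} [MeasurableSpace Ω] {μ : Measure Ω} [IsFiniteMeasure μ]
    {F : Ω → ℝ} (hF : Measurable F) {c : ℝ} (hc : 0 ≤ c) (h : ∀ ω, c ≤ F ω ∧ F ω ≤ 1) :
    Integrable F μ := by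
  refine Integrable.of_bound hF.aestronglyMeasurable 1 (ae_of_all _ fun ω => ?_)
  rw [Real.norm_eq_abs, abs_of_nonneg (hc.trans (h ω).1)]
  exact (h ω).2

theorem integral_mem {Ω : Type*} [MeasurableSpace Ω] {μ : Measure Ω} [IsProbabilityMeasure μ]
    {F : Ω → ℝ} (hF : Measurable F) {c : ℝ} (hc : 0 ≤ c) (h : ∀ ω, c ≤ F ω ∧ F ω ≤ 1) :
    c ≤ ∫ ω, F ω ∂μ ∧ ∫ ω, F ω ∂μ ≤ 1 := by
  have hi := integrable_of_mem (μ := μ) hF hc h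
  have h1 : ∫ _ : Ω, c ∂μ ≤ ∫ ω, F ω ∂μ := integral_mono (integrable_const _) hi fun ω => (h ω).1
  have h2 : ∫ ω, F ω ∂μ ≤ ∫ _ : Ω, 1 ∂μ := integral_mono hi (integrable_const _) fun ω => (h ω).2
  simp only [integral_const, probReal_univ, smul_eq_mul, one_mul] at h1 h2
  exact ⟨h1, h2⟩

/-- A factor in `[c, 1]` changes the logarithm of an integral by at most `- log c`. -/
theorem abs_log_integral_mul_sub_le {Ω : Type*} [MeasurableSpace Ω] {μ : Measure Ω}
    [IsProbabilityMeasure μ] {F G : Ω → ℝ} (hF : Measurable F) (hG : Measurable G) {b c : ℝ}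
    (hb : 0 < b) (hc : 0 < c) (h : ∀ ω, b ≤ F ω ∧ F ω ≤ 1) (h' : ∀ ω, c ≤ G ω ∧ G ω ≤ 1) :
    |Real.log (∫ ω, G ω * F ω ∂μ) - Real.log (∫ ω, F ω ∂μ)| ≤ - Real.log c := by
  have hF' := integral_mem (μ := μ) hF hb.le h
  have iF := integrable_of_mem (μ := μ) hF hb.le h
  have hGF : ∀ ω, 0 ≤ G ω * F ω ∧ G ω * F ω ≤ 1 := fun ω =>
    ⟨mul_nonneg (hc.le.trans (h' ω).1) (hb.le.trans (h ω).1),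
      mul_le_one₀ (h' ω).2 (hb.le.trans (h ω).1) (h ω).2⟩
  have iGF := integrable_of_mem (μ := μ) (hG.mul hF) le_rfl hGF
  have h1 : ∫ ω, c * F ω ∂μ ≤ ∫ ω, G ω * F ω ∂μ := integral_mono (iF.const_mul c) iGF fun ω =>
    mul_le_mul_of_nonneg_right (h' ω).1 (hb.le.trans (h ω).1)
  have h2 : ∫ ω, G ω * F ω ∂μ ≤ ∫ ω, F ω ∂μ := integral_mono iGF iF fun ω =>
    mul_le_of_le_one_left (hb.le.trans (h ω).1) (h' ω).2
  rw [integral_const_mul] at h1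
  have hp : 0 < ∫ ω, F ω ∂μ := hb.trans_le hF'.1
  have l1 := Real.log_le_log (mul_pos hc hp) h1
  have l2 := Real.log_le_log ((mul_pos hc hp).trans_le h1) h2
  rw [Real.log_mul hc.ne' hp.ne'] at l1
  obtain ⟨ω⟩ := nonempty_of_isProbabilityMeasure μ
  have : Real.log c ≤ 0 := Real.log_nonpos hc.le ((h' ω).1.trans (h' ω).2)
  rw [abs_le]
  constructor <;> linarith

/-! ### Reduction to a kernel bounded from below everywhere. -/

/-- The truncation of the kernel from below. -/
def trunc (ε : ℝ) (k : 𝒳 → 𝒱 → 𝒱 → ℝ) : 𝒳 → 𝒱 → 𝒱 → ℝ := fun x v₁ v₂ => max ε (k x v₁ v₂)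

theorem trunc_mem {k : 𝒳 → 𝒱 → 𝒱 → ℝ} (hk : IsObsKernel k) {ε : ℝ} (hε : ε ≤ 1) (x : 𝒳) (v₁ v₂ : 𝒱) :
    ε ≤ trunc ε k x v₁ v₂ ∧ trunc ε k x v₁ v₂ ≤ 1 :=
  ⟨le_max_left _ _, max_le hε (hk.le_one _ _ _)⟩

theorem measurable_trunc {k : 𝒳 → 𝒱 → 𝒱 → ℝ} (hk : IsObsKernel k) (ε : ℝ) (x : 𝒳) :
    Measurable (Function.uncurry (trunc ε k x)) :=
  measurable_const.max (hk.meas x)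

/-- `k` is at least `ε` on the support of `π`. -/
def MixesWith [TopologicalSpace 𝒱] (k : 𝒳 → 𝒱 → 𝒱 → ℝ) (ε : ℝ) (π : Measure 𝒱) : Prop :=
  ∀ x, ∀ v₁ ∈ π.support, ∀ v₂ ∈ π.support, ε ≤ k x v₁ v₂

section Mixing

variable [TopologicalSpace 𝒱] [HereditarilyLindelofSpace 𝒱] {k : 𝒳 → 𝒱 → 𝒱 → ℝ} {ε : ℝ}
  {π : Measure 𝒱} [IsProbabilityMeasure π]

/-- This is where the hereditary Lindelöf property enters: it makes the support a set of full
measure. -/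
theorem ae_mem_support (π : Measure 𝒱) [IsProbabilityMeasure π] :
    ∀ᵐ v ∂(Measure.infinitePi fun _ : ℤ => π), ∀ i, v i ∈ π.support := by
  rw [ae_all_iff]
  intro i
  have := (measurePreserving_eval_infinitePi (fun _ : ℤ => π) i).quasiMeasurePreserving.ae
    (p := fun v => v ∈ π.support) Measure.support_mem_ae
  exact this

omit [HereditarilyLindelofSpace 𝒱] [IsProbabilityMeasure π] in
theorem MixesWith.trunc_eq (h : MixesWith k ε π) {v₁ v₂ : 𝒱} (h₁ : v₁ ∈ π.support)
    (h₂ : v₂ ∈ π.support) (x : 𝒳) : trunc ε k x v₁ v₂ = k x v₁ v₂ :=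
  max_eq_right (h x v₁ h₁ v₂ h₂)

/-- Almost every weight configuration lies in the support, where truncation changes nothing. The
truncated kernel need not sum to one, but the forgetting estimates use only its bounds. -/
theorem MixesWith.cylLik_trunc (h : MixesWith k ε π) {n N : ℕ} (S : Finset (Edge n N))
    (x : Edge n N → 𝒳) : cylLik (trunc ε k) π S x = cylLik k π S x :=
  integral_congr_ae <| (ae_mem_support π).mono fun _ hv =>
    Finset.prod_congr rfl fun _ _ => h.trunc_eq (hv _) (hv _) _

theorem MixesWith.bulkLik_trunc (h : MixesWith k ε π) (n : ℕ) (q : ℤ) (I : Finset ℕ)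
    (x : ℤ → Fin (n * (n - 1)) → 𝒳) : bulkLik (trunc ε k) n π q I x = bulkLik k n π q I x :=
  integral_congr_ae <| (ae_mem_support π).mono fun _ hv =>
    Finset.prod_congr rfl fun _ _ => Finset.prod_congr rfl fun _ _ => h.trunc_eq (hv _) (hv _) _

theorem MixesWith.le_one [Nonempty 𝒳] (h : MixesWith k ε π) (hk : IsObsKernel k) : ε ≤ 1 := by
  obtain ⟨v, hv⟩ := Measure.nonempty_support (IsProbabilityMeasure.ne_zero π)
  obtain ⟨x⟩ := ‹Nonempty 𝒳›
  exact (h x v hv v hv).trans (hk.le_one _ _ _)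

end Mixing

end Bulk

/-! ### Forgetting for the increments of the likelihood -/

section Increments

variable {𝒱 : Type u} {𝒳 : Type v}

/-- The observations `X` on the round-robin graph extend to the sequence of layers `x` in the
bulk. -/
def Agrees (n N : ℕ) (X : Edge n N → 𝒳) (x : ℤ → Fin (n * (n - 1)) → 𝒳) : Prop :=
  ∀ q : ℕ, 2 ≤ q → q + 2 ≤ orderMax n N → List.ofFn (x q) = (edgeLayer n N q).sort.map X

theorem Agrees.prod_eq {n N h : ℕ} (hN : N = 2 * h) (hn : 4 * n < N) (hn1 : 2 ≤ n)
    {X : Edge n N → 𝒳} {x : ℤ → Fin (n * (n - 1)) → 𝒳} (hX : Agrees n N X x) {q : ℕ}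
    (hq : 2 ≤ q) (hq' : q + 2 ≤ orderMax n N) (k : 𝒳 → 𝒱 → 𝒱 → ℝ) (v : ℤ → 𝒱) :
    edgeWeight k (edgeLayer n N q) X v = layerWeight k n q (x q) v := by
  obtain ⟨e, he, hpos⟩ := exists_edge_enum hN hn hn1 hq hq'
  have hx := hX q hq hq'
  rw [he, List.map_ofFn, List.ofFn_inj] at hx
  have h1 : edgeWeight k (edgeLayer n N q) X v =
      (((edgeLayer n N q).sort).map fun e => k (X e) (v (e.fst : ℕ)) (v (e.snd : ℕ))).prod := by
    rw [edgeWeight, ← List.prod_toFinset _ (Finset.sort_nodup _ _), Finset.sort_toFinset]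
  rw [h1, he, List.map_ofFn, List.prod_ofFn, layerWeight]
  refine Finset.prod_congr rfl fun f _ => ?_
  simp only [Function.comp_apply, hx, (hpos f).1, (hpos f).2]

theorem edgeWeight_biUnion (k : 𝒳 → 𝒱 → 𝒱 → ℝ) (n N : ℕ) (I : Finset ℕ) (X : Edge n N → 𝒳)
    (v : ℤ → 𝒱) : edgeWeight k (I.biUnion fun p => edgeLayer n N p) X v =
      ∏ p ∈ I, edgeWeight k (edgeLayer n N p) X v := by
  rw [edgeWeight, Finset.prod_biUnion]
  · rfl
  · intro p _ p' _ hne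
    rw [Function.onFun, Finset.disjoint_left]
    intro e he he'
    simp only [edgeLayer, Finset.mem_filter, Finset.mem_univ, true_and] at he he'
    omega

theorem edgeWeight_edgeLayers (k : 𝒳 → 𝒱 → 𝒱 → ℝ) (n N a b : ℕ) (X : Edge n N → 𝒳) (v : ℤ → 𝒱) :
    edgeWeight k (edgeLayers n N a b) X v =
      ∏ p ∈ Finset.Icc a b, edgeWeight k (edgeLayer n N p) X v :=
  edgeWeight_biUnion k n N _ X v

/-- The bulk of the edges carries the weight of the sequence of layers. -/
theorem Agrees.bulk_eq {n N h : ℕ} (hN : N = 2 * h) (hn : 4 * n < N) (hn1 : 2 ≤ n)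
    {X : Edge n N → 𝒳} {x : ℤ → Fin (n * (n - 1)) → 𝒳} (hX : Agrees n N X x) {q a r : ℕ}
    (hq : 2 ≤ q) (hq' : q + r + 2 ≤ orderMax n N) (k : 𝒳 → 𝒱 → 𝒱 → ℝ) (v : ℤ → 𝒱) :
    edgeWeight k (edgeLayers n N (q + a) (q + r)) X v = bulkWeight k n q (Finset.Icc a r) x v := by
  rw [edgeWeight_edgeLayers, prod_Icc_add, bulkWeight]
  refine Finset.prod_congr rfl fun j hj => ?_
  rw [Finset.mem_Icc] at hj
  rw [hX.prod_eq hN hn hn1 (by omega) (by omega)]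
  push_cast
  rfl

theorem edgeWeight_mem {k : 𝒳 → 𝒱 → 𝒱 → ℝ} {ε : ℝ} (hε : 0 ≤ ε)
    (h : ∀ x v₁ v₂, ε ≤ k x v₁ v₂ ∧ k x v₁ v₂ ≤ 1) {n N : ℕ} (S : Finset (Edge n N))
    (X : Edge n N → 𝒳) (v : ℤ → 𝒱) :
    ε ^ S.card ≤ edgeWeight k S X v ∧ edgeWeight k S X v ≤ 1 :=
  prod_mem_Icc S hε fun _ _ => h _ _ _

variable [MeasurableSpace 𝒱]

theorem measurable_edgeWeight_coordSigma {k : 𝒳 → 𝒱 → 𝒱 → ℝ}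
    (hk : ∀ x, Measurable (Function.uncurry (k x))) {n N : ℕ} (S : Finset (Edge n N))
    (X : Edge n N → 𝒳) {T : Set ℤ}
    (hT : ∀ e ∈ S, ((e.fst : ℕ) : ℤ) ∈ T ∧ ((e.snd : ℕ) : ℤ) ∈ T) :
    Measurable[coordSigma 𝒱 T] (edgeWeight k S X) :=
  @Finset.measurable_fun_prod _ _ _ _ _ _ (coordSigma 𝒱 T) _ _ fun e he =>
    @measurable_kernel_comp _ _ _ _ hk _ (coordSigma 𝒱 T) _ _ _
      (measurable_coordSigma (hT e he).1) (measurable_coordSigma (hT e he).2)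

variable [TopologicalSpace 𝒱] [HereditarilyLindelofSpace 𝒱] {k : 𝒳 → 𝒱 → 𝒱 → ℝ} {ε : ℝ}
  {π : Measure 𝒱} [IsProbabilityMeasure π]

theorem bulkIncr_trunc (hmix : MixesWith k ε π) (n : ℕ) (q : ℤ) (r : ℕ)
    (x : ℤ → Fin (n * (n - 1)) → 𝒳) : bulkIncr (trunc ε k) n π q r x = bulkIncr k n π q r x := by
  simp only [bulkIncr, hmix.bulkLik_trunc]

/-- Far layers have an exponentially small influence on the increments. -/
theorem abs_bulkIncr_sub_le (hk : IsObsKernel k) (hε : 0 < ε) (hε1 : ε ≤ 1)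
    (hmix : MixesWith k ε π) {n : ℕ} (hn1 : 2 ≤ n) (q : ℤ) {r R : ℕ} (hr : 1 ≤ r) (hR : r ≤ R)
    (x : ℤ → Fin (n * (n - 1)) → 𝒳) :
    |bulkIncr k n π q R x - bulkIncr k n π q r x| ≤
      (1 - ε ^ (n * (n - 1))) ^ (r - 1) / (ε ^ (n * (n - 1))) ^ 2 := by
  have hm := measurable_trunc hk ε
  have hb := trunc_mem hk hε1
  have C := weightChain hm hε hb hn1 π q x
  -- The tail `H` is the product of the layers `r + 1, …, R`.
  have key := C.abs_log_sub_le hr (C.measurable_prod_fut (r + 1) R)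
    (pow_pos (pow_pos hε _) _) (fun v => (bulkWeight_mem hε.le hb n q _ x v).1)
    (fun v => (bulkWeight_mem hε.le hb n q _ x v).2)
  simp only [prod_Icc_mul_prod_Icc _ (show 0 ≤ r + 1 by omega) hR,
    prod_Icc_mul_prod_Icc _ (show 1 ≤ r + 1 by omega) hR] at key
  rw [← bulkIncr_trunc hmix, ← bulkIncr_trunc hmix]
  exact key

/-- The conditional log-likelihoods of the finite model are close to the increments. -/
theorem abs_condLogLik_sub_le [MeasurableSpace 𝒳] [DiscreteMeasurableSpace 𝒳] [Finite 𝒳]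
    (hk : IsObsKernel k) (hε : 0 < ε) (hε1 : ε ≤ 1)
    (hmix : MixesWith k ε π) {n N h : ℕ} (hN : N = 2 * h) (hn : 4 * n < N) (hn1 : 2 ≤ n)
    {X : Edge n N → 𝒳} {x : ℤ → Fin (n * (n - 1)) → 𝒳} (hX : Agrees n N X x) {q r : ℕ}
    (hq : 2 ≤ q) (hr : 1 ≤ r) (hq' : q + r + 2 ≤ orderMax n N) :
    |condLogLik k n N π q X - bulkIncr k n π q r x| ≤
      (1 - ε ^ (n * (n - 1))) ^ (r - 1) / (ε ^ (n * (n - 1))) ^ 2 := by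
  have hm := measurable_trunc hk ε
  have hb := trunc_mem hk hε1
  have C := weightChain hm hε hb hn1 π q x
  -- These layers need not agree with the bulk sequence, the last one being outside it; they all go
  -- into the tail `H`.
  set S := edgeLayers n N (q + r + 1) (orderMax n N - 1) with hS
  have hSm : Measurable[coordSigma 𝒱 {i | (q : ℤ) + (r + 1 : ℕ) ≤ layer n i}]
      (edgeWeight (trunc ε k) S X) := by
    refine measurable_edgeWeight_coordSigma hm S X fun e he => ?_
    simp only [hS, edgeLayers, Finset.mem_biUnion, Finset.mem_Icc, edgeLayer, Finset.mem_filter,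
      Finset.mem_univ, true_and] at he
    obtain ⟨p, hp, he⟩ := he
    have h1 := le_layer_of_le_depth hN hn hn1 e.fst (r := q + r) (by omega) (by omega)
    have h2 := le_layer_of_le_depth hN hn hn1 e.snd (r := q + r) (by omega) (by omega)
    rw [Set.mem_ofPred_eq, Set.mem_ofPred_eq]
    omega
  have key := C.abs_log_sub_le hr hSm (pow_pos hε _)
    (fun v => (edgeWeight_mem hε.le hb S X v).1) (fun v => (edgeWeight_mem hε.le hb S X v).2)
  have hsplit : ∀ a, a ≤ r → ∀ v, (∏ j ∈ Finset.Icc a r,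
      layerWeight (trunc ε k) n (q + j) (x (q + j)) v) * edgeWeight (trunc ε k) S X v =
      edgeWeight (trunc ε k) (edgeLayers n N (q + a) (orderMax n N - 1)) X v := by
    intro a ha v
    rw [← bulkWeight, ← hX.bulk_eq hN hn hn1 hq hq', edgeWeight_edgeLayers, edgeWeight_edgeLayers,
      edgeWeight_edgeLayers, prod_Icc_mul_prod_Icc _ (by omega) (by omega)]
  simp only [hsplit 0 (Nat.zero_le _), hsplit 1 hr] at key
  have hpos : ∀ T : Finset (Edge n N), 0 < cylLik (trunc ε k) π T X := fun T =>
    (pow_pos hε _).trans_le (integral_mem (measurable_edgeWeight hm T X) (pow_nonneg hε.le _)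
      fun v => edgeWeight_mem hε.le hb T X v).1
  rw [condLogLik_eq hk _ _ _ _ (by omega), ← hmix.cylLik_trunc, ← hmix.cylLik_trunc,
    Real.log_div (hpos _).ne' (hpos _).ne', ← bulkIncr_trunc hmix]
  exact key

theorem bulkLik_mem (hk : IsObsKernel k) (hε : 0 < ε) (hε1 : ε ≤ 1) (hmix : MixesWith k ε π)
    (n : ℕ) (q : ℤ) (I : Finset ℕ) (x : ℤ → Fin (n * (n - 1)) → 𝒳) :
    (ε ^ (n * (n - 1))) ^ I.card ≤ bulkLik k n π q I x ∧ bulkLik k n π q I x ≤ 1 := by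
  rw [← hmix.bulkLik_trunc]
  exact integral_mem (measurable_bulkWeight (measurable_trunc hk ε) n q I x)
    (pow_nonneg (pow_nonneg hε.le _) _) fun v => bulkWeight_mem hε.le (trunc_mem hk hε1) n q I x v

/-- Adding one layer multiplies the integrand by a factor in `[δ, 1]`. -/
theorem abs_bulkIncr_le (hk : IsObsKernel k) (hε : 0 < ε) (hε1 : ε ≤ 1) (hmix : MixesWith k ε π)
    (n : ℕ) (q : ℤ) (r : ℕ) (x : ℤ → Fin (n * (n - 1)) → 𝒳) :
    |bulkIncr k n π q r x| ≤ -Real.log (ε ^ (n * (n - 1))) := by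
  have hm := measurable_trunc hk ε
  have hb := trunc_mem hk hε1
  have key := abs_log_integral_mul_sub_le (μ := Measure.infinitePi fun _ : ℤ => π)
    (measurable_bulkWeight hm n q (Finset.Icc 1 r) x) (measurable_layerWeight hm n q (x q))
    (pow_pos (pow_pos hε _) _) (pow_pos hε _)
    (fun v => bulkWeight_mem hε.le hb n q _ x v) fun v => layerWeight_mem hε.le hb n q _ v
  rw [← bulkIncr_trunc hmix, bulkIncr]
  convert key using 4; swap; · rfl
  refine integral_congr_ae (ae_of_all _ fun v => ?_)
  simp only [bulkWeight]
  rw [← Finset.insert_Icc_add_one_left_eq_Icc (Nat.zero_le r), Finset.prod_insert (by simp),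
    zero_add, Nat.cast_zero, add_zero]

omit [TopologicalSpace 𝒱] [HereditarilyLindelofSpace 𝒱] in
theorem bulkLik_Icc_succ (k : 𝒳 → 𝒱 → 𝒱 → ℝ) (π : Measure 𝒱) (n : ℕ) (q : ℤ) (r : ℕ)
    (x : ℤ → Fin (n * (n - 1)) → 𝒳) :
    bulkLik k n π q (Finset.Icc 1 (1 + r)) x = bulkLik k n π (q + 1) (Finset.Icc 0 r) x :=
  integral_congr_ae (ae_of_all _ fun v => bulkWeight_Icc_succ k n q 0 r x v)

omit [TopologicalSpace 𝒱] [HereditarilyLindelofSpace 𝒱] in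
/-- The chain rule for the log-likelihood of the bulk. -/
theorem log_bulkLik_eq_sum (k : 𝒳 → 𝒱 → 𝒱 → ℝ) (π : Measure 𝒱) (n : ℕ) (q R : ℕ)
    (x : ℤ → Fin (n * (n - 1)) → 𝒳) :
    Real.log (bulkLik k n π q (Finset.Icc 0 R) x) =
      ∑ j ∈ Finset.range R, bulkIncr k n π (q + j : ℕ) (R - j) x +
        Real.log (bulkLik k n π (q + R : ℕ) (Finset.Icc 0 0) x) := by
  induction R generalizing q with
  | zero => simp
  | succ R ih =>
    rw [Finset.sum_range_succ']
    have h1 := ih (q + 1)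
    have h2 : Real.log (bulkLik k n π q (Finset.Icc 0 (R + 1)) x) =
        bulkIncr k n π q (R + 1) x +
          Real.log (bulkLik k n π ((q + 1 : ℕ) : ℤ) (Finset.Icc 0 R) x) := by
      rw [bulkIncr, add_comm R 1, bulkLik_Icc_succ]; push_cast; ring
    rw [h2, h1]
    simp only [Nat.add_sub_add_right, Nat.sub_zero, add_zero]
    rw [show q + 1 + R = q + (R + 1) by ring]
    simp only [show ∀ j, q + 1 + j = q + (j + 1) from fun j => by ring]
    ring

/-- The edges outside the bulk contribute at most `(20 n)²` factors, each in `[ε, 1]`. -/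
theorem abs_logLik_sub_le [MeasurableSpace 𝒳] [DiscreteMeasurableSpace 𝒳] [Finite 𝒳]
    (hk : IsObsKernel k) (hε : 0 < ε) (hε1 : ε ≤ 1)
    (hmix : MixesWith k ε π) {n N h : ℕ} (hN : N = 2 * h) (hn : 4 * n < N) (hn1 : 2 ≤ n)
    {X : Edge n N → 𝒳} {x : ℤ → Fin (n * (n - 1)) → 𝒳} (hX : Agrees n N X x) {R : ℕ}
    (hR : R + 4 = orderMax n N) :
    |logLik k n N π X - Real.log (bulkLik k n π (2 : ℕ) (Finset.Icc 0 R) x)| ≤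
      -Real.log (ε ^ (20 * n * (20 * n))) := by
  have hm := measurable_trunc hk ε
  have hb := trunc_mem hk hε1
  set S := Finset.univ \ edgeLayers n N 2 (orderMax n N - 2) with hS
  have key := abs_log_integral_mul_sub_le (μ := Measure.infinitePi fun _ : ℤ => π)
    (measurable_bulkWeight hm n (2 : ℕ) (Finset.Icc 0 R) x) (measurable_edgeWeight hm S X)
    (pow_pos (pow_pos hε _) _) (pow_pos hε (20 * n * (20 * n)))
    (fun v => bulkWeight_mem hε.le hb n _ _ x v) fun v =>
      ⟨(pow_le_pow_of_le_one hε.le hε1 (card_compl_bulk_le hN hn hn1)).trans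
        (edgeWeight_mem hε.le hb S X v).1, (edgeWeight_mem hε.le hb S X v).2⟩
  rw [logLik_eq hk, ← hmix.cylLik_trunc, ← hmix.bulkLik_trunc]
  convert key using 4; swap; · rfl
  refine integral_congr_ae (ae_of_all _ fun v => ?_)
  have h1 := hX.bulk_eq hN hn hn1 (q := 2) (a := 0) (r := R) le_rfl (by omega) (trunc ε k) v
  simp only
  rw [← h1, hS, show orderMax n N - 2 = 2 + R by omega]
  exact (Finset.prod_sdiff (Finset.subset_univ _)).symm

end Increments

/-! ### Existence of stationary extensions -/

section Existence

variable {𝒱 : Type u} {𝒳 : Type v} [MeasurableSpace 𝒱] [MeasurableSpace 𝒳]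

theorem measure_ext_of_singleton_prod {α β : Type*} [Countable α] [MeasurableSpace α]
    [MeasurableSingletonClass α] [MeasurableSpace β] {μ ν : Measure (α × β)}
    (h : ∀ a s, MeasurableSet s → μ ({a} ×ˢ s) = ν ({a} ×ˢ s)) : μ = ν := by
  refine Measure.ext fun B hB => ?_
  have hdec : B = ⋃ a, {a} ×ˢ (Prod.mk a ⁻¹' B) := by
    ext ⟨a, b⟩
    simp
  have hm : ∀ a, MeasurableSet (Prod.mk a ⁻¹' B) := fun a => measurable_prodMk_left hB
  have hd : Pairwise (Function.onFun Disjoint fun a => ({a} : Set α) ×ˢ (Prod.mk a ⁻¹' B)) := by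
    intro a a' hne
    rw [Function.onFun, Set.disjoint_left]
    rintro ⟨c, b⟩ ⟨h1, -⟩ ⟨h2, -⟩
    exact hne (h1.symm.trans h2)
  rw [hdec, measure_iUnion hd fun a => (measurableSet_singleton a).prod (hm a),
    measure_iUnion hd fun a => (measurableSet_singleton a).prod (hm a)]
  exact tsum_congr fun a => h a _ (hm a)

/-- Observations can be sampled by applying a measurable function to independent uniform random
variables. -/
theorem IsObsKernel.exists_sampler [DiscreteMeasurableSpace 𝒳] [Finite 𝒳] [Nonempty 𝒳]
    {k : 𝒳 → 𝒱 → 𝒱 → ℝ} (hk : IsObsKernel k) :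
    ∃ f : 𝒱 × 𝒱 → unitInterval → 𝒳, Measurable (Function.uncurry f) ∧
      ∀ x v₁ v₂, volume (f (v₁, v₂) ⁻¹' {x}) = ENNReal.ofReal (k x v₁ v₂) := by
  classical
  have := Fintype.ofFinite 𝒳
  let κ : Kernel (𝒱 × 𝒱) 𝒳 :=
    { toFun := fun p => ∑ x, ENNReal.ofReal (k x p.1 p.2) • Measure.dirac x
      measurable' := by
        refine Measure.measurable_of_measurable_coe _ fun s hs => ?_
        simp only [Measure.coe_finsetSum, Finset.sum_apply, Measure.smul_apply, smul_eq_mul]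
        refine Finset.measurable_fun_sum _ fun x _ => Measurable.mul_const ?_ _
        exact ENNReal.measurable_ofReal.comp (hk.meas x) }
  have hκ : ∀ p, κ p = ∑ x, ENNReal.ofReal (k x p.1 p.2) • Measure.dirac x := fun p => rfl
  have : IsMarkovKernel κ := ⟨fun p => ⟨by
    simp [hκ, hk.sum_ofReal]⟩⟩
  obtain ⟨f, hf, hfκ⟩ := κ.exists_measurable_map_eq_unitInterval
  refine ⟨f, hf, fun x v₁ v₂ => ?_⟩
  rw [← Measure.map_apply hf.of_uncurry_left (measurableSet_singleton x), hfκ, hκ]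
  simp [Set.indicator_apply]

theorem edge_pair_injective (n N : ℕ) :
    Function.Injective fun e : Edge n N => (((e.fst : ℕ) : ℤ), ((e.snd : ℕ) : ℤ)) := by
  intro e e' h
  simp only [Prod.mk.injEq] at h
  apply Subtype.ext
  apply ofLex.injective
  exact Prod.ext (node_cast_injective N h.1) (node_cast_injective N h.2)

/-- The weights and the observations of all pairs obtained from a sampler. -/
def sampleMap (f : 𝒱 × 𝒱 → unitInterval → 𝒳) (p : (ℤ → 𝒱) × (ℤ × ℤ → unitInterval)) :
    (ℤ → 𝒱) × (ℤ × ℤ → 𝒳) := (p.1, fun e => f (p.1 e.1, p.1 e.2) (p.2 e))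

theorem measurable_sampleMap {f : 𝒱 × 𝒱 → unitInterval → 𝒳} (hf : Measurable (Function.uncurry f)) :
    Measurable (sampleMap f) := by
  refine measurable_fst.prodMk (measurable_pi_lambda _ fun e => ?_)
  have h : Measurable fun p : (ℤ → 𝒱) × (ℤ × ℤ → unitInterval) =>
      ((p.1 e.1, p.1 e.2), p.2 e) := by fun_prop
  exact hf.comp h

/-- The law of the weights and of the observations of all pairs of integers. -/
noncomputable def sampleLaw (f : 𝒱 × 𝒱 → unitInterval → 𝒳) (π : Measure 𝒱) :
    Measure ((ℤ → 𝒱) × (ℤ × ℤ → 𝒳)) :=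
  ((Measure.infinitePi fun _ : ℤ => π).prod
    (Measure.infinitePi fun _ : ℤ × ℤ => (volume : Measure unitInterval))).map (sampleMap f)

/-- Both i.i.d. families are invariant under translations, and `sampleMap` commutes with them. -/
theorem sampleLaw_map_translate {f : 𝒱 × 𝒱 → unitInterval → 𝒳}
    (hf : Measurable (Function.uncurry f)) (π : Measure 𝒱) [IsProbabilityMeasure π] (c : ℤ) :
    (sampleLaw f π).map (fun ω => ((fun i => ω.1 (i + c)), fun e => ω.2 (e.1 + c, e.2 + c))) =
      sampleLaw f π := by
  have h1 := measurePreserving_precomp π (add_left_injective c)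
  have h2 := measurePreserving_precomp (volume : Measure unitInterval)
    (g := fun e : ℤ × ℤ => (e.1 + c, e.2 + c)) (fun e e' h => by
      simp only [Prod.mk.injEq, add_left_inj] at h
      exact Prod.ext h.1 h.2)
  have h3 := h1.prod h2
  have hT := measurable_sampleMap hf
  rw [sampleLaw, Measure.map_map (by fun_prop) hT]
  conv_rhs => rw [← h3.map_eq, Measure.map_map hT h3.measurable]
  rfl

/-- Distinct edges use distinct uniform variables, so given the weights the observations are
independent with the laws prescribed by `k`. -/
theorem sampleLaw_map_graph [DiscreteMeasurableSpace 𝒳] [Finite 𝒳] {k : 𝒳 → 𝒱 → 𝒱 → ℝ}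
    (hk : IsObsKernel k) {f : 𝒱 × 𝒱 → unitInterval → 𝒳}
    (hf : Measurable (Function.uncurry f))
    (hfk : ∀ x v₁ v₂, volume (f (v₁, v₂) ⁻¹' {x}) = ENNReal.ofReal (k x v₁ v₂))
    (π : Measure 𝒱) [IsProbabilityMeasure π] (n N : ℕ) :
    (sampleLaw f π).map (fun ω => ((fun e : Edge n N => ω.2 (((e.fst : ℕ) : ℤ), ((e.snd : ℕ) : ℤ))),
      fun i : Node N => ω.1 ((i : ℕ) : ℤ))) = jointLaw k n N π := by
  classical
  have := Fintype.ofFinite 𝒳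
  refine measure_ext_of_singleton_prod fun y A hA => ?_
  have hT := measurable_sampleMap hf
  have hyA : MeasurableSet (({y} : Set (Edge n N → 𝒳)) ×ˢ A) := (measurableSet_singleton y).prod hA
  have hΦ : Measurable fun ω : (ℤ → 𝒱) × (ℤ × ℤ → 𝒳) =>
      ((fun e : Edge n N => ω.2 (((e.fst : ℕ) : ℤ), ((e.snd : ℕ) : ℤ))),
        fun i : Node N => ω.1 ((i : ℕ) : ℤ)) := by fun_prop
  have hnode := measurePreserving_precomp π (node_cast_injective N)
  have hedge := measurePreserving_precomp (volume : Measure unitInterval) (edge_pair_injective n N)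
  rw [jointLaw_apply hk.meas _ _ _ _ hA, sampleLaw, Measure.map_map hΦ hT,
    Measure.map_apply (hΦ.comp hT) hyA, Measure.prod_apply ((hΦ.comp hT) hyA),
    ← lintegral_indicator hA, ← Measure.infinitePi_eq_pi, ← hnode.lintegral_comp]
  · refine lintegral_congr fun v => ?_
    by_cases hv : (fun i : Node N => v ((i : ℕ) : ℤ)) ∈ A
    · rw [Set.indicator_of_mem hv, Finset.sum_eq_single y
        (fun y' _ hne => Set.indicator_of_notMem (by simpa using hne) _)
        (fun h => absurd (Finset.mem_univ _) h), Set.indicator_of_mem (Set.mem_singleton y)]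
      have hset : (Prod.mk v ⁻¹' ((fun ω : (ℤ → 𝒱) × (ℤ × ℤ → 𝒳) =>
          ((fun e : Edge n N => ω.2 (((e.fst : ℕ) : ℤ), ((e.snd : ℕ) : ℤ))),
            fun i : Node N => ω.1 ((i : ℕ) : ℤ))) ∘ sampleMap f ⁻¹' ({y} ×ˢ A)) :
            Set (ℤ × ℤ → unitInterval)) =
          (fun (u : ℤ × ℤ → unitInterval) (e : Edge n N) =>
            u (((e.fst : ℕ) : ℤ), ((e.snd : ℕ) : ℤ))) ⁻¹' Set.pi Set.univ fun e : Edge n N =>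
              f (v ((e.fst : ℕ) : ℤ), v ((e.snd : ℕ) : ℤ)) ⁻¹' {y e} := by
        ext u
        simp [sampleMap, hv, funext_iff]
      have hmf : ∀ e : Edge n N,
          MeasurableSet (f (v ((e.fst : ℕ) : ℤ), v ((e.snd : ℕ) : ℤ)) ⁻¹' {y e}) := fun e =>
        hf.of_uncurry_left (measurableSet_singleton _)
      rw [hset, hedge.measure_preimage (MeasurableSet.univ_pi hmf).nullMeasurableSet,
        Measure.infinitePi_eq_pi, Measure.pi_pi]
      exact Finset.prod_congr rfl fun e _ => hfk _ _ _
    · rw [Set.indicator_of_notMem hv]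
      have hset : (Prod.mk v ⁻¹' ((fun ω : (ℤ → 𝒱) × (ℤ × ℤ → 𝒳) =>
          ((fun e : Edge n N => ω.2 (((e.fst : ℕ) : ℤ), ((e.snd : ℕ) : ℤ))),
            fun i : Node N => ω.1 ((i : ℕ) : ℤ))) ∘ sampleMap f ⁻¹' ({y} ×ˢ A)) :
            Set (ℤ × ℤ → unitInterval)) = ∅ := by
        ext u
        simp [sampleMap, hv]
      rw [hset, measure_empty]
  · refine Measurable.indicator (Finset.measurable_fun_sum _ fun y' _ => ?_) hA
    by_cases hy : y' ∈ ({y} : Set (Edge n N → 𝒳))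
    · simp only [Set.indicator_of_mem hy]
      exact Finset.measurable_fun_prod _ fun e _ => ENNReal.measurable_ofReal.comp
        (measurable_kernel_comp hk.meas _ (measurable_pi_apply _) (measurable_pi_apply _))
    · simp only [Set.indicator_of_notMem hy]
      exact measurable_const

theorem nodeAt_add_one (n : ℕ) (z : ℤ) (a) :
    nodeAt n (z + 1) a = nodeAt n z a + 2 * ((n : ℤ) - 1) := by
  unfold nodeAt; ring

theorem fstAt_add_one (n : ℕ) (z : ℤ) (f) :
    fstAt n (z + 1) f = fstAt n z f + 2 * ((n : ℤ) - 1) := by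
  unfold fstAt; ring

theorem sndAt_add_one (n : ℕ) (z : ℤ) (f) :
    sndAt n (z + 1) f = sndAt n z f + 2 * ((n : ℤ) - 1) := by
  unfold sndAt; ring

/-- Every graph reads its weights and observations from the same array, with labels as positions, so
the layers of different `N` coincide pointwise; moving one layer is a translation by `2(n - 1)`. -/
theorem exists_stationaryExtension [DiscreteMeasurableSpace 𝒳] [Finite 𝒳] [Nonempty 𝒳]
    {k : 𝒳 → 𝒱 → 𝒱 → ℝ} (hk : IsObsKernel k) {n : ℕ} (hn1 : 2 ≤ n) (π : Measure 𝒱)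
    [IsProbabilityMeasure π] :
    ∃ (Ω : Type (max u v)) (_ : MeasurableSpace Ω) (μ : Measure Ω), IsProbabilityMeasure μ ∧
      Nonempty (StationaryExtension μ k n π) := by
  obtain ⟨f, hf, hfk⟩ := hk.exists_sampler
  refine ⟨(ℤ → 𝒱) × (ℤ × ℤ → 𝒳), inferInstance, sampleLaw f π,
    Measure.isProbabilityMeasure_map (measurable_sampleMap hf).aemeasurable, ⟨?_⟩⟩
  exact
    { V := fun N ω i => ω.1 ((i : ℕ) : ℤ)
      X := fun N ω e => ω.2 (((e.fst : ℕ) : ℤ), ((e.snd : ℕ) : ℤ))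
      measurable_V := fun N => by fun_prop
      measurable_X := fun N => by fun_prop
      law_eq := fun N _ _ => sampleLaw_map_graph hk hf hfk π n N
      Vinf := fun ω z a => ω.1 (nodeAt n z a)
      Xinf := fun ω z e => ω.2 (fstAt n z e, sndAt n z e)
      measurable_Vinf := by fun_prop
      measurable_Xinf := by fun_prop
      stationary := by
        conv_rhs => rw [← sampleLaw_map_translate hf π (2 * ((n : ℤ) - 1)),
          Measure.map_map (by fun_prop) (by fun_prop)]
        congr 1
        funext ω z
        simp only [Function.comp_apply, nodeAt_add_one, fstAt_add_one, sndAt_add_one]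
      extends_V := fun N q hev hN hq hq' => ae_of_all _ fun ω => by
        obtain ⟨h, hh⟩ := hev
        obtain ⟨ν, hν, hpos⟩ := exists_node_enum (by omega : N = 2 * h) hN hn1 hq hq'
        rw [hν, List.map_ofFn, List.ofFn_inj]
        funext a
        simp only [Function.comp_apply, hpos]
      extends_X := fun N q hev hN hq hq' => ae_of_all _ fun ω => by
        obtain ⟨h, hh⟩ := hev
        obtain ⟨e, he, hpos⟩ := exists_edge_enum (by omega : N = 2 * h) hN hn1 hq hq'
        rw [he, List.map_ofFn, List.ofFn_inj]
        funext a
        simp only [Function.comp_apply, (hpos a).1, (hpos a).2] }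

end Existence

/-! ### The law of large numbers for the stationary extension -/

section LLN

variable {𝒱 : Type u} {𝒳 : Type v}

theorem edgeAt_injective {n : ℕ} (hn1 : 2 ≤ n) : Function.Injective
    fun p : ℤ × Fin (n * (n - 1)) => (fstAt n p.1 p.2, sndAt n p.1 p.2) := by
  rintro ⟨z, f⟩ ⟨z', f'⟩ h
  simp only [Prod.mk.injEq] at h
  have h1 := (inEdgeLayer_at hn1 z f).2
  have h2 := (inEdgeLayer_at hn1 z' f').2
  rw [h.1, h.2] at h1
  obtain rfl : z = z' := by omega
  have hf : baseEdge n f = baseEdge n f' := by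
    apply ofLex.injective
    unfold fstAt sndAt at h
    exact Prod.ext (by omega) (by omega)
  rw [(baseEdge n).injective hf]

/-- Any sequence of layers is realized by observations on the round-robin graph. -/
theorem exists_agrees [Nonempty 𝒳] {n N h : ℕ} (hN : N = 2 * h) (hn : 4 * n < N) (hn1 : 2 ≤ n)
    (x : ℤ → Fin (n * (n - 1)) → 𝒳) : ∃ X : Edge n N → 𝒳, Agrees n N X x := by
  refine ⟨fun e => Function.extend
    (fun p : ℤ × Fin (n * (n - 1)) => (fstAt n p.1 p.2, sndAt n p.1 p.2)) (fun p => x p.1 p.2)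
    (fun _ => Classical.arbitrary 𝒳) (((e.fst : ℕ) : ℤ), ((e.snd : ℕ) : ℤ)), fun q hq hq' => ?_⟩
  obtain ⟨e, he, hpos⟩ := exists_edge_enum hN hn hn1 hq hq'
  rw [he, List.map_ofFn, List.ofFn_inj]
  funext f
  rw [Function.comp_apply, (hpos f).1, (hpos f).2]
  exact ((edgeAt_injective hn1).extend_apply (fun p => x p.1 p.2) _ ((q : ℤ), f)).symm

theorem Agrees.eq_iff {n N : ℕ} {X X' : Edge n N → 𝒳} {x x' : ℤ → Fin (n * (n - 1)) → 𝒳}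
    (h : Agrees n N X x) (h' : Agrees n N X' x') {q : ℕ} (hq : 2 ≤ q)
    (hq' : q + 2 ≤ orderMax n N) : x q = x' q ↔ ∀ e ∈ edgeLayer n N q, X e = X' e := by
  rw [← List.ofFn_inj, h q hq hq', h' q hq hq', List.map_inj_left]
  simp only [Finset.mem_sort]

theorem exists_large_even {n : ℕ} (hn1 : 2 ≤ n) (K : ℕ) :
    ∀ᶠ N in evenAtTop, Even N ∧ 4 * n < N ∧ K ≤ orderMax n N := by
  have h1 := (tendsto_orderMax hn1).eventually_ge_atTop K
  have h2 : ∀ᶠ N in evenAtTop, Even N := mem_inf_of_right (mem_principal_self _)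
  have h3 : ∀ᶠ N in evenAtTop, 4 * n < N := mem_inf_of_left (eventually_gt_atTop _)
  filter_upwards [h1, h2, h3] with N a b c using ⟨b, c, a⟩

instance : evenAtTop.NeBot := by
  rw [evenAtTop, inf_principal_neBot_iff]
  intro U hU
  obtain ⟨a, ha⟩ := mem_atTop_sets.1 hU
  exact ⟨2 * a, ha _ (by omega), even_two_mul a⟩

instance : evenAtTop.IsCountablyGenerated := by
  unfold evenAtTop; infer_instance

variable [MeasurableSpace 𝒱]

/-- With edge layer `r + 1` left out, the two groups of edges have no node in common. -/
theorem bulkLik_union {k : 𝒳 → 𝒱 → 𝒱 → ℝ} (hk : ∀ x, Measurable (Function.uncurry (k x))) {n : ℕ}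
    (hn1 : 2 ≤ n) (π : Measure 𝒱) [IsProbabilityMeasure π] (q : ℤ) {I J : Finset ℕ} {r : ℕ}
    (hI : ∀ i ∈ I, i ≤ r) (hJ : ∀ j ∈ J, r + 2 ≤ j) (x : ℤ → Fin (n * (n - 1)) → 𝒳) :
    bulkLik k n π q (I ∪ J) x = bulkLik k n π q I x * bulkLik k n π q J x := by
  have hd : Disjoint I J := Finset.disjoint_left.2 fun i hi hj => by
    have := hI i hi; have := hJ i hj; omega
  have hind := indep_coordSigma π (S := {i | layer n i ≤ q + r + 1})
    (T := {i | q + r + 2 ≤ layer n i}) (Set.disjoint_left.2 fun a ha hb => by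
      rw [Set.mem_ofPred_eq] at ha hb; omega)
  rw [bulkLik, bulkLik, bulkLik, ← integral_mul_of_indep (coordSigma_le _) (coordSigma_le _) hind]
  · exact integral_congr_ae (ae_of_all _ fun v => Finset.prod_union hd)
  · refine @Finset.measurable_fun_prod _ _ _ _ _ _ (coordSigma 𝒱 _) _ _ fun i hi =>
      measurable_layerWeight_coordSigma hk _ _ fun f => ?_
    have h1 := layer_fstAt hn1 (q + i) f
    have h2 := layer_sndAt hn1 (q + i) f
    have h3 := hI i hi
    rw [Set.mem_ofPred_eq, Set.mem_ofPred_eq]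
    omega
  · refine @Finset.measurable_fun_prod _ _ _ _ _ _ (coordSigma 𝒱 _) _ _ fun i hi =>
      measurable_layerWeight_coordSigma hk _ _ fun f => ?_
    have h1 := layer_fstAt hn1 (q + i) f
    have h2 := layer_sndAt hn1 (q + i) f
    have h3 := hJ i hi
    rw [Set.mem_ofPred_eq, Set.mem_ofPred_eq]
    omega

variable [MeasurableSpace 𝒳] [DiscreteMeasurableSpace 𝒳] [Finite 𝒳] {Ω : Type w}
  [MeasurableSpace Ω] {μ : Measure Ω} {k : 𝒳 → 𝒱 → 𝒱 → ℝ} {n : ℕ} {π : Measure 𝒱}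

omit [DiscreteMeasurableSpace 𝒳] [Finite 𝒳] in
theorem StationaryExtension.ae_agrees (M : StationaryExtension μ k n π) :
    ∀ᵐ ω ∂μ, ∀ N, Even N → 4 * n < N → Agrees n N (M.X N ω) (M.Xinf ω) := by
  rw [ae_all_iff]
  intro N
  by_cases h : Even N ∧ 4 * n < N
  · have : ∀ᵐ ω ∂μ, ∀ q : ℕ, 2 ≤ q → q + 2 ≤ orderMax n N →
        List.ofFn (M.Xinf ω q) = (edgeLayer n N q).sort.map (M.X N ω) := by
      rw [ae_all_iff]
      intro q
      by_cases hq : 2 ≤ q ∧ q + 2 ≤ orderMax n N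
      · filter_upwards [M.extends_X N q h.1 h.2 hq.1 hq.2] with ω hω _ _ using hω
      · exact ae_of_all _ fun ω h1 h2 => absurd ⟨h1, h2⟩ hq
    filter_upwards [this] with ω hω _ _ using hω
  · exact ae_of_all _ fun ω h1 h2 => absurd ⟨h1, h2⟩ h

omit [DiscreteMeasurableSpace 𝒳] [Finite 𝒳] in
theorem StationaryExtension.map_X (M : StationaryExtension μ k n π) {N : ℕ} (hev : Even N)
    (hn : 4 * n < N) : μ.map (M.X N) = obsLaw k n N π := by
  rw [obsLaw, ← M.law_eq N hev hn, Measure.map_map measurable_fst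
    ((M.measurable_X N).prodMk (M.measurable_V N))]
  rfl

variable [IsProbabilityMeasure π]

/-- The finite-dimensional laws of the stationary extension, to the right of the layer `2`. -/
theorem StationaryExtension.measure_cylinder [Nonempty 𝒳] (hk : IsObsKernel k) (hn1 : 2 ≤ n)
    (M : StationaryExtension μ k n π) {q : ℕ} (hq : 2 ≤ q) (I : Finset ℕ)
    (x : ℤ → Fin (n * (n - 1)) → 𝒳) :
    μ {ω | ∀ j ∈ I, M.Xinf ω ((q + j : ℕ) : ℤ) = x ((q + j : ℕ) : ℤ)} =
      ENNReal.ofReal (bulkLik k n π q I x) := by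
  -- A graph whose bulk contains all the layers `q + j`; `X'` then turns the event into a cylinder
  -- of its observations.
  obtain ⟨N, hev, hn, hK⟩ := (exists_large_even hn1 (q + I.sup id + 2)).exists
  have hsup : ∀ j ∈ I, j ≤ I.sup id := fun j hj => Finset.le_sup (f := id) hj
  obtain ⟨h, hh⟩ := id hev
  have hN : N = 2 * h := by omega
  obtain ⟨X', hX'⟩ := exists_agrees hN hn hn1 x
  set S := (I.image (q + ·)).biUnion fun p => edgeLayer n N p with hS
  have hae : {ω | ∀ j ∈ I, M.Xinf ω ((q + j : ℕ) : ℤ) = x ((q + j : ℕ) : ℤ)} =ᵐ[μ]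
      M.X N ⁻¹' {y | ∀ e ∈ S, y e = X' e} := by
    filter_upwards [M.ae_agrees] with ω hω
    apply propext
    change (∀ j ∈ I, M.Xinf ω ((q + j : ℕ) : ℤ) = x ((q + j : ℕ) : ℤ)) ↔
      ∀ e ∈ S, M.X N ω e = X' e
    simp only [hS, Finset.mem_biUnion, Finset.mem_image, exists_exists_and_eq_and,
      forall_exists_index, and_imp]
    constructor
    · intro H e j hj he
      have := hsup j hj
      exact ((hω N hev hn).eq_iff hX' (by omega) (by omega)).1 (H j hj) e he
    · intro H j hj
      have := hsup j hj
      exact ((hω N hev hn).eq_iff hX' (by omega) (by omega)).2 fun e he => H e j hj he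
  rw [measure_congr hae, ← Measure.map_apply (M.measurable_X N) (Set.toFinite _).measurableSet,
    M.map_X hev hn, obsLaw_cylinder hk]
  congr 1
  refine integral_congr_ae (ae_of_all _ fun v => ?_)
  rw [hS, edgeWeight_biUnion, Finset.prod_image (by simp), bulkWeight]
  refine Finset.prod_congr rfl fun j hj => ?_
  have := hsup j hj
  rw [hX'.prod_eq hN hn hn1 (by omega) (by omega)]
  push_cast
  rfl

/-- The block of the layers `q, …, q + r`. -/
def block (n : ℕ) (q r : ℕ) (x : ℤ → Fin (n * (n - 1)) → 𝒳) : Fin (r + 1) → Fin (n * (n - 1)) → 𝒳 :=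
  fun j => x ((q + j : ℕ) : ℤ)

omit [DiscreteMeasurableSpace 𝒳] [Finite 𝒳] in
theorem measurable_block (n q r : ℕ) : Measurable (block (𝒳 := 𝒳) n q r) :=
  measurable_pi_lambda _ fun _ => measurable_pi_apply _

/-- Blocks at distance at least two are independent. -/
theorem StationaryExtension.indepFun_block [Nonempty 𝒳] [IsProbabilityMeasure μ]
    (hk : IsObsKernel k) (hn1 : 2 ≤ n) (M : StationaryExtension μ k n π) {q d r : ℕ} (hq : 2 ≤ q)
    (hd : r + 2 ≤ d) :
    IndepFun (fun ω => block n q r (M.Xinf ω)) (fun ω => block n (q + d) r (M.Xinf ω)) μ := by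
  have hm1 : Measurable fun ω => block n q r (M.Xinf ω) :=
    (measurable_block n q r).comp M.measurable_Xinf
  have hm2 : Measurable fun ω => block n (q + d) r (M.Xinf ω) :=
    (measurable_block n (q + d) r).comp M.measurable_Xinf
  rw [indepFun_iff_map_prod_eq_prod_map_map hm1.aemeasurable hm2.aemeasurable]
  refine Measure.ext_of_singleton fun ⟨a, b⟩ => ?_
  rw [← Set.singleton_prod_singleton, Measure.prod_prod,
    Measure.map_apply (hm1.prodMk hm2) ((measurableSet_singleton a).prod (measurableSet_singleton b)),
    Measure.map_apply hm1 (measurableSet_singleton a),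
    Measure.map_apply hm2 (measurableSet_singleton b)]
  -- A single sequence of layers showing `a` on the first window and `b` on the second.
  let x : ℤ → Fin (n * (n - 1)) → 𝒳 := fun z =>
    if z ≤ q + r then a (Fin.ofNat (r + 1) (z - q).toNat)
    else b (Fin.ofNat (r + 1) (z - q - d).toNat)
  have hxa : ∀ j : Fin (r + 1), x ((q + j : ℕ) : ℤ) = a j := fun j => by
    have hj := j.2
    simp only [x]
    rw [if_pos (by push_cast; omega)]
    congr 1
    apply Fin.ext
    rw [Fin.val_ofNat, Nat.mod_eq_of_lt] <;> omega
  have hxb : ∀ j : Fin (r + 1), x ((q + (d + j) : ℕ) : ℤ) = b j := fun j => by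
    have hj := j.2
    simp only [x]
    rw [if_neg (by push_cast; omega)]
    congr 1
    apply Fin.ext
    rw [Fin.val_ofNat, Nat.mod_eq_of_lt] <;> omega
  set I := Finset.range (r + 1) with hI
  set J := (Finset.range (r + 1)).image (d + ·) with hJ
  have eA : (fun ω => block n q r (M.Xinf ω)) ⁻¹' {a} =
      {ω | ∀ j ∈ I, M.Xinf ω ((q + j : ℕ) : ℤ) = x ((q + j : ℕ) : ℤ)} := by
    ext ω
    simp only [Set.mem_preimage, Set.mem_singleton_iff, Set.mem_ofPred_eq, funext_iff (f := block _ _ _ _),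
      block, hI, Finset.mem_range]
    constructor
    · intro H j hj
      rw [hxa ⟨j, hj⟩]; exact H ⟨j, hj⟩
    · intro H j
      rw [← hxa j]; exact H j j.2
  have eB : (fun ω => block n (q + d) r (M.Xinf ω)) ⁻¹' {b} =
      {ω | ∀ j ∈ J, M.Xinf ω ((q + j : ℕ) : ℤ) = x ((q + j : ℕ) : ℤ)} := by
    ext ω
    simp only [Set.mem_preimage, Set.mem_singleton_iff, Set.mem_ofPred_eq, funext_iff (f := block _ _ _ _),
      block, hJ, Finset.mem_image, Finset.mem_range, forall_exists_index, and_imp,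
      forall_apply_eq_imp_iff₂, add_assoc]
    constructor
    · intro H j hj
      rw [hxb ⟨j, hj⟩]; exact H ⟨j, hj⟩
    · intro H j
      rw [← hxb j]; exact H j j.2
  have eAB : (fun ω => (block n q r (M.Xinf ω), block n (q + d) r (M.Xinf ω))) ⁻¹' ({a} ×ˢ {b}) =
      {ω | ∀ j ∈ I ∪ J, M.Xinf ω ((q + j : ℕ) : ℤ) = x ((q + j : ℕ) : ℤ)} := by
    have : (fun ω => (block n q r (M.Xinf ω), block n (q + d) r (M.Xinf ω))) ⁻¹' ({a} ×ˢ {b}) =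
      ((fun ω => block n q r (M.Xinf ω)) ⁻¹' {a}) ∩
        ((fun ω => block n (q + d) r (M.Xinf ω)) ⁻¹' {b}) := rfl
    rw [this, eA, eB]
    ext ω
    simp only [Set.mem_inter_iff, Set.mem_ofPred_eq, Finset.mem_union, or_imp, forall_and]
  rw [eAB, eA, eB, M.measure_cylinder hk hn1 hq, M.measure_cylinder hk hn1 hq,
    M.measure_cylinder hk hn1 hq, bulkLik_union hk.meas hn1 π q (r := r), ENNReal.ofReal_mul]
  · exact integral_nonneg fun v => Finset.prod_nonneg fun _ _ => Finset.prod_nonneg fun _ _ =>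
      hk.nonneg _ _ _
  · intro i hi; rw [hI, Finset.mem_range] at hi; omega
  · intro j hj
    simp only [hJ, Finset.mem_image] at hj
    omega

omit [DiscreteMeasurableSpace 𝒳] [Finite 𝒳] [IsProbabilityMeasure π] in
theorem StationaryExtension.map_shift (M : StationaryExtension μ k n π) (q : ℕ) :
    μ.map (fun ω => shift^[q] (M.Xinf ω)) = μ.map M.Xinf := by
  have hs : Measurable (shift (S := Fin (n * (n - 1)) → 𝒳)) :=
    measurable_pi_lambda _ fun _ => measurable_pi_apply _
  have h1 : μ.map (fun ω => shift (M.Xinf ω)) = μ.map M.Xinf := by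
    have hX := M.measurable_Xinf
    have hV := M.measurable_Vinf
    have := congrArg (Measure.map fun p : ℤ → (Fin (n * (n - 1)) → 𝒳) × (Fin (2 * (n - 1)) → 𝒱) =>
      fun z => (p z).1) M.stationary
    rw [Measure.map_map (by fun_prop) (by fun_prop), Measure.map_map (by fun_prop) (by fun_prop)]
      at this
    exact this
  induction q with
  | zero => rfl
  | succ q ih =>
    have h2 := congrArg (Measure.map shift^[q]) h1
    have hc : Measurable fun ω => shift (M.Xinf ω) := hs.comp M.measurable_Xinf
    rw [Measure.map_map (hs.iterate q) hc,
      Measure.map_map (hs.iterate q) M.measurable_Xinf] at h2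
    exact h2.trans ih

/-! ### The strong law for finitely dependent blocks. -/

/-- Cesàro averages converge if they do so along each residue class. -/
theorem _root_.tendsto_cesaro_of_residues {y : ℕ → ℝ} {B c : ℝ} {L : ℕ} (hL : 0 < L)
    (hB : ∀ j, |y j| ≤ B)
    (h : ∀ a < L, Tendsto (fun m : ℕ => (∑ i ∈ Finset.range m, y (a + i * L)) / m) atTop (𝓝 c)) :
    Tendsto (fun R : ℕ => (∑ j ∈ Finset.range R, y j) / R) atTop (𝓝 c) := by
  have hB0 : 0 ≤ B := (abs_nonneg _).trans (hB 0)
  have hblock : ∀ m : ℕ, ∑ j ∈ Finset.range (m * L), (y j - c) =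
      ∑ a ∈ Finset.range L, (∑ i ∈ Finset.range m, y (a + i * L) - m * c) := by
    intro m
    induction m with
    | zero => simp
    | succ m ih =>
      rw [Nat.succ_mul, Finset.sum_range_add, ih, ← Finset.sum_add_distrib]
      refine Finset.sum_congr rfl fun a _ => ?_
      rw [Finset.sum_range_succ, add_comm (m * L) a]
      push_cast
      ring
  have h0 : Tendsto (fun m : ℕ => (∑ j ∈ Finset.range (m * L), (y j - c)) / m) atTop (𝓝 0) := by
    have h1 : Tendsto (fun m : ℕ => ∑ a ∈ Finset.range L,
        ((∑ i ∈ Finset.range m, y (a + i * L)) / m - c)) atTop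
        (𝓝 (∑ a ∈ Finset.range L, (c - c))) :=
      tendsto_finsetSum _ fun a ha => (h a (Finset.mem_range.1 ha)).sub_const c
    simp only [sub_self, Finset.sum_const_zero] at h1
    refine h1.congr' ?_
    filter_upwards [eventually_gt_atTop 0] with m hm
    rw [hblock, Finset.sum_div]
    refine Finset.sum_congr rfl fun a _ => ?_
    have : (m : ℝ) ≠ 0 := by positivity
    field_simp
  -- The complete periods, plus fewer than `L` bounded leftover terms.
  have h1 : Tendsto (fun R : ℕ => |(∑ j ∈ Finset.range (R / L * L), (y j - c)) / (R / L : ℕ)| +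
      L * (B + |c|) / R) atTop (𝓝 0) := by
    have e1 := (h0.comp (Nat.tendsto_div_const_atTop hL.ne')).abs
    have e2 := tendsto_const_div_atTop_nhds_zero_nat ((L : ℝ) * (B + |c|))
    simpa using e1.add e2
  rw [tendsto_iff_norm_sub_tendsto_zero]
  refine squeeze_zero' (Eventually.of_forall fun _ => norm_nonneg _) ?_ h1
  filter_upwards [eventually_ge_atTop L] with R hR
  have hR0 : (0 : ℝ) < R := by exact_mod_cast hL.trans_le hR
  have hm0 : 0 < R / L := Nat.div_pos hR hL
  have hm0' : (0 : ℝ) < (R / L : ℕ) := by exact_mod_cast hm0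
  have hmR : ((R / L : ℕ) : ℝ) ≤ R := by exact_mod_cast Nat.div_le_self R L
  have e1 : (∑ j ∈ Finset.range R, y j) / R - c = (∑ j ∈ Finset.range R, (y j - c)) / R := by
    rw [Finset.sum_sub_distrib, Finset.sum_const, Finset.card_range, nsmul_eq_mul]
    field_simp
  have e2 : ∑ j ∈ Finset.range R, (y j - c) = ∑ j ∈ Finset.range (R / L * L), (y j - c) +
      ∑ j ∈ Finset.range (R % L), (y (R / L * L + j) - c) := by
    rw [← Finset.sum_range_add, Nat.div_add_mod']
  have e3 : |∑ j ∈ Finset.range (R % L), (y (R / L * L + j) - c)| ≤ L * (B + |c|) := by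
    refine (Finset.abs_sum_le_sum_abs _ _).trans ?_
    have : ∀ j ∈ Finset.range (R % L), |y (R / L * L + j) - c| ≤ B + |c| := fun j _ =>
      (abs_sub _ _).trans (by linarith [hB (R / L * L + j)])
    refine (Finset.sum_le_card_nsmul _ _ _ this).trans ?_
    rw [Finset.card_range, nsmul_eq_mul]
    have : ((R % L : ℕ) : ℝ) ≤ L := by exact_mod_cast (Nat.mod_lt R hL).le
    have h2 : 0 ≤ B + |c| := by positivity
    exact mul_le_mul_of_nonneg_right this h2
  rw [e1, Real.norm_eq_abs, e2, abs_div, abs_div, abs_of_pos hR0, abs_of_pos hm0']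
  calc _ ≤ (|∑ j ∈ Finset.range (R / L * L), (y j - c)| +
        |∑ j ∈ Finset.range (R % L), (y (R / L * L + j) - c)|) / R := by
          gcongr; exact abs_add_le _ _
    _ ≤ _ := by
      rw [add_div]
      gcongr

/-- The law of large numbers for functions of finitely many layers. -/
theorem StationaryExtension.strong_law_block [Nonempty 𝒳] [IsProbabilityMeasure μ]
    (hk : IsObsKernel k) (hn1 : 2 ≤ n) (M : StationaryExtension μ k n π) (r : ℕ)
    (G : (Fin (r + 1) → Fin (n * (n - 1)) → 𝒳) → ℝ) :
    ∀ᵐ ω ∂μ, Tendsto (fun R : ℕ =>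
      (∑ j ∈ Finset.range R, G (block n 0 r (shift^[2 + j] (M.Xinf ω)))) / R) atTop
      (𝓝 (∫ ω, G (block n 0 r (M.Xinf ω)) ∂μ)) := by
  have hG : Measurable G := measurable_of_countable G
  obtain ⟨B, hB⟩ : ∃ B, ∀ b, |G b| ≤ B := by
    obtain ⟨B, hB⟩ := (Set.finite_range fun b => |G b|).bddAbove
    exact ⟨B, fun b => hB ⟨b, rfl⟩⟩
  have hs : ∀ (q : ℕ) (x : ℤ → Fin (n * (n - 1)) → 𝒳),
      block n 0 r (shift^[q] x) = block n q r x := by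
    intro q x
    funext j
    simp only [block, shift_iterate_apply]
    push_cast
    rw [zero_add]
  have hmeas : ∀ q, Measurable fun ω => G (block n q r (M.Xinf ω)) := fun q =>
    hG.comp ((measurable_block n q r).comp M.measurable_Xinf)
  have hid : ∀ q, IdentDistrib (fun ω => G (block n q r (M.Xinf ω)))
      (fun ω => G (block n 0 r (M.Xinf ω))) μ μ := by
    intro q
    refine ⟨(hmeas q).aemeasurable, (hmeas 0).aemeasurable, ?_⟩
    have hshift : Measurable fun ω => shift^[q] (M.Xinf ω) :=
      ((measurable_pi_lambda shift fun _ => measurable_pi_apply _).iterate q).comp M.measurable_Xinf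
    have hGb : Measurable fun x => G (block n 0 r x) := hG.comp (measurable_block n 0 r)
    have h1 := congrArg (Measure.map fun x => G (block n 0 r x)) (M.map_shift q)
    rw [Measure.map_map hGb hshift, Measure.map_map hGb M.measurable_Xinf] at h1
    simp only [Function.comp_def, hs] at h1
    exact h1
  -- Starting points `r + 2` apart leave one layer free between blocks of `r + 1` layers. The offset
  -- `2` is needed because the joint laws are identified with the model from layer `2` on.
  have hres : ∀ a, ∀ᵐ ω ∂μ, Tendsto (fun m : ℕ =>
      (∑ i ∈ Finset.range m, G (block n (2 + (a + i * (r + 2))) r (M.Xinf ω))) / m) atTop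
      (𝓝 (∫ ω, G (block n 0 r (M.Xinf ω)) ∂μ)) := by
    intro a
    have hlt : ∀ i j : ℕ, i < j → IndepFun (fun ω => G (block n (2 + (a + i * (r + 2))) r (M.Xinf ω)))
        (fun ω => G (block n (2 + (a + j * (r + 2))) r (M.Xinf ω))) μ := by
      intro i j hij
      have hd : r + 2 ≤ (j - i) * (r + 2) := Nat.le_mul_of_pos_left _ (by omega)
      have := (M.indepFun_block hk hn1 (q := 2 + (a + i * (r + 2))) (by omega) hd).comp hG hG
      have e : 2 + (a + i * (r + 2)) + (j - i) * (r + 2) = 2 + (a + j * (r + 2)) := by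
        obtain ⟨t, rfl⟩ := Nat.exists_eq_add_of_lt hij
        rw [show i + t + 1 - i = t + 1 by omega]
        ring
      rw [e] at this
      exact this
    have key := strong_law_ae_real
      (fun (i : ℕ) ω => G (block n (2 + (a + i * (r + 2))) r (M.Xinf ω)))
      (Integrable.of_bound (hmeas _).aestronglyMeasurable B (ae_of_all _ fun ω => hB _))
      (fun i j hij => by
        rcases lt_or_gt_of_ne hij with h | h
        · exact hlt i j h
        · exact (hlt j i h).symm)
      (fun i => (hid _).trans (hid _).symm)
    rw [(hid _).integral_eq] at key
    exact key
  filter_upwards [ae_all_iff.2 hres] with ω hω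
  simp only [hs]
  exact tendsto_cesaro_of_residues (y := fun j => G (block n (2 + j) r (M.Xinf ω)))
    (Nat.succ_pos (r + 1)) (fun j => hB _) fun a _ => hω a

end LLN

/-! ### The limit of the increments -/

section Limit

variable {𝒱 : Type u} {𝒳 : Type v} [MeasurableSpace 𝒱]

theorem bulkLik_congr (k : 𝒳 → 𝒱 → 𝒱 → ℝ) (n : ℕ) (π : Measure 𝒱) (q : ℤ) {I : Finset ℕ}
    {x x' : ℤ → Fin (n * (n - 1)) → 𝒳} (h : ∀ j ∈ I, x (q + j) = x' (q + j)) :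
    bulkLik k n π q I x = bulkLik k n π q I x' :=
  integral_congr_ae (ae_of_all _ fun v => Finset.prod_congr rfl fun j hj => by rw [h j hj])

/-- The increment as a function of the block of layers on which it depends. -/
noncomputable def blockIncr (k : 𝒳 → 𝒱 → 𝒱 → ℝ) (n : ℕ) (π : Measure 𝒱) (r : ℕ)
    (b : Fin (r + 1) → Fin (n * (n - 1)) → 𝒳) : ℝ :=
  bulkIncr k n π 0 r fun z => b (Fin.ofNat (r + 1) z.toNat)

theorem bulkIncr_eq_blockIncr (k : 𝒳 → 𝒱 → 𝒱 → ℝ) (n : ℕ) (π : Measure 𝒱) (r : ℕ)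
    (x : ℤ → Fin (n * (n - 1)) → 𝒳) :
    bulkIncr k n π 0 r x = blockIncr k n π r (block n 0 r x) := by
  have h : ∀ j ≤ r, x (0 + (j : ℤ)) =
      block n 0 r x (Fin.ofNat (r + 1) (0 + (j : ℤ)).toNat) := by
    intro j hj
    rw [block, Fin.val_ofNat, zero_add, Int.toNat_natCast, Nat.mod_eq_of_lt (by omega), zero_add]
  have h' : ∀ a, bulkLik k n π 0 (Finset.Icc a r) x = bulkLik k n π 0 (Finset.Icc a r)
      fun z => block n 0 r x (Fin.ofNat (r + 1) z.toNat) := fun a =>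
    bulkLik_congr k n π 0 fun j hj => h j (Finset.mem_Icc.1 hj).2
  rw [blockIncr, bulkIncr, bulkIncr, h', h']

variable [TopologicalSpace 𝒱] [HereditarilyLindelofSpace 𝒱] {k : 𝒳 → 𝒱 → 𝒱 → ℝ} {ε : ℝ}
  {π : Measure 𝒱} [IsProbabilityMeasure π]

theorem tendsto_gap (hε : 0 < ε) (hε1 : ε ≤ 1) (m : ℕ) :
    Tendsto (fun r : ℕ => (1 - ε ^ m) ^ (r - 1) / (ε ^ m) ^ 2) atTop (𝓝 0) := by
  have hδ : 0 < ε ^ m := pow_pos hε m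
  have hδ1 : ε ^ m ≤ 1 := pow_le_one₀ hε.le hε1
  have h := ((tendsto_pow_atTop_nhds_zero_of_lt_one (r := 1 - ε ^ m) (by linarith)
    (by linarith)).comp (tendsto_sub_atTop_nat 1)).div_const ((ε ^ m) ^ 2)
  rw [zero_div] at h
  exact h

theorem tendsto_bulkIncr (hk : IsObsKernel k) (hε : 0 < ε) (hε1 : ε ≤ 1)
    (hmix : MixesWith k ε π) {n : ℕ} (hn1 : 2 ≤ n) (x : ℤ → Fin (n * (n - 1)) → 𝒳) :
    Tendsto (fun r => bulkIncr k n π 0 r x) atTop (𝓝 (ell k n π x)) := by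
  -- The index starts at `1` because the forgetting bound requires `1 ≤ r`.
  have hc : CauchySeq fun r => bulkIncr k n π 0 (r + 1) x := by
    refine cauchySeq_of_le_tendsto_0' _ (fun r R hR => ?_)
      ((tendsto_gap hε hε1 (n * (n - 1))).comp (tendsto_add_atTop_nat 1))
    rw [dist_comm, Real.dist_eq]
    exact abs_bulkIncr_sub_le hk hε hε1 hmix hn1 0 (by omega) (by omega) x
  obtain ⟨l, hl⟩ := cauchySeq_tendsto_of_complete hc
  have hl' := (tendsto_add_atTop_iff_nat (f := fun r => bulkIncr k n π 0 r x) 1).1 hl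
  rw [ell, hl'.limUnder_eq]
  exact hl'

theorem abs_ell_sub_le (hk : IsObsKernel k) (hε : 0 < ε) (hε1 : ε ≤ 1)
    (hmix : MixesWith k ε π) {n : ℕ} (hn1 : 2 ≤ n) {r : ℕ} (hr : 1 ≤ r)
    (x : ℤ → Fin (n * (n - 1)) → 𝒳) :
    |ell k n π x - bulkIncr k n π 0 r x| ≤
      (1 - ε ^ (n * (n - 1))) ^ (r - 1) / (ε ^ (n * (n - 1))) ^ 2 := by
  refine le_of_tendsto ((tendsto_bulkIncr hk hε hε1 hmix hn1 x).sub_const _).abs ?_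
  filter_upwards [eventually_ge_atTop r] with R hR
  exact abs_bulkIncr_sub_le hk hε hε1 hmix hn1 0 hr hR x

theorem abs_ell_le (hk : IsObsKernel k) (hε : 0 < ε) (hε1 : ε ≤ 1)
    (hmix : MixesWith k ε π) {n : ℕ} (hn1 : 2 ≤ n) (x : ℤ → Fin (n * (n - 1)) → 𝒳) :
    |ell k n π x| ≤ -Real.log (ε ^ (n * (n - 1))) :=
  le_of_tendsto (tendsto_bulkIncr hk hε hε1 hmix hn1 x).abs
    (Eventually.of_forall fun r => abs_bulkIncr_le hk hε hε1 hmix n 0 r x)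

variable [MeasurableSpace 𝒳] [DiscreteMeasurableSpace 𝒳] [Finite 𝒳]

/-- A pointwise limit of functions of finitely many layers, each of which takes values in a finite
set. -/
theorem measurable_ell (hk : IsObsKernel k) (hε : 0 < ε) (hε1 : ε ≤ 1)
    (hmix : MixesWith k ε π) {n : ℕ} (hn1 : 2 ≤ n) : Measurable (ell k n π) := by
  refine measurable_of_tendsto_metrizable (f := fun r x => bulkIncr k n π 0 r x) (fun r => ?_)
    (tendsto_pi_nhds.2 fun x => tendsto_bulkIncr hk hε hε1 hmix hn1 x)
  simp only [bulkIncr_eq_blockIncr]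
  exact (measurable_of_countable (blockIncr k n π r)).comp (measurable_block n 0 r)

/-- The log-likelihood is, up to a bounded error, a Birkhoff sum of the limit increments. -/
theorem exists_abs_logLik_sub_sum_le (hk : IsObsKernel k) (hε : 0 < ε) (hε1 : ε ≤ 1)
    (hmix : MixesWith k ε π) {n : ℕ} (hn1 : 2 ≤ n) :
    ∃ K, ∀ N, Even N → 4 * n < N → 5 ≤ orderMax n N →
      ∀ (X : Edge n N → 𝒳) (x : ℤ → Fin (n * (n - 1)) → 𝒳), Agrees n N X x →
        |logLik k n N π X - ∑ j ∈ Finset.range (orderMax n N), ell k n π (shift^[2 + j] x)| ≤ K := by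
  set δ := ε ^ (n * (n - 1)) with hδ
  have hδ0 : 0 < δ := pow_pos hε _
  have hδ1 : δ ≤ 1 := pow_le_one₀ hε.le hε1
  -- In order: the edges outside the bulk, the geometric sum of the forgetting errors, the last bulk
  -- layer, and the four terms by which `orderMax n N` exceeds `R`.
  refine ⟨-Real.log (ε ^ (20 * n * (20 * n))) + (δ⁻¹ / δ ^ 2 + -Real.log δ) + 4 * -Real.log δ, ?_⟩
  intro N hev hN hom X x hX
  obtain ⟨h, hh⟩ := hev
  obtain ⟨R, hR⟩ : ∃ R, R + 4 = orderMax n N := ⟨orderMax n N - 4, by omega⟩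
  have e1 := abs_logLik_sub_le hk hε hε1 hmix (by omega : N = 2 * h) hN hn1 hX hR
  rw [log_bulkLik_eq_sum] at e1
  have e2 : |∑ j ∈ Finset.range R, (bulkIncr k n π (2 + j : ℕ) (R - j) x -
      ell k n π (shift^[2 + j] x))| ≤ δ⁻¹ / δ ^ 2 := by
    refine (Finset.abs_sum_le_sum_abs _ _).trans ?_
    have hle : ∀ j ∈ Finset.range R, |bulkIncr k n π (2 + j : ℕ) (R - j) x -
        ell k n π (shift^[2 + j] x)| ≤ (1 - δ) ^ (R - 1 - j) / δ ^ 2 := by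
      intro j hj
      rw [Finset.mem_range] at hj
      rw [abs_sub_comm, bulkIncr_shift hk.meas, show R - 1 - j = R - j - 1 by omega]
      exact abs_ell_sub_le hk hε hε1 hmix hn1 (by omega) _
    refine (Finset.sum_le_sum hle).trans ?_
    rw [← Finset.sum_div, Finset.sum_range_reflect (fun j => (1 - δ) ^ j)]
    gcongr
    rw [geom_sum_eq (by linarith)]
    have h1 : 0 ≤ (1 - δ) ^ R := pow_nonneg (by linarith) _
    rw [← neg_div_neg_eq, inv_eq_one_div]
    apply div_le_div₀ <;> linarith
  have e3 : |Real.log (bulkLik k n π (2 + R : ℕ) (Finset.Icc 0 0) x)| ≤ -Real.log δ := by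
    have hm := bulkLik_mem hk hε hε1 hmix n (2 + R : ℕ) (Finset.Icc 0 0) x
    simp only [Finset.Icc_self, Finset.card_singleton, pow_one] at hm ⊢
    have l1 := Real.log_le_log hδ0 hm.1
    have l2 := Real.log_nonpos (hδ0.le.trans hm.1) hm.2
    rw [abs_of_nonpos l2]
    linarith
  have e4 : |∑ j ∈ Finset.range 4, ell k n π (shift^[2 + (R + j)] x)| ≤ 4 * -Real.log δ := by
    refine (Finset.abs_sum_le_sum_abs _ _).trans ?_
    refine (Finset.sum_le_card_nsmul _ _ (-Real.log δ) fun j _ =>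
      abs_ell_le hk hε hε1 hmix hn1 _).trans ?_
    simp
  rw [← hR, Finset.sum_range_add]
  rw [Finset.sum_sub_distrib] at e2
  rw [abs_le] at *
  constructor <;> linarith [e1.1, e1.2, e2.1, e2.2, e3.1, e3.2, e4.1, e4.2]

variable {Ω : Type w} [MeasurableSpace Ω] {μ : Measure Ω} [IsProbabilityMeasure μ] {n : ℕ}
  {πstar : Measure 𝒱} [IsProbabilityMeasure πstar]

omit [IsProbabilityMeasure πstar] in
theorem integrable_ell (hk : IsObsKernel k) (hε : 0 < ε) (hε1 : ε ≤ 1)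
    (hmix : MixesWith k ε π) (hn1 : 2 ≤ n) (M : StationaryExtension μ k n πstar) :
    Integrable (fun ω => ell k n π (M.Xinf ω)) μ :=
  Integrable.of_bound
    ((measurable_ell hk hε hε1 hmix hn1).comp M.measurable_Xinf).aestronglyMeasurable _
    (ae_of_all _ fun ω => abs_ell_le hk hε hε1 hmix hn1 (M.Xinf ω))

/-- The law of large numbers for the limit increments. -/
theorem StationaryExtension.strong_law_ell [Nonempty 𝒳] (hk : IsObsKernel k) (hε : 0 < ε)
    (hε1 : ε ≤ 1) (hmix : MixesWith k ε π) (hn1 : 2 ≤ n) (M : StationaryExtension μ k n πstar) :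
    ∀ᵐ ω ∂μ, Tendsto (fun R : ℕ =>
      (∑ j ∈ Finset.range R, ell k n π (shift^[2 + j] (M.Xinf ω))) / R) atTop
      (𝓝 (∫ ω, ell k n π (M.Xinf ω) ∂μ)) := by
  have key : ∀ᵐ ω ∂μ, ∀ r : ℕ, Tendsto (fun R : ℕ =>
      (∑ j ∈ Finset.range R, bulkIncr k n π 0 r (shift^[2 + j] (M.Xinf ω))) / R) atTop
      (𝓝 (∫ ω, bulkIncr k n π 0 r (M.Xinf ω) ∂μ)) := by
    rw [ae_all_iff]
    intro r
    simp only [bulkIncr_eq_blockIncr]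
    exact M.strong_law_block hk hn1 r (blockIncr k n π r)
  filter_upwards [key] with ω hω
  rw [Metric.tendsto_atTop]
  intro η hη
  -- One third of `η` each for replacing `ell` by an increment in the average and in the mean, and
  -- one for the strong law.
  obtain ⟨r, hr, hr1⟩ := (((tendsto_gap hε hε1 (n * (n - 1))).eventually_lt_const
    (show (0 : ℝ) < η / 3 by linarith)).and (eventually_ge_atTop 1)).exists
  set g := (1 - ε ^ (n * (n - 1))) ^ (r - 1) / (ε ^ (n * (n - 1))) ^ 2 with hg
  have hle : ∀ x, |ell k n π x - bulkIncr k n π 0 r x| ≤ g := fun x =>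
    abs_ell_sub_le hk hε hε1 hmix hn1 hr1 x
  obtain ⟨R₀, hR₀⟩ := Metric.tendsto_atTop.1 (hω r) (η / 3) (by linarith)
  refine ⟨max R₀ 1, fun R hR => ?_⟩
  have hRpos : (0 : ℝ) < R := by
    have : 1 ≤ R := (le_max_right _ _).trans hR
    exact_mod_cast this
  have h1 := hR₀ R ((le_max_left _ _).trans hR)
  have h2 : |(∑ j ∈ Finset.range R, ell k n π (shift^[2 + j] (M.Xinf ω))) / R -
      (∑ j ∈ Finset.range R, bulkIncr k n π 0 r (shift^[2 + j] (M.Xinf ω))) / R| ≤ g := by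
    rw [← sub_div, ← Finset.sum_sub_distrib, abs_div, abs_of_pos hRpos, div_le_iff₀ hRpos]
    refine (Finset.abs_sum_le_sum_abs _ _).trans
      ((Finset.sum_le_card_nsmul _ _ g fun j _ => hle _).trans ?_)
    rw [Finset.card_range, nsmul_eq_mul, mul_comm]
  have hib : Integrable (fun ω => bulkIncr k n π 0 r (M.Xinf ω)) μ := by
    refine Integrable.of_bound (Measurable.aestronglyMeasurable ?_) _
      (ae_of_all _ fun ω => abs_bulkIncr_le hk hε hε1 hmix n 0 r (M.Xinf ω))
    simp only [bulkIncr_eq_blockIncr]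
    exact (measurable_of_countable (blockIncr k n π r)).comp
      ((measurable_block n 0 r).comp M.measurable_Xinf)
  have h3 : |(∫ ω, ell k n π (M.Xinf ω) ∂μ) - ∫ ω, bulkIncr k n π 0 r (M.Xinf ω) ∂μ| ≤ g := by
    rw [← integral_sub (integrable_ell hk hε hε1 hmix hn1 M) hib, ← Real.norm_eq_abs]
    have := norm_integral_le_of_norm_le_const (μ := μ)
      (f := fun ω => ell k n π (M.Xinf ω) - bulkIncr k n π 0 r (M.Xinf ω)) (C := g)
      (ae_of_all _ fun ω => hle _)
    simpa using this
  rw [Real.dist_eq] at h1 ⊢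
  rw [abs_le] at h2 h3
  rw [abs_lt] at h1 ⊢
  constructor <;> linarith [h1.1, h1.2, h2.1, h2.2, h3.1, h3.2]

/-- The conditional log-likelihoods converge uniformly over the laws with the same mixing
constant. -/
theorem tendstoUniformlyOn_condLogLik {P : Set (ProbabilityMeasure 𝒱)} (hk : IsObsKernel k)
    (hε : 0 < ε) (hε1 : ε ≤ 1) (hmix : ∀ π ∈ P, MixesWith k ε (π : Measure 𝒱)) (hn1 : 2 ≤ n)
    {X : ∀ N, Edge n N → 𝒳} {x : ℤ → Fin (n * (n - 1)) → 𝒳}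
    (hX : ∀ N, Even N → 4 * n < N → Agrees n N (X N) x) {q : ℕ} (hq : 2 ≤ q) :
    TendstoUniformlyOn (fun N (π : ProbabilityMeasure 𝒱) => condLogLik k n N (π : Measure 𝒱) q (X N))
      (fun π => ell k n π (shift^[q] x)) evenAtTop P := by
  rw [Metric.tendstoUniformlyOn_iff]
  intro η hη
  obtain ⟨r, hr, hr1⟩ := (((tendsto_gap hε hε1 (n * (n - 1))).eventually_lt_const
    (show (0 : ℝ) < η / 2 by linarith)).and (eventually_ge_atTop 1)).exists
  filter_upwards [exists_large_even hn1 (q + r + 2)] with N ⟨hev, hN, hom⟩ π hπ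
  obtain ⟨h, hh⟩ := id hev
  have h1 := abs_condLogLik_sub_le hk hε hε1 (hmix π hπ) (by omega : N = 2 * h) hN hn1
    (hX N hev hN) hq hr1 hom
  have h2 := abs_ell_sub_le hk hε hε1 (hmix π hπ) hn1 hr1 (shift^[q] x)
  rw [bulkIncr_shift hk.meas] at h1
  rw [Real.dist_eq]
  rw [abs_le] at h1 h2
  rw [abs_lt]
  constructor <;> linarith [h1.1, h1.2, h2.1, h2.2]

theorem StationaryExtension.tendsto_logLik [Nonempty 𝒳] (hk : IsObsKernel k) (hε : 0 < ε)
    (hε1 : ε ≤ 1) (hmix : MixesWith k ε π) (hn1 : 2 ≤ n) (M : StationaryExtension μ k n πstar) :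
    ∀ᵐ ω ∂μ, Tendsto (fun N => (1 / (orderMax n N : ℝ)) * logLik k n N π (M.X N ω)) evenAtTop
      (𝓝 (∫ ω', ell k n π (M.Xinf ω') ∂μ)) := by
  obtain ⟨K, hK⟩ := exists_abs_logLik_sub_sum_le hk hε hε1 hmix hn1
  filter_upwards [M.ae_agrees, M.strong_law_ell hk hε hε1 hmix hn1] with ω hω hlln
  have h1 := hlln.comp (tendsto_orderMax hn1)
  have h2 : Tendsto (fun N => K / (orderMax n N : ℝ)) evenAtTop (𝓝 0) :=
    (tendsto_const_div_atTop_nhds_zero_nat K).comp (tendsto_orderMax hn1)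
  have h3 : Tendsto (fun N => (1 / (orderMax n N : ℝ)) * logLik k n N π (M.X N ω) -
      (∑ j ∈ Finset.range (orderMax n N), ell k n π (shift^[2 + j] (M.Xinf ω))) / orderMax n N)
      evenAtTop (𝓝 0) := by
    refine squeeze_zero_norm' ?_ h2
    filter_upwards [exists_large_even hn1 5] with N ⟨hev, hN, hom⟩
    have hpos : (0 : ℝ) < orderMax n N := by exact_mod_cast (by omega : 0 < orderMax n N)
    rw [one_div_mul_eq_div, ← sub_div, Real.norm_eq_abs, abs_div, abs_of_pos hpos]
    gcongr
    exact hK N hev hN hom _ _ (hω N hev hN)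
  have h4 := h3.add h1
  simp only [Function.comp_apply, sub_add_cancel, zero_add] at h4
  exact h4

/-- Dominated convergence: the normalized log-likelihood is bounded, `ell` being bounded and the
error of its Birkhoff sum being at most `K`. -/
theorem StationaryExtension.tendsto_logLik_L1 [Nonempty 𝒳] (hk : IsObsKernel k) (hε : 0 < ε)
    (hε1 : ε ≤ 1) (hmix : MixesWith k ε π) (hn1 : 2 ≤ n) (M : StationaryExtension μ k n πstar) :
    Tendsto (fun N => eLpNorm (fun ω => (1 / (orderMax n N : ℝ)) * logLik k n N π (M.X N ω) -
      ∫ ω', ell k n π (M.Xinf ω') ∂μ) 1 μ) evenAtTop (𝓝 0) := by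
  obtain ⟨K, hK⟩ := exists_abs_logLik_sub_sum_le hk hε hε1 hmix hn1
  set c := ∫ ω', ell k n π (M.Xinf ω') ∂μ with hc
  set D := -Real.log (ε ^ (n * (n - 1))) with hD
  simp only [eLpNorm_one_eq_lintegral_enorm]
  have key := tendsto_lintegral_filter_of_dominated_convergence (μ := μ) (l := evenAtTop)
    (F := fun N ω => ‖(1 / (orderMax n N : ℝ)) * logLik k n N π (M.X N ω) - c‖ₑ)
    (f := fun _ => 0) (fun _ => ENNReal.ofReal (K + D + |c|)) ?_ ?_ ?_ ?_
  · simpa using key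
  · refine Eventually.of_forall fun N => Measurable.enorm (Measurable.sub_const
      (Measurable.const_mul ?_ _) _)
    exact (measurable_of_countable (logLik k n N π)).comp (M.measurable_X N)
  · filter_upwards [exists_large_even hn1 5] with N ⟨hev, hN, hom⟩
    filter_upwards [M.ae_agrees] with ω hω
    have h1 := hK N hev hN hom _ _ (hω N hev hN)
    have hpos : (1 : ℝ) ≤ orderMax n N := by exact_mod_cast (by omega : 1 ≤ orderMax n N)
    have h2 : |∑ j ∈ Finset.range (orderMax n N), ell k n π (shift^[2 + j] (M.Xinf ω))| ≤
        orderMax n N * D := by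
      refine (Finset.abs_sum_le_sum_abs _ _).trans ((Finset.sum_le_card_nsmul _ _ D fun j _ =>
        abs_ell_le hk hε hε1 hmix hn1 _).trans ?_)
      rw [Finset.card_range, nsmul_eq_mul]
    have hK0 : 0 ≤ K := (abs_nonneg _).trans h1
    have h3 : |logLik k n N π (M.X N ω)| ≤ orderMax n N * (K + D) := by
      have : K ≤ orderMax n N * K := le_mul_of_one_le_left hK0 hpos
      rw [abs_le] at *
      constructor <;> linarith [h1.1, h1.2, h2.1, h2.2]
    rw [← ofReal_norm]
    refine ENNReal.ofReal_le_ofReal ((norm_sub_le _ _).trans ?_)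
    rw [Real.norm_eq_abs, Real.norm_eq_abs, one_div_mul_eq_div, abs_div,
      abs_of_pos (by linarith : (0 : ℝ) < orderMax n N)]
    gcongr
    rw [div_le_iff₀ (by linarith)]
    linarith
  · simp
  · filter_upwards [M.tendsto_logLik hk hε hε1 hmix hn1] with ω hω
    have := (hω.sub_const c).enorm
    rwa [← hc, sub_self, enorm_zero] at this

end Limit

end RoundRobin

/-! ### Assembly of the theorem. -/

theorem mainTheorem2 {𝒱 : Type u} {𝒳 : Type v}
    [TopologicalSpace 𝒱] [HereditarilyLindelofSpace 𝒱] [MeasurableSpace 𝒱] [OpensMeasurableSpace 𝒱]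
    [MeasurableSpace 𝒳] [Countable 𝒳] [DiscreteMeasurableSpace 𝒳]
    (k : 𝒳 → 𝒱 → 𝒱 → ℝ)
    (hk_meas : ∀ x, Measurable (Function.uncurry (k x)))
    (hk_nonneg : ∀ x v₁ v₂, 0 ≤ k x v₁ v₂)
    (hk_sum : ∀ v₁ v₂, HasSum (fun x => k x v₁ v₂) 1)
    (n : ℕ) (hn : 2 ≤ n) :
    ∃ ℓ : ProbabilityMeasure 𝒱 → (ℤ → Fin (n * (n - 1)) → 𝒳) → ℝ,
      ∀ (P : Set (ProbabilityMeasure 𝒱)) (πstar : ProbabilityMeasure 𝒱),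
        RoundRobin.Mixing k (insert πstar P) →
        (∃ (Ω : Type (max u v)) (_ : MeasurableSpace Ω) (μ : Measure Ω), IsProbabilityMeasure μ ∧
          Nonempty (RoundRobin.StationaryExtension μ k n (πstar : Measure 𝒱))) ∧
        (∀ π ∈ P, Measurable (ℓ π)) ∧
        ∀ (Ω : Type w) [MeasurableSpace Ω] (μ : Measure Ω) [IsProbabilityMeasure μ]
          (M : RoundRobin.StationaryExtension μ k n (πstar : Measure 𝒱)),
          (∀ q : ℕ, 2 ≤ q → ∀ᵐ ω ∂μ,
            TendstoUniformlyOn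
              (fun N (π : ProbabilityMeasure 𝒱) =>
                RoundRobin.condLogLik k n N (π : Measure 𝒱) q (M.X N ω))
              (fun π => ℓ π (RoundRobin.shift^[q] (M.Xinf ω)))
              RoundRobin.evenAtTop P) ∧
          ∀ π ∈ P,
            Integrable (fun ω => ℓ π (M.Xinf ω)) μ ∧
            (∀ᵐ ω ∂μ, Tendsto
              (fun N => (1 / (RoundRobin.orderMax n N : ℝ)) *
                RoundRobin.logLik k n N (π : Measure 𝒱) (M.X N ω))
              RoundRobin.evenAtTop (𝓝 (∫ ω', ℓ π (M.Xinf ω') ∂μ))) ∧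
            Tendsto
              (fun N => eLpNorm (fun ω => (1 / (RoundRobin.orderMax n N : ℝ)) *
                RoundRobin.logLik k n N (π : Measure 𝒱) (M.X N ω) -
                  ∫ ω', ℓ π (M.Xinf ω') ∂μ) 1 μ)
              RoundRobin.evenAtTop (𝓝 0) := by
  have hk : RoundRobin.IsObsKernel k := ⟨hk_meas, hk_nonneg, hk_sum⟩
  -- `ell` is a `limUnder`, hence defined for every `π` before `P`, `πstar` and `ε` are chosen; the
  -- mixing condition only enters to show that the limit exists.
  refine ⟨fun π => RoundRobin.ell k n (π : Measure 𝒱), fun P πstar hmixing => ?_⟩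
  obtain ⟨ε, hε, hmix⟩ := hmixing
  have hmixP : ∀ π ∈ P, RoundRobin.MixesWith k ε (π : Measure 𝒱) := fun π hπ x v₁ h₁ v₂ h₂ =>
    hmix x π (Set.mem_insert_of_mem _ hπ) v₁ h₁ v₂ h₂
  have hmixs : RoundRobin.MixesWith k ε (πstar : Measure 𝒱) := fun x v₁ h₁ v₂ h₂ =>
    hmix x πstar (Set.mem_insert _ _) v₁ h₁ v₂ h₂
  obtain ⟨v, hv⟩ := Measure.nonempty_support (IsProbabilityMeasure.ne_zero (πstar : Measure 𝒱))
  have : Finite 𝒳 := hk.finite hε fun x => hmixs x v hv v hv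
  have : Nonempty 𝒳 := by
    by_contra hne
    rw [not_nonempty_iff] at hne
    exact zero_ne_one (hasSum_empty.unique (hk_sum v v))
  have hε1 : ε ≤ 1 := hmixs.le_one hk
  refine ⟨RoundRobin.exists_stationaryExtension hk hn _,
    fun π hπ => RoundRobin.measurable_ell hk hε hε1 (hmixP π hπ) hn, ?_⟩
  intro Ω _ μ _ M
  refine ⟨fun q hq => ?_, fun π hπ => ?_⟩
  · filter_upwards [M.ae_agrees] with ω hω
    exact RoundRobin.tendstoUniformlyOn_condLogLik hk hε hε1 hmixP hn hω hq
  · exact ⟨RoundRobin.integrable_ell hk hε hε1 (hmixP π hπ) hn M,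
      M.tendsto_logLik hk hε hε1 (hmixP π hπ) hn, M.tendsto_logLik_L1 hk hε hε1 (hmixP π hπ) hn⟩
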